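/- Let $H\in(0,1)$ and let $R(s,t)=\frac12\left(s^{2H}+t^{2H}-|s-t|^{2H}\right)$ be the covariance function of fractional Brownian motion with Hurst parameter $H$. For $T>0$ let $\mathfrak H$ be the canonical Hilbert space of fractional Brownian motion on $[0,T]$, i.e. the completion of the linear span of the indicator functions $\mathbf 1_{[0,t]}$, $0\le t\le T$, under the inner product $\langle \mathbf 1_{[0,s]},\mathbf 1_{[0,t]}\rangle_{\mathfrak H}=R(s,t)$, and let $\mathfrak H^{\otimes2}$ be its Hilbert tensor square. A function $f\in L^2([0,T]^2)$ is regarded as an element of $\mathfrak H^{\otimes 2}$ if some sequence of linear combinations of functions $\mathbf 1_{[0,s]}\otimes\mathbf 1_{[0,t]}$, $s,t\in[0,T]$, is Cauchy in $\mathfrak H^{\otimes2}$ and converges to $f$ in $L^2([0,T]^2)$; its norm $\|f\|_{\mathfrak H^{\otimes 2}}$ is then the limit of the norms. Let $$f_T(t,s)=e^{-|t-s|}\mathbf 1_{\{0\le s,t\le T\}},\qquad a=H\,\Gamma(2H),\qquad \sigma^2=a^2(4H-1)\Bigl(1-\frac1{\cos(2H\pi)}\Bigr),$$ where for $H=\frac14$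 the product $(4H-1)\bigl(1-\frac1{\cos(2H\pi)}\bigr)$ is replaced by its limit $\frac2\pi$. Then for every $T>0$ the function $f_T$ belongs to $\mathfrak H^{\otimes2}$ with a well-defined norm, and the function $T\mapsto\frac12\|f_T\|^2_{\mathfrak H^{\otimes2}}$ has an oblique asymptote as $T\to\infty$ (that is, there are real $m\ne0$ and $b$ with $\frac12\|f_T\|^2_{\mathfrak H^{\otimes2}}-(mT+b)\to0$) if and only if $H\in(0,\frac12]$. When it exists, its slope is $m=\sigma^2$ and its intercept is $$b=-\frac{4H-1}{2}\,\sigma^2-(2H-1)(2H+1)\,a^2 .$$ -/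

import Mathlib

open MeasureTheory Filter Topology

namespace FBM

/-- The covariance `R(s,t) = (s^{2H} + t^{2H} - |s-t|^{2H}) / 2` of fractional Brownian motion
with Hurst parameter `H`. -/
noncomputable def cov (H s t : ℝ) : ℝ :=
  (s ^ (2 * H) + t ^ (2 * H) - |s - t| ^ (2 * H)) / 2

/-- Elementary functions of two variables, as formal linear combinations
`∑ c(s,t) • 1_{[0,s]} ⊗ 1_{[0,t]}` of tensor products of indicator functions. -/
abbrev Elem : Type := (ℝ × ℝ) →₀ ℝ

/-- The elementary function lives on `[0,T]²`: only indicators `1_{[0,s]} ⊗ 1_{[0,t]}` with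
`s, t ∈ [0,T]` occur in it. -/
def Elem.IsOn (T : ℝ) (φ : Elem) : Prop :=
  ∀ p ∈ φ.support, p.1 ∈ Set.Icc 0 T ∧ p.2 ∈ Set.Icc 0 T

/-- The function on `ℝ²` given by an elementary function:
`x ↦ ∑ c(s,t) 1_{[0,s]}(x₁) 1_{[0,t]}(x₂)`. -/
noncomputable def Elem.toFun (φ : Elem) (x : ℝ × ℝ) : ℝ :=
  φ.sum fun p c =>
    c * ((Set.Icc 0 p.1).indicator 1 x.1 * (Set.Icc 0 p.2).indicator 1 x.2)

/-- The inner product of `𝔥 ⊗ 𝔥` on elementary functions: the bilinear form determined by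
`⟨1_{[0,s]} ⊗ 1_{[0,t]}, 1_{[0,s']} ⊗ 1_{[0,t']}⟩ = R(s,s') R(t,t')`, which is what
`⟨1_{[0,s]}, 1_{[0,s']}⟩_𝔥 = R(s,s')` prescribes on tensor products. -/
noncomputable def Elem.tensorInner (H : ℝ) (φ ψ : Elem) : ℝ :=
  φ.sum fun p c => ψ.sum fun q d => c * d * (cov H p.1 q.1 * cov H p.2 q.2)

/-- `IsTensorNormSq H T f N`: the function `f` on `[0,T]²` belongs to `𝔥 ⊗ 𝔥` and
`‖f‖² = N` there. The space `𝔥 ⊗ 𝔥` is the completion of the elementary functions on `[0,T]²`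
under `Elem.tensorInner H`; a function `f` represents the limit of a Cauchy sequence of elementary
functions when that sequence also converges to `f` in `L²([0,T]²)`, and its squared norm is then
the limit of the squared norms. -/
def IsTensorNormSq (H T : ℝ) (f : ℝ × ℝ → ℝ) (N : ℝ) : Prop :=
  ∃ φ : ℕ → Elem,
    (∀ n, (φ n).IsOn T) ∧
    Tendsto (fun n => eLpNorm (fun x => (φ n).toFun x - f x) 2
      (volume.restrict (Set.Icc 0 T ×ˢ Set.Icc 0 T))) atTop (𝓝 0) ∧
    (∀ ε > 0, ∃ n₀, ∀ m ≥ n₀, ∀ n ≥ n₀,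
      Elem.tensorInner H (φ m - φ n) (φ m - φ n) < ε) ∧
    Tendsto (fun n => Elem.tensorInner H (φ n) (φ n)) atTop (𝓝 N)

/-- `‖f‖²` in `𝔥 ⊗ 𝔥` over `[0,T]`: the number `N` with `IsTensorNormSq H T f N`
(meaningful when there is exactly one such `N`). -/
noncomputable def tensorNormSq (H T : ℝ) (f : ℝ × ℝ → ℝ) : ℝ :=
  Classical.epsilon (IsTensorNormSq H T f)

/-- `f_T(t,s) = e^{-|t-s|} 1_{0 ≤ s,t ≤ T}`. -/
noncomputable def fT (T : ℝ) : ℝ × ℝ → ℝ :=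
  (Set.Icc 0 T ×ˢ Set.Icc 0 T).indicator fun x => Real.exp (-|x.1 - x.2|)

/-- `a = H Γ(2H)`. -/
noncomputable def a (H : ℝ) : ℝ := H * Real.Gamma (2 * H)

open Classical in
/-- `σ_H² = (4H-1)(1 - 1/cos(2Hπ))`, with its limit value `2/π` at `H = 1/4`, where the
cosine vanishes. -/
noncomputable def sigmaHSq (H : ℝ) : ℝ :=
  if H = 1 / 4 then 2 / Real.pi
  else (4 * H - 1) * (1 - 1 / Real.cos (2 * H * Real.pi))

/-- `σ² = a² σ_H²`. -/
noncomputable def sigmaSq (H : ℝ) : ℝ := a H ^ 2 * sigmaHSq H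

/-- The line `y = m T + b`, neither vertical nor horizontal, is an asymptote of `F` at `+∞`. -/
def HasObliqueAsymptote (F : ℝ → ℝ) (m b : ℝ) : Prop :=
  m ≠ 0 ∧ Tendsto (fun T => F T - (m * T + b)) atTop (𝓝 0)

end FBM

namespace FBM

/-! Spectral side. Let μ be `specMeasure H`, with density proportional to |ξ|^(1-2H). Sending
1_[0,s] to its Fourier transform is an isometry into L²(μ), so the norm of f in the tensor square is
the L²(μ ⊗ μ) norm of its Fourier transform. `eq_integral_of_isTensorNormSq` gives this for every
admissible sequence, hence uniqueness. Existence, in `isTensorNormSq_fT`, comes from grid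
discretizations whose coefficients have uniformly bounded total variation, so that their transforms
are dominated.

Closed form. On [0,T]² the kernel e^(-|x-y|) is the mixture of rank-one tensors e_u ⊗ e_u against
δ_T + 2 du, where e_u is an exponential started at T - u (`exp_neg_abs_sub_eq_integral`). Hence
‖f_T‖² is the double integral of ⟨e_u, e_v⟩², and ⟨e_u, e_v⟩ = ρ(u,v) is γ(u-v) plus corrections
carrying a factor e^(-u) or e^(-v). Here γ(x) = ∫ cos(xξ)/(1+ξ²) dμ is `gam`. With G(x) = ∫_0^x γ²,
the growing part of half the squared norm is 4 ∫_0^T G = 4 (T G(T) - ∫_0^T xγ²) (`normFun_eq`,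
`integral_gamSqPrim`).

Case H ≤ 1/2. Here γ = O(x^(-θ)) with θ > 1 (`exists_abs_gam_le`), so all the integrals converge and
the slope is 4 ∫ γ², evaluated by Plancherel and a Beta integral (`four_mul_integral_gam_sq`). The
intercept is explicit because the spectral density is a pure power. Let g be the convolution of γ
with e^(-|x|) and Γ the primitive of γ. Then g'' = g - 2γ and g' = (2H-1)Γ - xγ (`gamConv'_eq`),
hence xγ' = 2Hγ - g, and the integrals of xγ², γg and γg' follow by integrating total derivatives.

Case H > 1/2. Here γ ≥ c/x for x ≥ 1 (`exists_gam_ge`), so ∫_0^T xγ² grows at least logarithmically,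
while everything outside 4 ∫_0^T G is O(1 + G(T)). An affine asymptote mT + b would force G to be
bounded with 4G ≤ m, and then ∫_0^T xγ² would stay bounded (`not_tendsto_normFun_sub`). -/

variable {H : ℝ}

/-! ### Beta-type integrals on the half-line -/

theorem integrableOn_prod_rpow_exp {s k : ℝ} (hs : 0 < s) (hk : s / 2 < k) :
    Integrable (fun z : ℝ × ℝ => z.1 ^ (s - 1) * (z.2 ^ (k - 1) * Real.exp (-(1 + z.1 ^ 2) * z.2)))
      ((volume.restrict (Set.Ioi 0)).prod (volume.restrict (Set.Ioi 0))) := by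
  have hm : AEStronglyMeasurable
      (fun z : ℝ × ℝ => z.1 ^ (s - 1) * (z.2 ^ (k - 1) * Real.exp (-(1 + z.1 ^ 2) * z.2)))
      ((volume.restrict (Set.Ioi 0)).prod (volume.restrict (Set.Ioi 0))) := by
    apply Measurable.aestronglyMeasurable
    fun_prop
  rw [integrable_prod_iff' hm]
  have key : ∀ t : ℝ, ∀ x : ℝ, x ^ (s - 1) * (t ^ (k - 1) * Real.exp (-(1 + x ^ 2) * t))
      = (t ^ (k - 1) * Real.exp (-t)) * (x ^ (s - 1) * Real.exp (-t * x ^ (2 : ℝ))) := by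
    intro t x
    rw [show -(1 + x ^ 2) * t = -t + -t * x ^ (2 : ℝ) by rw [Real.rpow_two]; ring, Real.exp_add]
    ring
  constructor
  · filter_upwards [ae_restrict_mem measurableSet_Ioi] with t ht
    simp_rw [key]
    exact (integrableOn_rpow_mul_exp_neg_mul_rpow (by linarith) (by norm_num) ht).const_mul _
  · have h1 : IntegrableOn (fun t : ℝ => (1 / 2 * Real.Gamma (s / 2)) *
        (Real.exp (-t) * t ^ (k - s / 2 - 1))) (Set.Ioi 0) :=
      (Real.GammaIntegral_convergent (by linarith)).const_mul _
    refine h1.congr_fun ?_ measurableSet_Ioi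
    intro t ht
    have ht' : (0 : ℝ) < t := ht
    have : ∫ x in Set.Ioi (0 : ℝ), ‖x ^ (s - 1) * (t ^ (k - 1) * Real.exp (-(1 + x ^ 2) * t))‖
        = (t ^ (k - 1) * Real.exp (-t)) *
          ∫ x in Set.Ioi (0 : ℝ), x ^ (s - 1) * Real.exp (-t * x ^ (2 : ℝ)) := by
      rw [← integral_const_mul]
      refine setIntegral_congr_fun measurableSet_Ioi fun x hx => ?_
      have hx' : (0 : ℝ) < x := hx
      rw [key, Real.norm_of_nonneg (by positivity)]
    dsimp only
    rw [this, integral_rpow_mul_exp_neg_mul_rpow (by norm_num) (by linarith) ht',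
      show k - s / 2 - 1 = (k - 1) + -(s - 1 + 1) / 2 by ring, Real.rpow_add ht']
    ring_nf

/-- Fubini for x^(s-1) t^(k-1) e^(-(1+x²)t). The t-integral produces Γ(k)(1+x²)^(-k); the x-integral
is a Gaussian moment and leaves a Gamma integral of order k - s/2. The case k = 1 gives the variance
γ(0), the case k = 2 the slope. -/
theorem integrableOn_rpow_mul_one_add_sq_rpow {s k : ℝ} (hs : 0 < s) (hk : s / 2 < k) :
    IntegrableOn (fun x : ℝ => x ^ (s - 1) * (1 + x ^ 2) ^ (-k)) (Set.Ioi 0) ∧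
    ∫ x in Set.Ioi (0 : ℝ), x ^ (s - 1) * (1 + x ^ 2) ^ (-k)
      = Real.Gamma (s / 2) * Real.Gamma (k - s / 2) / (2 * Real.Gamma k) := by
  have hk0 : 0 < k := by linarith
  have hG : Real.Gamma k ≠ 0 := (Real.Gamma_pos_of_pos hk0).ne'
  have hint := integrableOn_prod_rpow_exp hs hk
  have inner1 : ∀ x : ℝ, ∫ t in Set.Ioi (0 : ℝ),
      x ^ (s - 1) * (t ^ (k - 1) * Real.exp (-(1 + x ^ 2) * t))
      = Real.Gamma k * (x ^ (s - 1) * (1 + x ^ 2) ^ (-k)) := by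
    intro x
    rw [integral_const_mul]
    have := Real.integral_rpow_mul_exp_neg_mul_Ioi hk0 (r := 1 + x ^ 2) (by positivity)
    simp_rw [neg_mul]
    rw [this, one_div, Real.inv_rpow (by positivity), Real.rpow_neg (by positivity)]
    ring
  have inner2 : ∀ t ∈ Set.Ioi (0 : ℝ), ∫ x in Set.Ioi (0 : ℝ),
      x ^ (s - 1) * (t ^ (k - 1) * Real.exp (-(1 + x ^ 2) * t))
      = (1 / 2 * Real.Gamma (s / 2)) * (Real.exp (-t) * t ^ (k - s / 2 - 1)) := by
    intro t ht
    have ht' : (0 : ℝ) < t := ht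
    have key : ∀ x : ℝ, x ^ (s - 1) * (t ^ (k - 1) * Real.exp (-(1 + x ^ 2) * t))
      = (t ^ (k - 1) * Real.exp (-t)) * (x ^ (s - 1) * Real.exp (-t * x ^ (2 : ℝ))) := by
      intro x
      rw [show -(1 + x ^ 2) * t = -t + -t * x ^ (2 : ℝ) by rw [Real.rpow_two]; ring, Real.exp_add]
      ring
    simp_rw [key]
    rw [integral_const_mul, integral_rpow_mul_exp_neg_mul_rpow (by norm_num) (by linarith) ht',
      show k - s / 2 - 1 = (k - 1) + -(s - 1 + 1) / 2 by ring, Real.rpow_add ht']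
    ring_nf
  constructor
  · have h := hint.integral_prod_left
    simp only [inner1] at h
    have h2 := h.const_mul (Real.Gamma k)⁻¹
    refine h2.congr (ae_of_all _ fun x => ?_)
    simp only
    field_simp
  · have hsw := integral_integral_swap (f := fun x t : ℝ =>
      x ^ (s - 1) * (t ^ (k - 1) * Real.exp (-(1 + x ^ 2) * t))) hint
    simp only [inner1] at hsw
    rw [setIntegral_congr_fun measurableSet_Ioi inner2, integral_const_mul, integral_const_mul,
      ← Real.Gamma_eq_integral (by linarith)] at hsw
    rw [eq_div_iff (by positivity)]
    linear_combination 2 * hsw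


/-! ### The spectral measure of fractional Brownian motion -/

theorem integrable_comp_abs {f : ℝ → ℝ} (hf : IntegrableOn f (Set.Ioi 0)) :
    Integrable fun x => f |x| := by
  have := (integrable_fun_norm_addHaar (volume : Measure ℝ) (f := f)).2 (by simpa using hf)
  simpa using this

theorem integrable_weight_div {H : ℝ} (hH0 : 0 < H) (hH1 : H < 1) :
    Integrable fun ξ : ℝ => |ξ| ^ (1 - 2 * H) * (1 + ξ ^ 2)⁻¹ := by
  have h := (integrableOn_rpow_mul_one_add_sq_rpow (s := 2 - 2 * H) (k := 1)
    (by linarith) (by linarith)).1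
  have := integrable_comp_abs h
  refine this.congr (ae_of_all _ fun x => ?_)
  simp only [sq_abs]
  rw [Real.rpow_neg_one]
  ring_nf

theorem two_sub_two_cos_nonneg (x : ℝ) : 0 ≤ 2 - 2 * Real.cos x := by
  linarith [Real.cos_le_one x]

theorem two_sub_two_cos_le_sq (x : ℝ) : 2 - 2 * Real.cos x ≤ x ^ 2 := by
  linarith [Real.one_sub_sq_div_two_le_cos (x := x)]

/-- The numerator is at most (tξ)² and at most 4; after multiplication by 1 + ξ² the first bound
serves the term 1 and the second the term ξ². -/
theorem two_sub_two_cos_div_sq_le (t ξ : ℝ) :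
    (2 - 2 * Real.cos (t * ξ)) / ξ ^ 2 ≤ (t ^ 2 + 4) * (1 + ξ ^ 2)⁻¹ := by
  rcases eq_or_ne ξ 0 with rfl | h
  · simp; positivity
  have hξ : 0 < ξ ^ 2 := by positivity
  rw [div_le_iff₀ hξ, mul_assoc, ← div_eq_inv_mul, mul_div_assoc', le_div_iff₀ (by positivity)]
  nlinarith [two_sub_two_cos_le_sq (t * ξ), Real.neg_one_le_cos (t * ξ),
    two_sub_two_cos_nonneg (t * ξ)]

theorem integrable_two_sub_two_cos {H : ℝ} (hH0 : 0 < H) (hH1 : H < 1) (t : ℝ) :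
    Integrable fun ξ : ℝ => (2 - 2 * Real.cos (t * ξ)) / ξ ^ 2 * |ξ| ^ (1 - 2 * H) := by
  refine ((integrable_weight_div hH0 hH1).const_mul (t ^ 2 + 4)).mono' ?_ (ae_of_all _ fun ξ => ?_)
  · apply Measurable.aestronglyMeasurable; fun_prop
  · have h0 : 0 ≤ |ξ| ^ (1 - 2 * H) := by positivity
    have h1 : 0 ≤ (2 - 2 * Real.cos (t * ξ)) / ξ ^ 2 :=
      div_nonneg (two_sub_two_cos_nonneg _) (sq_nonneg _)
    rw [Real.norm_of_nonneg (mul_nonneg h1 h0)]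
    calc _ ≤ (t ^ 2 + 4) * (1 + ξ ^ 2)⁻¹ * |ξ| ^ (1 - 2 * H) :=
          mul_le_mul_of_nonneg_right (two_sub_two_cos_div_sq_le t ξ) h0
      _ = _ := by ring

/-- The inverse of the constant normalizing the spectral measure. -/
noncomputable def specInt (H : ℝ) : ℝ :=
  ∫ ξ : ℝ, (2 - 2 * Real.cos ξ) / ξ ^ 2 * |ξ| ^ (1 - 2 * H)

theorem specInt_pos {H : ℝ} (hH0 : 0 < H) (hH1 : H < 1) : 0 < specInt H := by
  have hint := integrable_two_sub_two_cos hH0 hH1 1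
  simp only [one_mul] at hint
  have hnn : ∀ ξ : ℝ, 0 ≤ (2 - 2 * Real.cos ξ) / ξ ^ 2 * |ξ| ^ (1 - 2 * H) := fun ξ =>
    mul_nonneg (div_nonneg (two_sub_two_cos_nonneg _) (sq_nonneg _)) (by positivity)
  unfold specInt
  rw [integral_pos_iff_support_of_nonneg hnn hint]
  refine lt_of_lt_of_le ?_ (measure_mono (s := Set.Ioo 0 1) fun ξ hξ => ?_)
  · simp
  · have h1 : Real.cos ξ < 1 := by
      have := Real.cos_lt_cos_of_nonneg_of_le_pi_div_two le_rfl
        (by linarith [hξ.2, Real.pi_gt_three] : ξ ≤ Real.pi / 2) hξ.1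
      simpa using this
    have h0 : 0 < ξ := hξ.1
    have : 0 < (2 - 2 * Real.cos ξ) / ξ ^ 2 * |ξ| ^ (1 - 2 * H) :=
      mul_pos (div_pos (by linarith) (by positivity)) (Real.rpow_pos_of_pos (abs_pos.2 h0.ne') _)
    exact this.ne'

/-- Substitute tξ for ξ: the weight is homogeneous of degree 1 - 2H, and with the factor t² and the
Jacobian this leaves |t|^(2H). -/
theorem integral_two_sub_two_cos {H : ℝ} (hH0 : 0 < H) (t : ℝ) :
    ∫ ξ : ℝ, (2 - 2 * Real.cos (t * ξ)) / ξ ^ 2 * |ξ| ^ (1 - 2 * H)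
      = |t| ^ (2 * H) * specInt H := by
  rcases eq_or_ne t 0 with rfl | ht
  · simp [Real.zero_rpow (by positivity : 2 * H ≠ 0)]
  have h := Measure.integral_comp_mul_left
    (fun ξ : ℝ => (2 - 2 * Real.cos ξ) / ξ ^ 2 * |ξ| ^ (1 - 2 * H)) t
  have h2 : ∀ ξ : ℝ, (2 - 2 * Real.cos (t * ξ)) / (t * ξ) ^ 2 * |t * ξ| ^ (1 - 2 * H)
      = (|t| ^ (1 - 2 * H) / t ^ 2) *
        ((2 - 2 * Real.cos (t * ξ)) / ξ ^ 2 * |ξ| ^ (1 - 2 * H)) := by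
    intro ξ
    rw [abs_mul, Real.mul_rpow (abs_nonneg _) (abs_nonneg _), mul_pow]
    ring
  simp_rw [h2] at h
  rw [integral_const_mul, smul_eq_mul, abs_inv] at h
  have hta : 0 < |t| := abs_pos.2 ht
  have h3 : |t| ^ (1 - 2 * H) = |t| * (|t| ^ (2 * H))⁻¹ := by
    rw [Real.rpow_sub hta, Real.rpow_one]; rfl
  have h4 : 0 < |t| ^ (2 * H) := Real.rpow_pos_of_pos hta _
  rw [h3, ← sq_abs t] at h
  change _ = _ * specInt H at h
  generalize (∫ ξ : ℝ, (2 - 2 * Real.cos (t * ξ)) / ξ ^ 2 * |ξ| ^ (1 - 2 * H)) = I at h ⊢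
  field_simp at h
  linarith

/-- The spectral measure of fractional Brownian motion. -/
noncomputable def specMeasure (H : ℝ) : Measure ℝ :=
  volume.withDensity fun ξ => ENNReal.ofReal ((specInt H)⁻¹ * |ξ| ^ (1 - 2 * H))

instance (H : ℝ) : SFinite (specMeasure H) := by
  unfold specMeasure; infer_instance

theorem specMeasure_density_measurable (H : ℝ) :
    Measurable fun ξ : ℝ => (specInt H)⁻¹ * |ξ| ^ (1 - 2 * H) := by fun_prop

theorem specMeasure_density_nonneg {H : ℝ} (hH0 : 0 < H) (hH1 : H < 1) (ξ : ℝ) :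
    0 ≤ (specInt H)⁻¹ * |ξ| ^ (1 - 2 * H) :=
  mul_nonneg (inv_nonneg.2 (specInt_pos hH0 hH1).le) (by positivity)

theorem integral_specMeasure {E : Type*} [NormedAddCommGroup E] [NormedSpace ℝ E]
    {H : ℝ} (hH0 : 0 < H) (hH1 : H < 1) (f : ℝ → E) :
    ∫ ξ, f ξ ∂(specMeasure H) = ∫ ξ, ((specInt H)⁻¹ * |ξ| ^ (1 - 2 * H)) • f ξ := by
  unfold specMeasure
  rw [integral_withDensity_eq_integral_toReal_smul
    (specMeasure_density_measurable H).ennreal_ofReal (ae_of_all _ fun _ => ENNReal.ofReal_lt_top)]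
  simp_rw [ENNReal.toReal_ofReal (specMeasure_density_nonneg hH0 hH1 _)]

theorem integrable_specMeasure_iff {E : Type*} [NormedAddCommGroup E] [NormedSpace ℝ E]
    {H : ℝ} (hH0 : 0 < H) (hH1 : H < 1) (f : ℝ → E) :
    Integrable f (specMeasure H) ↔
      Integrable fun ξ => ((specInt H)⁻¹ * |ξ| ^ (1 - 2 * H)) • f ξ := by
  unfold specMeasure
  rw [integrable_withDensity_iff_integrable_smul'
    (specMeasure_density_measurable H).ennreal_ofReal (ae_of_all _ fun _ => ENNReal.ofReal_lt_top)]
  simp_rw [ENNReal.toReal_ofReal (specMeasure_density_nonneg hH0 hH1 _)]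

theorem integrable_inv_one_add_sq_specMeasure {H : ℝ} (hH0 : 0 < H) (hH1 : H < 1) :
    Integrable (fun ξ : ℝ => (1 + ξ ^ 2)⁻¹) (specMeasure H) := by
  rw [integrable_specMeasure_iff hH0 hH1]
  refine ((integrable_weight_div hH0 hH1).const_mul (specInt H)⁻¹).congr (ae_of_all _ fun ξ => ?_)
  simp only [smul_eq_mul]; ring

theorem integrable_two_sub_two_cos_specMeasure {H : ℝ} (hH0 : 0 < H) (hH1 : H < 1) (t : ℝ) :
    Integrable (fun ξ : ℝ => (2 - 2 * Real.cos (t * ξ)) / ξ ^ 2) (specMeasure H) := by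
  rw [integrable_specMeasure_iff hH0 hH1]
  refine ((integrable_two_sub_two_cos hH0 hH1 t).const_mul (specInt H)⁻¹).congr
    (ae_of_all _ fun ξ => ?_)
  simp only [smul_eq_mul]; ring

theorem integral_two_sub_two_cos_specMeasure {H : ℝ} (hH0 : 0 < H) (hH1 : H < 1) (t : ℝ) :
    ∫ ξ : ℝ, (2 - 2 * Real.cos (t * ξ)) / ξ ^ 2 ∂(specMeasure H) = |t| ^ (2 * H) := by
  rw [integral_specMeasure hH0 hH1]
  have : ∀ ξ : ℝ, ((specInt H)⁻¹ * |ξ| ^ (1 - 2 * H)) • ((2 - 2 * Real.cos (t * ξ)) / ξ ^ 2)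
      = (specInt H)⁻¹ * ((2 - 2 * Real.cos (t * ξ)) / ξ ^ 2 * |ξ| ^ (1 - 2 * H)) := by
    intro ξ; simp only [smul_eq_mul]; ring
  simp_rw [this]
  rw [integral_const_mul, integral_two_sub_two_cos hH0]
  have := (specInt_pos hH0 hH1).ne'
  field_simp

theorem integral_comp_neg_specMeasure {E : Type*} [NormedAddCommGroup E] [NormedSpace ℝ E]
    {H : ℝ} (hH0 : 0 < H) (hH1 : H < 1) (f : ℝ → E) :
    ∫ ξ, f (-ξ) ∂(specMeasure H) = ∫ ξ, f ξ ∂(specMeasure H) := by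
  rw [integral_specMeasure hH0 hH1, integral_specMeasure hH0 hH1, ← integral_neg_eq_self]
  simp

theorem integral_odd_specMeasure {H : ℝ} (hH0 : 0 < H) (hH1 : H < 1) {f : ℝ → ℝ}
    (hf : ∀ ξ, f (-ξ) = - f ξ) : ∫ ξ, f ξ ∂(specMeasure H) = 0 := by
  have := integral_comp_neg_specMeasure hH0 hH1 f
  simp_rw [hf, integral_neg] at this
  linarith


/-! ### Trigonometric integrals: differentiation and the Riemann–Lebesgue lemma -/

theorem integrable_cos_mul {ν : Measure ℝ} {f : ℝ → ℝ} (hf : Integrable f ν) (u : ℝ) :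
    Integrable (fun ξ => Real.cos (u * ξ) * f ξ) ν := by
  refine hf.bdd_mul (c := 1) (Measurable.aestronglyMeasurable (by fun_prop))
    (ae_of_all _ fun ξ => ?_)
  exact Real.abs_cos_le_one _

theorem integrable_sin_mul {ν : Measure ℝ} {f : ℝ → ℝ} (hf : Integrable f ν) (u : ℝ) :
    Integrable (fun ξ => Real.sin (u * ξ) * f ξ) ν := by
  refine hf.bdd_mul (c := 1) (Measurable.aestronglyMeasurable (by fun_prop))
    (ae_of_all _ fun ξ => ?_)
  exact Real.abs_sin_le_one _

/-- The bound |sin(uξ)| ≤ |uξ| replaces integrability of f. It is needed for f = 1/(ξ(1+ξ²)), which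
is not integrable at the origin against the spectral measure once H ≥ 1/2. -/
theorem integrable_sin_mul' {ν : Measure ℝ} {f : ℝ → ℝ} (hf : AEStronglyMeasurable f ν)
    (hf' : Integrable (fun ξ => ξ * f ξ) ν) (u : ℝ) :
    Integrable (fun ξ => Real.sin (u * ξ) * f ξ) ν := by
  refine (hf'.norm.const_mul |u|).mono' ?_ (ae_of_all _ fun ξ => ?_)
  · exact (Measurable.aestronglyMeasurable (by fun_prop)).mul hf
  · rw [norm_mul, norm_mul, ← mul_assoc, Real.norm_eq_abs, Real.norm_eq_abs ξ, ← abs_mul]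
    exact mul_le_mul_of_nonneg_right (Real.abs_sin_le_abs) (norm_nonneg _)

theorem hasDerivAt_integral_cos {ν : Measure ℝ} {f : ℝ → ℝ} (hf : Integrable f ν)
    (hf' : Integrable (fun ξ => ξ * f ξ) ν) (u : ℝ) :
    HasDerivAt (fun u => ∫ ξ, Real.cos (u * ξ) * f ξ ∂ν)
      (-∫ ξ, Real.sin (u * ξ) * (ξ * f ξ) ∂ν) u := by
  rw [← integral_neg]
  refine (hasDerivAt_integral_of_dominated_loc_of_deriv_le
    (F := fun u ξ => Real.cos (u * ξ) * f ξ)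
    (F' := fun u ξ => -(Real.sin (u * ξ) * (ξ * f ξ)))
    (bound := fun ξ => ‖ξ * f ξ‖) univ_mem ?_ ?_ ?_ ?_ hf'.norm ?_).2
  · exact Eventually.of_forall fun u => (integrable_cos_mul hf u).aestronglyMeasurable
  · exact integrable_cos_mul hf u
  · exact (integrable_sin_mul hf' u).aestronglyMeasurable.neg
  · refine ae_of_all _ fun ξ x _ => ?_
    rw [norm_neg, norm_mul]
    exact mul_le_of_le_one_left (norm_nonneg _) (Real.abs_sin_le_one _)
  · refine ae_of_all _ fun ξ x _ => ?_
    have h := ((hasDerivAt_mul_const ξ (x := x)).cos).mul_const (f ξ)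
    exact h.congr_deriv (by ring)

theorem hasDerivAt_integral_sin {ν : Measure ℝ} {f : ℝ → ℝ} (hf : AEStronglyMeasurable f ν)
    (hf' : Integrable (fun ξ => ξ * f ξ) ν) (u : ℝ) :
    HasDerivAt (fun u => ∫ ξ, Real.sin (u * ξ) * f ξ ∂ν)
      (∫ ξ, Real.cos (u * ξ) * (ξ * f ξ) ∂ν) u := by
  refine (hasDerivAt_integral_of_dominated_loc_of_deriv_le
    (F := fun u ξ => Real.sin (u * ξ) * f ξ)
    (F' := fun u ξ => (Real.cos (u * ξ) * (ξ * f ξ)))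
    (bound := fun ξ => ‖ξ * f ξ‖) univ_mem ?_ ?_ ?_ ?_ hf'.norm ?_).2
  · exact Eventually.of_forall fun u => (integrable_sin_mul' hf hf' u).aestronglyMeasurable
  · exact integrable_sin_mul' hf hf' u
  · exact (integrable_cos_mul hf' u).aestronglyMeasurable
  · refine ae_of_all _ fun ξ x _ => ?_
    rw [norm_mul]
    exact mul_le_of_le_one_left (norm_nonneg _) (Real.abs_cos_le_one _)
  · refine ae_of_all _ fun ξ x _ => ?_
    have h := ((hasDerivAt_mul_const ξ (x := x)).sin).mul_const (f ξ)
    exact h.congr_deriv (by ring)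

theorem tendsto_integral_cexp_atTop {f : ℝ → ℝ} :
    Tendsto (fun u : ℝ => ∫ ξ, Complex.exp (-(u * ξ : ℝ) * Complex.I) * (f ξ : ℂ)) atTop (𝓝 0) := by
  have h := (Real.tendsto_integral_exp_smul_cocompact (fun ξ : ℝ => (f ξ : ℂ))).mono_left
    atTop_le_cocompact
  -- The standard character is e^(2πix), so the frequency is rescaled by 2π.
  have h2 : Tendsto (fun u : ℝ => u * (2 * Real.pi)⁻¹) atTop atTop :=
    tendsto_id.atTop_mul_const (by positivity)
  refine (h.comp h2).congr fun u => ?_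
  simp only [Function.comp]
  refine integral_congr_ae (ae_of_all _ fun ξ => ?_)
  simp only [Circle.smul_def, Real.fourierChar_apply, smul_eq_mul]
  congr 2
  push_cast
  have : (Real.pi : ℂ) ≠ 0 := by exact_mod_cast Real.pi_ne_zero
  field_simp

theorem tendsto_integral_cos_atTop {f : ℝ → ℝ} (hf : Integrable f) :
    Tendsto (fun u : ℝ => ∫ ξ, Real.cos (u * ξ) * f ξ) atTop (𝓝 0) := by
  have h := (Complex.continuous_re.tendsto 0).comp (tendsto_integral_cexp_atTop (f := f))
  refine h.congr fun u => ?_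
  have hi : Integrable fun ξ => Complex.exp (-(u * ξ : ℝ) * Complex.I) * (f ξ : ℂ) := by
    refine (hf.ofReal (𝕜 := ℂ)).bdd_mul (c := 1) (Measurable.aestronglyMeasurable (by fun_prop))
      (ae_of_all _ fun ξ => ?_)
    rw [← Complex.ofReal_neg, Complex.norm_exp_ofReal_mul_I]
  rw [Function.comp]
  refine (integral_re hi).symm.trans (integral_congr_ae (ae_of_all _ fun ξ => ?_))
  simp only [← Complex.ofReal_neg, RCLike.re_to_complex]
  rw [Complex.re_mul_ofReal, Complex.exp_ofReal_mul_I_re, Real.cos_neg]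

theorem tendsto_integral_sin_atTop {f : ℝ → ℝ} (hf : Integrable f) :
    Tendsto (fun u : ℝ => ∫ ξ, Real.sin (u * ξ) * f ξ) atTop (𝓝 0) := by
  have h := (Complex.continuous_im.tendsto 0).comp (tendsto_integral_cexp_atTop (f := f))
  rw [Complex.zero_im] at h
  rw [← neg_zero]
  refine h.neg.congr fun u => ?_
  have hi : Integrable fun ξ => Complex.exp (-(u * ξ : ℝ) * Complex.I) * (f ξ : ℂ) := by
    refine (hf.ofReal (𝕜 := ℂ)).bdd_mul (c := 1) (Measurable.aestronglyMeasurable (by fun_prop))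
      (ae_of_all _ fun ξ => ?_)
    rw [← Complex.ofReal_neg, Complex.norm_exp_ofReal_mul_I]
  rw [Function.comp, neg_eq_iff_eq_neg, ← integral_neg]
  refine (integral_im hi).symm.trans (integral_congr_ae (ae_of_all _ fun ξ => ?_))
  simp only [← Complex.ofReal_neg, RCLike.im_to_complex]
  rw [Complex.im_mul_ofReal, Complex.exp_ofReal_mul_I_im, Real.sin_neg]
  ring

theorem tendsto_integral_cos_specMeasure (hH0 : 0 < H) (hH1 : H < 1) {f : ℝ → ℝ}
    (hf : Integrable f (specMeasure H)) :
    Tendsto (fun u : ℝ => ∫ ξ, Real.cos (u * ξ) * f ξ ∂(specMeasure H)) atTop (𝓝 0) := by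
  have h := tendsto_integral_cos_atTop ((integrable_specMeasure_iff hH0 hH1 f).1 hf)
  refine h.congr fun u => ?_
  rw [integral_specMeasure hH0 hH1]
  refine integral_congr_ae (ae_of_all _ fun ξ => ?_)
  simp only [smul_eq_mul]; ring

theorem tendsto_integral_sin_specMeasure (hH0 : 0 < H) (hH1 : H < 1) {f : ℝ → ℝ}
    (hf : Integrable f (specMeasure H)) :
    Tendsto (fun u : ℝ => ∫ ξ, Real.sin (u * ξ) * f ξ ∂(specMeasure H)) atTop (𝓝 0) := by
  have h := tendsto_integral_sin_atTop ((integrable_specMeasure_iff hH0 hH1 f).1 hf)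
  refine h.congr fun u => ?_
  rw [integral_specMeasure hH0 hH1]
  refine integral_congr_ae (ae_of_all _ fun ξ => ?_)
  simp only [smul_eq_mul]; ring

/-! ### The stationary covariance, its exponential convolution and its primitive -/

/-- The covariance function of the stationary fractional Ornstein-Uhlenbeck process. -/
noncomputable def gam (H x : ℝ) : ℝ := ∫ ξ, Real.cos (x * ξ) * (1 + ξ ^ 2)⁻¹ ∂(specMeasure H)

/-- The convolution of `gam H` with `exp (-|x|)`. -/
noncomputable def gamConv (H x : ℝ) : ℝ :=
  2 * ∫ ξ, Real.cos (x * ξ) * ((1 + ξ ^ 2)⁻¹) ^ 2 ∂(specMeasure H)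

/-- The derivative of `gamConv`. -/
noncomputable def gamConv' (H x : ℝ) : ℝ :=
  -(2 * ∫ ξ, Real.sin (x * ξ) * (ξ * ((1 + ξ ^ 2)⁻¹) ^ 2) ∂(specMeasure H))

/-- The primitive of `gam`. -/
noncomputable def gamPrim (H x : ℝ) : ℝ :=
  ∫ ξ, Real.sin (x * ξ) * (ξ⁻¹ * (1 + ξ ^ 2)⁻¹) ∂(specMeasure H)

theorem inv_one_add_sq_nonneg (ξ : ℝ) : 0 ≤ (1 + ξ ^ 2)⁻¹ := by positivity

theorem inv_one_add_sq_le_one (ξ : ℝ) : (1 + ξ ^ 2)⁻¹ ≤ 1 :=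
  inv_le_one_of_one_le₀ (by nlinarith [sq_nonneg ξ])

theorem integrable_of_le_inv_one_add_sq (hH0 : 0 < H) (hH1 : H < 1) {f : ℝ → ℝ}
    (hf : Measurable f) {C : ℝ} (h : ∀ ξ, |f ξ| ≤ C * (1 + ξ ^ 2)⁻¹) :
    Integrable f (specMeasure H) :=
  ((integrable_inv_one_add_sq_specMeasure hH0 hH1).const_mul C).mono' hf.aestronglyMeasurable
    (ae_of_all _ h)

theorem integrable_inv_sq (hH0 : 0 < H) (hH1 : H < 1) :
    Integrable (fun ξ : ℝ => ((1 + ξ ^ 2)⁻¹) ^ 2) (specMeasure H) := by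
  refine integrable_of_le_inv_one_add_sq hH0 hH1 (by fun_prop) (C := 1) fun ξ => ?_
  rw [abs_of_nonneg (by positivity)]
  nlinarith [inv_one_add_sq_nonneg ξ, inv_one_add_sq_le_one ξ]

theorem integrable_mul_inv_sq (hH0 : 0 < H) (hH1 : H < 1) :
    Integrable (fun ξ : ℝ => ξ * ((1 + ξ ^ 2)⁻¹) ^ 2) (specMeasure H) := by
  refine integrable_of_le_inv_one_add_sq hH0 hH1 (by fun_prop) (C := 1) fun ξ => ?_
  rw [abs_mul, abs_of_nonneg (a := ((1 + ξ ^ 2)⁻¹) ^ 2) (by positivity), sq, ← mul_assoc]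
  refine mul_le_mul_of_nonneg_right ?_ (inv_one_add_sq_nonneg ξ)
  rw [← div_eq_mul_inv, div_le_one (by positivity)]
  nlinarith [sq_nonneg (|ξ| - 1), sq_abs ξ]

theorem integrable_sq_mul_inv_sq (hH0 : 0 < H) (hH1 : H < 1) :
    Integrable (fun ξ : ℝ => ξ * (ξ * ((1 + ξ ^ 2)⁻¹) ^ 2)) (specMeasure H) := by
  refine integrable_of_le_inv_one_add_sq hH0 hH1 (by fun_prop) (C := 1) fun ξ => ?_
  have : ξ * (ξ * ((1 + ξ ^ 2)⁻¹) ^ 2) = ξ ^ 2 / (1 + ξ ^ 2) * (1 + ξ ^ 2)⁻¹ := by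
    field_simp
  rw [this, abs_of_nonneg (by positivity)]
  refine mul_le_mul_of_nonneg_right ?_ (inv_one_add_sq_nonneg ξ)
  rw [div_le_one (by positivity)]
  linarith

theorem integrable_mul_inv_mul (hH0 : 0 < H) (hH1 : H < 1) :
    Integrable (fun ξ : ℝ => ξ * (ξ⁻¹ * (1 + ξ ^ 2)⁻¹)) (specMeasure H) := by
  refine integrable_of_le_inv_one_add_sq hH0 hH1 (by fun_prop) (C := 1) fun ξ => ?_
  rcases eq_or_ne ξ 0 with rfl | h
  · simp
  · rw [mul_inv_cancel_left₀ h, abs_of_nonneg (by positivity), one_mul]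

theorem specMeasure_ae_ne_zero : ∀ᵐ ξ ∂(specMeasure H), ξ ≠ 0 := by
  have h : specMeasure H ≪ volume := withDensity_absolutelyContinuous _ _
  exact h.ae_le (Measure.ae_ne volume 0)

theorem hasDerivAt_gamConv (hH0 : 0 < H) (hH1 : H < 1) (x : ℝ) :
    HasDerivAt (gamConv H) (gamConv' H x) x := by
  have := (hasDerivAt_integral_cos (integrable_inv_sq hH0 hH1)
    (integrable_mul_inv_sq hH0 hH1) x).const_mul 2
  refine HasDerivAt.congr_deriv this ?_
  unfold gamConv'; ring

/-- On the spectral side ξ²/(1+ξ²)² = 1/(1+ξ²) - 1/(1+ξ²)². This is the equation g'' = g - 2γ for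
the convolution with e^(-|x|). -/
theorem hasDerivAt_gamConv' (hH0 : 0 < H) (hH1 : H < 1) (x : ℝ) :
    HasDerivAt (gamConv' H) (gamConv H x - 2 * gam H x) x := by
  have := ((hasDerivAt_integral_sin (integrable_mul_inv_sq hH0 hH1).aestronglyMeasurable
    (integrable_sq_mul_inv_sq hH0 hH1) x).const_mul 2).neg
  refine HasDerivAt.congr_deriv this ?_
  unfold gamConv gam
  rw [← mul_sub, ← integral_sub (integrable_cos_mul (integrable_inv_sq hH0 hH1) x)
    (integrable_cos_mul (integrable_inv_one_add_sq_specMeasure hH0 hH1) x), ← mul_neg,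
    ← integral_neg]
  congr 1
  refine integral_congr_ae (ae_of_all _ fun ξ => ?_)
  field_simp
  ring

theorem hasDerivAt_gamPrim (hH0 : 0 < H) (hH1 : H < 1) (x : ℝ) :
    HasDerivAt (gamPrim H) (gam H x) x := by
  have := hasDerivAt_integral_sin (f := fun ξ : ℝ => ξ⁻¹ * (1 + ξ ^ 2)⁻¹)
    (ν := specMeasure H) (Measurable.aestronglyMeasurable (by fun_prop))
    (integrable_mul_inv_mul hH0 hH1) x
  refine HasDerivAt.congr_deriv this ?_
  unfold gam
  refine integral_congr_ae ?_
  filter_upwards [specMeasure_ae_ne_zero (H := H)] with ξ h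
  rw [mul_inv_cancel_left₀ h]

theorem continuous_gam (hH0 : 0 < H) (hH1 : H < 1) : Continuous (gam H) := by
  unfold gam
  refine continuous_of_dominated (bound := fun ξ => (1 + ξ ^ 2)⁻¹) ?_ ?_
    (integrable_inv_one_add_sq_specMeasure hH0 hH1) ?_
  · exact fun x => Measurable.aestronglyMeasurable (by fun_prop)
  · refine fun x => ae_of_all _ fun ξ => ?_
    rw [norm_mul, Real.norm_of_nonneg (inv_one_add_sq_nonneg ξ)]
    exact mul_le_of_le_one_left (inv_one_add_sq_nonneg ξ) (Real.abs_cos_le_one _)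
  · exact ae_of_all _ fun ξ => by fun_prop

theorem gam_neg (x : ℝ) : gam H (-x) = gam H x := by
  simp [gam]

theorem gam_abs (x : ℝ) : gam H |x| = gam H x := by
  rcases abs_choice x with h | h <;> rw [h]
  exact gam_neg x

theorem abs_gam_le (hH0 : 0 < H) (hH1 : H < 1) (x : ℝ) : |gam H x| ≤ gam H 0 := by
  unfold gam
  refine (norm_integral_le_integral_norm (G := ℝ) _).trans ?_
  refine integral_mono (integrable_cos_mul (integrable_inv_one_add_sq_specMeasure hH0 hH1) x).norm
    (integrable_cos_mul (integrable_inv_one_add_sq_specMeasure hH0 hH1) 0) fun ξ => ?_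
  simp only [zero_mul, Real.cos_zero, norm_mul, one_mul]
  rw [Real.norm_of_nonneg (inv_one_add_sq_nonneg ξ)]
  exact mul_le_of_le_one_left (inv_one_add_sq_nonneg ξ) (Real.abs_cos_le_one _)

theorem tendsto_gam (hH0 : 0 < H) (hH1 : H < 1) : Tendsto (gam H) atTop (𝓝 0) :=
  tendsto_integral_cos_specMeasure hH0 hH1 (integrable_inv_one_add_sq_specMeasure hH0 hH1)

theorem tendsto_gamConv (hH0 : 0 < H) (hH1 : H < 1) : Tendsto (gamConv H) atTop (𝓝 0) := by
  have := (tendsto_integral_cos_specMeasure hH0 hH1 (integrable_inv_sq hH0 hH1)).const_mul 2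
  rwa [mul_zero] at this

theorem tendsto_gamConv' (hH0 : 0 < H) (hH1 : H < 1) : Tendsto (gamConv' H) atTop (𝓝 0) := by
  have := ((tendsto_integral_sin_specMeasure hH0 hH1
    (integrable_mul_inv_sq hH0 hH1)).const_mul 2).neg
  rwa [mul_zero, neg_zero] at this

theorem gamConv'_zero : gamConv' H 0 = 0 := by simp [gamConv']

theorem gamPrim_zero : gamPrim H 0 = 0 := by simp [gamPrim]

theorem integral_even_specMeasure (hH0 : 0 < H) (hH1 : H < 1) {f : ℝ → ℝ}
    (hf : ∀ ξ, f |ξ| = f ξ) :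
    ∫ ξ, f ξ ∂(specMeasure H)
      = 2 * (specInt H)⁻¹ * ∫ ξ in Set.Ioi (0 : ℝ), ξ ^ (1 - 2 * H) * f ξ := by
  rw [integral_specMeasure hH0 hH1]
  have h := integral_comp_abs (f := fun ξ : ℝ => (specInt H)⁻¹ * (ξ ^ (1 - 2 * H) * f ξ))
  simp only [hf] at h
  simp only [smul_eq_mul, mul_assoc]
  rw [h, integral_const_mul]


/-! ### Consequences of the homogeneity of the spectral density -/

theorem integrableOn_Ioi_weight (hH0 : 0 < H) (hH1 : H < 1) :
    IntegrableOn (fun ξ : ℝ => ξ ^ (1 - 2 * H) * (1 + ξ ^ 2)⁻¹) (Set.Ioi 0) := by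
  refine (integrable_weight_div hH0 hH1).integrableOn.congr_fun (fun ξ hξ => ?_) measurableSet_Ioi
  simp only
  rw [abs_of_pos hξ]

theorem hasDerivAt_weight {ξ : ℝ} (hξ : 0 < ξ) :
    HasDerivAt (fun ξ : ℝ => ξ ^ (1 - 2 * H) * (1 + ξ ^ 2)⁻¹)
      (ξ ^ (1 - 2 * H) * ((1 - 2 * H) * (ξ⁻¹ * (1 + ξ ^ 2)⁻¹)
        - 2 * (ξ * ((1 + ξ ^ 2)⁻¹) ^ 2))) ξ := by
  have h1 := Real.hasDerivAt_rpow_const (p := 1 - 2 * H) (Or.inl hξ.ne')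
  have h2 : HasDerivAt (fun ξ : ℝ => (1 + ξ ^ 2)⁻¹) (-(2 * ξ) / (1 + ξ ^ 2) ^ 2) ξ := by
    have := ((hasDerivAt_pow 2 ξ).const_add 1).fun_inv (by positivity : (1 + ξ ^ 2) ≠ 0)
    simpa using this
  refine (h1.mul h2).congr_deriv ?_
  rw [Real.rpow_sub_one hξ.ne']
  field_simp
  ring

theorem tendsto_weight_atTop (hH0 : 0 < H) :
    Tendsto (fun ξ : ℝ => ξ ^ (1 - 2 * H) * (1 + ξ ^ 2)⁻¹) atTop (𝓝 0) := by
  have h : Tendsto (fun ξ : ℝ => ξ ^ (-(1 + 2 * H))) atTop (𝓝 0) :=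
    tendsto_rpow_neg_atTop (by linarith)
  refine squeeze_zero' ?_ ?_ h
  · filter_upwards [eventually_gt_atTop 0] with ξ hξ
    positivity
  · filter_upwards [eventually_gt_atTop 0] with ξ hξ
    rw [show -(1 + 2 * H) = (1 - 2 * H) - 2 by ring, Real.rpow_sub hξ (1 - 2 * H) 2, Real.rpow_two, div_eq_mul_inv]
    gcongr
    linarith

/-- Integrate the ξ-derivative of sin(xξ) ξ^(1-2H)/(1+ξ²) over the half-line; the boundary terms
vanish. The logarithmic derivative (1-2H)/ξ of the pure power produces `gamPrim`, and the derivative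
of 1/(1+ξ²) produces `gamConv'`. Self-similarity enters here and makes the intercept computable. -/
theorem gamConv'_eq (hH0 : 0 < H) (hH1 : H < 1) (x : ℝ) :
    gamConv' H x = (2 * H - 1) * gamPrim H x - x * gam H x := by
  set c := 2 * (specInt H)⁻¹ with hc
  have e1 : gam H x = c * ∫ ξ in Set.Ioi (0 : ℝ),
      ξ ^ (1 - 2 * H) * (Real.cos (x * ξ) * (1 + ξ ^ 2)⁻¹) :=
    integral_even_specMeasure hH0 hH1 fun ξ => by
      rw [sq_abs]; rcases abs_choice ξ with h | h <;> rw [h]; simp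
  have e2 : gamPrim H x = c * ∫ ξ in Set.Ioi (0 : ℝ),
      ξ ^ (1 - 2 * H) * (Real.sin (x * ξ) * (ξ⁻¹ * (1 + ξ ^ 2)⁻¹)) :=
    integral_even_specMeasure hH0 hH1 fun ξ => by
      rw [sq_abs]; rcases abs_choice ξ with h | h <;> rw [h]; simp [inv_neg]
  have e3 : gamConv' H x = -(2 * (c * ∫ ξ in Set.Ioi (0 : ℝ),
      ξ ^ (1 - 2 * H) * (Real.sin (x * ξ) * (ξ * ((1 + ξ ^ 2)⁻¹) ^ 2)))) := by
    unfold gamConv'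
    rw [integral_even_specMeasure hH0 hH1 fun ξ => by
      rw [sq_abs]; rcases abs_choice ξ with h | h <;> rw [h]; simp]
  have hg := integrableOn_Ioi_weight hH0 hH1
  have hI : ∀ f : ℝ → ℝ, Integrable f (specMeasure H) →
      IntegrableOn (fun ξ => ξ ^ (1 - 2 * H) * f ξ) (Set.Ioi 0) := by
    intro f hf
    rw [integrable_specMeasure_iff hH0 hH1] at hf
    refine (hf.const_mul (specInt H)).integrableOn.congr_fun (fun ξ hξ => ?_) measurableSet_Ioi
    simp only [smul_eq_mul]
    rw [abs_of_pos hξ]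
    have := (specInt_pos hH0 hH1).ne'
    field_simp
  have i1 := hI _ (integrable_cos_mul (integrable_inv_one_add_sq_specMeasure hH0 hH1) x)
  have i2 := hI _ (integrable_sin_mul' (f := fun ξ : ℝ => ξ⁻¹ * (1 + ξ ^ 2)⁻¹)
    (Measurable.aestronglyMeasurable (by fun_prop)) (integrable_mul_inv_mul hH0 hH1) x)
  have i3 := hI _ (integrable_sin_mul (integrable_mul_inv_sq hH0 hH1) x)
  have i23 : IntegrableOn (fun ξ : ℝ =>
      (1 - 2 * H) * (ξ ^ (1 - 2 * H) * (Real.sin (x * ξ) * (ξ⁻¹ * (1 + ξ ^ 2)⁻¹)))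
      - 2 * (ξ ^ (1 - 2 * H) * (Real.sin (x * ξ) * (ξ * ((1 + ξ ^ 2)⁻¹) ^ 2)))) (Set.Ioi 0) :=
    (i2.const_mul _).sub (i3.const_mul _)
  have key := integral_Ioi_of_hasDerivAt_of_tendsto (a := 0) (m := 0)
    (f := fun ξ : ℝ => Real.sin (x * ξ) * (ξ ^ (1 - 2 * H) * (1 + ξ ^ 2)⁻¹))
    (f' := fun ξ : ℝ => x * (ξ ^ (1 - 2 * H) * (Real.cos (x * ξ) * (1 + ξ ^ 2)⁻¹))
      + ((1 - 2 * H) * (ξ ^ (1 - 2 * H) * (Real.sin (x * ξ) * (ξ⁻¹ * (1 + ξ ^ 2)⁻¹)))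
      - 2 * (ξ ^ (1 - 2 * H) * (Real.sin (x * ξ) * (ξ * ((1 + ξ ^ 2)⁻¹) ^ 2))))) ?_ ?_ ?_ ?_
  · rw [integral_add (i1.const_mul _) i23,
      integral_sub (i2.const_mul _) (i3.const_mul _), integral_const_mul, integral_const_mul,
      integral_const_mul] at key
    simp only [mul_zero, Real.sin_zero, zero_mul, sub_zero] at key
    rw [e1, e2, e3]
    linear_combination c * key
  -- For H > 1/2 the weight blows up at 0; the factor |sin(xξ)| ≤ |x|ξ compensates and leaves a
  -- positive power ξ^(2-2H).
  · have hlim : Tendsto (fun ξ : ℝ => |x| * |ξ| ^ (2 - 2 * H)) (𝓝 0) (𝓝 0) := by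
      have : ContinuousAt (fun ξ : ℝ => |x| * |ξ| ^ (2 - 2 * H)) 0 :=
        continuousAt_const.mul (continuous_abs.continuousAt.rpow_const (Or.inr (by linarith)))
      have h2 := this.tendsto
      simpa [Real.zero_rpow (by linarith : 2 - 2 * H ≠ 0)] using h2
    rw [ContinuousWithinAt]
    simp only [mul_zero, Real.sin_zero, zero_mul]
    refine squeeze_zero_norm' ?_ (hlim.mono_left nhdsWithin_le_nhds)
    filter_upwards [self_mem_nhdsWithin] with ξ hξ
    rcases (Set.mem_Ici.1 hξ).eq_or_lt with rfl | hξ0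
    · simp; positivity
    rw [norm_mul, Real.norm_of_nonneg (r := ξ ^ (1 - 2 * H) * (1 + ξ ^ 2)⁻¹) (by positivity),
      abs_of_pos hξ0, show 2 - 2 * H = (1 - 2 * H) + 1 by ring, Real.rpow_add_one hξ0.ne']
    have h1 : ‖Real.sin (x * ξ)‖ ≤ |x| * ξ := by
      have := Real.abs_sin_le_abs (x := x * ξ)
      rwa [abs_mul, abs_of_pos hξ0] at this
    have h2 : ξ ^ (1 - 2 * H) * (1 + ξ ^ 2)⁻¹ ≤ ξ ^ (1 - 2 * H) :=
      mul_le_of_le_one_right (by positivity) (inv_one_add_sq_le_one ξ)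
    calc _ ≤ |x| * ξ * ξ ^ (1 - 2 * H) := by gcongr
      _ = _ := by ring
  · intro ξ hξ
    have h1 := ((hasDerivAt_const_mul x (x := ξ)).sin).mul (hasDerivAt_weight (H := H) hξ)
    exact h1.congr_deriv (by ring)
  · exact (i1.const_mul _).add i23
  · refine squeeze_zero_norm' ?_ (tendsto_weight_atTop hH0)
    filter_upwards [eventually_gt_atTop 0] with ξ hξ
    rw [norm_mul, Real.norm_of_nonneg (r := ξ ^ (1 - 2 * H) * (1 + ξ ^ 2)⁻¹) (by positivity)]
    exact mul_le_of_le_one_left (by positivity) (Real.abs_sin_le_one _)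

/-- Compare the two derivatives of g' at 0: g(0) - 2γ(0) from the differential equation, and
(2H-1)γ(0) - γ(0) from `gamConv'_eq`. -/
theorem gamConv_zero (hH0 : 0 < H) (hH1 : H < 1) : gamConv H 0 = 2 * H * gam H 0 := by
  have h1 := hasDerivAt_gamConv' hH0 hH1 0
  -- Only continuity of `gam` is available at 0, and it suffices: the difference quotient of x γ(x)
  -- there is γ(x).
  have h2 : HasDerivAt (fun x => x * gam H x) (gam H 0) 0 := by
    rw [hasDerivAt_iff_tendsto_slope]
    refine ((continuous_gam hH0 hH1).tendsto 0 |>.mono_left nhdsWithin_le_nhds).congr' ?_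
    filter_upwards [self_mem_nhdsWithin] with x hx
    simp only [slope, vsub_eq_sub, sub_zero, zero_mul, smul_eq_mul]
    rw [inv_mul_cancel_left₀ hx]
  have h3 := ((hasDerivAt_gamPrim hH0 hH1 0).const_mul (2 * H - 1)).sub h2
  have h4 : gamConv' H = fun x => (2 * H - 1) * gamPrim H x - x * gam H x :=
    funext (gamConv'_eq hH0 hH1)
  rw [h4] at h1
  have := h1.unique h3
  linarith

/-- Solve `gamConv'_eq` for γ and differentiate the quotient. Differentiating under the integral is
not possible for H ≤ 1/2, where ξ/(1+ξ²) is not integrable against the spectral measure. -/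
theorem hasDerivAt_gam (hH0 : 0 < H) (hH1 : H < 1) {x : ℝ} (hx : 0 < x) :
    HasDerivAt (gam H) ((2 * H * gam H x - gamConv H x) / x) x := by
  have h1 := (((hasDerivAt_gamPrim hH0 hH1 x).const_mul (2 * H - 1)).sub
    (hasDerivAt_gamConv' hH0 hH1 x)).div (hasDerivAt_id x) hx.ne'
  have h2 : gam H =ᶠ[𝓝 x] ((fun x => (2 * H - 1) * gamPrim H x) - gamConv' H) / id := by
    filter_upwards [lt_mem_nhds hx] with y hy
    simp only [Pi.div_apply, Pi.sub_apply, id, gamConv'_eq hH0 hH1 y]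
    field_simp
    ring
  refine (h1.congr_of_eventuallyEq h2).congr_deriv ?_
  simp only [Pi.sub_apply, id, gamConv'_eq hH0 hH1 x]
  field_simp
  ring


/-! ### The covariance as an average of second differences, and its size at infinity -/

theorem integral_exp_neg_mul_cos (ξ : ℝ) :
    IntegrableOn (fun y : ℝ => Real.exp (-y) * Real.cos (y * ξ)) (Set.Ioi 0) ∧
    ∫ y in Set.Ioi (0 : ℝ), Real.exp (-y) * Real.cos (y * ξ) = (1 + ξ ^ 2)⁻¹ := by
  have hre : (⟨-1, ξ⟩ : ℂ).re < 0 := by simp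
  have hi := integrableOn_exp_mul_complex_Ioi hre 0
  have hv := integral_exp_mul_complex_Ioi hre 0
  have hpt : ∀ y : ℝ, (Complex.exp ((⟨-1, ξ⟩ : ℂ) * y)).re = Real.exp (-y) * Real.cos (y * ξ) := by
    intro y
    rw [Complex.exp_re]
    simp [mul_comm]
  constructor
  · exact hi.re.congr (ae_of_all _ fun y => hpt y)
  · have h2 := integral_re hi
    simp only [RCLike.re_to_complex, hpt] at h2
    rw [h2, hv]
    simp [Complex.normSq_apply, Complex.div_re, Complex.neg_re]
    ring_nf

theorem integral_exp_neg_mul_one_sub_cos (ξ : ℝ) :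
    IntegrableOn (fun y : ℝ => Real.exp (-y) * (1 - Real.cos (y * ξ))) (Set.Ioi 0) ∧
    ∫ y in Set.Ioi (0 : ℝ), Real.exp (-y) * (1 - Real.cos (y * ξ)) = 1 - (1 + ξ ^ 2)⁻¹ := by
  obtain ⟨h1, h2⟩ := integral_exp_neg_mul_cos ξ
  have h3 : IntegrableOn (fun y : ℝ => Real.exp (-y)) (Set.Ioi 0) := integrableOn_exp_neg_Ioi 0
  simp_rw [mul_sub, mul_one]
  refine ⟨h3.sub h1, ?_⟩
  rw [integral_sub h3 h1, integral_exp_neg_Ioi_zero, h2]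

/-- The symmetric second difference of `t ↦ |t| ^ (2 * H)`. -/
noncomputable def secondDiff (H x y : ℝ) : ℝ :=
  |x - y| ^ (2 * H) + |x + y| ^ (2 * H) - 2 * |x| ^ (2 * H)

/-- By product-to-sum, cos(xξ)(1 - cos(yξ)) combines the functions 2 - 2cos at x - y, x + y and x,
and each of them integrates to a power. -/
theorem secondDiff_eq_integral (hH0 : 0 < H) (hH1 : H < 1) (x y : ℝ) :
    ∫ ξ, Real.cos (x * ξ) * ((1 - Real.cos (y * ξ)) / ξ ^ 2) ∂(specMeasure H)
      = 1 / 4 * secondDiff H x y := by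
  have i := integrable_two_sub_two_cos_specMeasure hH0 hH1
  have v := integral_two_sub_two_cos_specMeasure hH0 hH1
  unfold secondDiff
  have i2 : Integrable (fun ξ : ℝ => (2 - 2 * Real.cos ((x - y) * ξ)) / ξ ^ 2
      + (2 - 2 * Real.cos ((x + y) * ξ)) / ξ ^ 2) (specMeasure H) := (i _).add (i _)
  rw [← v, ← v, ← v, ← integral_const_mul, ← integral_add (i _) (i _),
    ← integral_sub i2 ((i _).const_mul 2), ← integral_const_mul]
  refine integral_congr_ae (ae_of_all _ fun ξ => ?_)
  simp only [sub_mul, add_mul, Real.cos_sub, Real.cos_add]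
  ring

theorem integrable_gam_kernel (hH0 : 0 < H) (hH1 : H < 1) (x : ℝ) :
    Integrable (fun z : ℝ × ℝ =>
      Real.exp (-z.1) * (Real.cos (x * z.2) * ((1 - Real.cos (z.1 * z.2)) / z.2 ^ 2)))
      ((volume.restrict (Set.Ioi 0)).prod (specMeasure H)) := by
  rw [integrable_prod_iff' (Measurable.aestronglyMeasurable (by fun_prop))]
  have key : ∀ y ξ : ℝ,
      Real.exp (-y) * (Real.cos (x * ξ) * ((1 - Real.cos (y * ξ)) / ξ ^ 2))
      = (Real.cos (x * ξ) / ξ ^ 2) * (Real.exp (-y) * (1 - Real.cos (y * ξ))) := by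
    intros; ring
  constructor
  · refine ae_of_all _ fun ξ => ?_
    simp only [key]
    exact (integral_exp_neg_mul_one_sub_cos ξ).1.const_mul _
  · refine (integrable_cos_mul (integrable_inv_one_add_sq_specMeasure hH0 hH1) x).norm.congr ?_
    filter_upwards [specMeasure_ae_ne_zero (H := H)] with ξ hξ
    simp only [key]
    have : ∀ y : ℝ, ‖(Real.cos (x * ξ) / ξ ^ 2) * (Real.exp (-y) * (1 - Real.cos (y * ξ)))‖
        = ‖Real.cos (x * ξ) / ξ ^ 2‖ * (Real.exp (-y) * (1 - Real.cos (y * ξ))) := by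
      intro y
      rw [norm_mul, Real.norm_of_nonneg (r := Real.exp (-y) * _)]
      exact mul_nonneg (Real.exp_nonneg _) (by linarith [Real.cos_le_one (y * ξ)])
    simp_rw [this]
    rw [integral_const_mul, (integral_exp_neg_mul_one_sub_cos ξ).2, norm_mul, norm_div,
      Real.norm_of_nonneg (inv_one_add_sq_nonneg ξ), Real.norm_of_nonneg (sq_nonneg ξ)]
    field_simp
    ring

/-- Write 1/(1+ξ²) as ξ⁻² ∫ e^(-y)(1 - cos(yξ)) dy and exchange the integrals. The oscillatory
integral becomes an average of real second differences, from which both the decay and the lower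
bound of γ are read off. -/
theorem gam_eq_integral_secondDiff (hH0 : 0 < H) (hH1 : H < 1) (x : ℝ) :
    IntegrableOn (fun y => Real.exp (-y) * (1 / 4 * secondDiff H x y)) (Set.Ioi 0) ∧
    gam H x = ∫ y in Set.Ioi (0 : ℝ), Real.exp (-y) * (1 / 4 * secondDiff H x y) := by
  have hk := integrable_gam_kernel hH0 hH1 x
  constructor
  · have := hk.integral_prod_left
    simp only [integral_const_mul, secondDiff_eq_integral hH0 hH1] at this
    exact this
  · have hsw := integral_integral_swap (f := fun y ξ : ℝ =>
      Real.exp (-y) * (Real.cos (x * ξ) * ((1 - Real.cos (y * ξ)) / ξ ^ 2))) hk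
    simp only [integral_const_mul, secondDiff_eq_integral hH0 hH1] at hsw
    rw [hsw, gam]
    refine integral_congr_ae ?_
    filter_upwards [specMeasure_ae_ne_zero (H := H)] with ξ hξ
    have key : ∀ y : ℝ,
        Real.exp (-y) * (Real.cos (x * ξ) * ((1 - Real.cos (y * ξ)) / ξ ^ 2))
        = (Real.cos (x * ξ) / ξ ^ 2) * (Real.exp (-y) * (1 - Real.cos (y * ξ))) := by
      intros; ring
    simp only [key]
    rw [integral_const_mul, (integral_exp_neg_mul_one_sub_cos ξ).2]
    field_simp
    ring

theorem gam_zero (hH0 : 0 < H) (hH1 : H < 1) : gam H 0 = a H := by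
  rw [(gam_eq_integral_secondDiff hH0 hH1 0).2, a]
  have h : ∀ y ∈ Set.Ioi (0 : ℝ), Real.exp (-y) * (1 / 4 * secondDiff H 0 y)
      = 1 / 2 * (Real.exp (-y) * y ^ ((2 * H + 1) - 1)) := by
    intro y hy
    have h0 : (0 : ℝ) ^ (2 * H) = 0 := Real.zero_rpow (by positivity)
    simp only [secondDiff, zero_sub, zero_add, abs_neg, abs_zero, h0, abs_of_pos (Set.mem_Ioi.1 hy)]
    ring_nf
  rw [setIntegral_congr_fun measurableSet_Ioi h, integral_const_mul,
    ← Real.Gamma_eq_integral (by linarith), Real.Gamma_add_one (by positivity)]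
  ring

theorem a_pos (hH0 : 0 < H) : 0 < a H :=
  mul_pos hH0 (Real.Gamma_pos_of_pos (by linarith))

/-- Bernoulli's inequality gives the sum of the powers at most 2. From below, AM-GM and (1-z²)^p ≥ 1
- z² give (A+B)² ≥ 4AB ≥ 4(1-z²) ≥ 4(1-z²)². -/
theorem abs_one_sub_rpow_add_le {p z : ℝ} (hp0 : 0 < p) (hp1 : p ≤ 1) (hz0 : 0 ≤ z) (hz1 : z ≤ 1) :
    |(1 - z) ^ p + (1 + z) ^ p - 2| ≤ 2 * z ^ 2 := by
  have u1 : (1 + z) ^ p ≤ 1 + p * z := rpow_one_add_le_one_add_mul_self (by linarith) hp0.le hp1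
  have u2 : (1 - z) ^ p ≤ 1 + p * (-z) := by
    have := rpow_one_add_le_one_add_mul_self (s := -z) (by linarith) hp0.le hp1
    rwa [← sub_eq_add_neg] at this
  have hA : 0 ≤ (1 - z) ^ p := Real.rpow_nonneg (by linarith) _
  have hB : 0 ≤ (1 + z) ^ p := Real.rpow_nonneg (by linarith) _
  have hAB : (1 - z ^ 2) ≤ (1 - z) ^ p * (1 + z) ^ p := by
    rw [← Real.mul_rpow (by linarith) (by linarith), show (1 - z) * (1 + z) = 1 - z ^ 2 by ring]
    have : (0 : ℝ) ≤ 1 - z ^ 2 := by nlinarith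
    calc 1 - z ^ 2 = (1 - z ^ 2) ^ (1 : ℝ) := (Real.rpow_one _).symm
      _ ≤ _ := Real.rpow_le_rpow_of_exponent_ge' this (by nlinarith) hp0.le hp1
  have hz2 : z ^ 2 ≤ 1 := by nlinarith
  have h1 : 2 * (1 - z ^ 2) ≤ (1 - z) ^ p + (1 + z) ^ p := by
    apply le_of_sq_le_sq _ (by positivity)
    nlinarith [sq_nonneg ((1 - z) ^ p - (1 + z) ^ p), sq_nonneg z]
  rw [abs_le]
  constructor <;> nlinarith

theorem secondDiff_eq_mul {x y : ℝ} (hx : 0 < x) (hy : 0 ≤ y) (hyx : y ≤ x) :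
    secondDiff H x y = x ^ (2 * H) * ((1 - y / x) ^ (2 * H) + (1 + y / x) ^ (2 * H) - 2) := by
  have h1 : y / x ≤ 1 := (div_le_one hx).2 hyx
  have h2 : 0 ≤ y / x := by positivity
  unfold secondDiff
  rw [abs_of_nonneg (by linarith : 0 ≤ x - y), abs_of_nonneg (by linarith : 0 ≤ x + y),
    abs_of_pos hx, mul_sub, mul_add, ← Real.mul_rpow hx.le (by linarith),
    ← Real.mul_rpow hx.le (by linarith)]
  have e1 : x * (1 - y / x) = x - y := by field_simp
  have e2 : x * (1 + y / x) = x + y := by field_simp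
  rw [e1, e2]; ring

theorem abs_secondDiff_le_of_lt {x y : ℝ} (hH0 : 0 < H) (hH : H ≤ 1 / 2) (hx : 0 < x) (hxy : x < y) :
    |secondDiff H x y| ≤ 5 * y ^ (2 * H) := by
  unfold secondDiff
  have hy : 0 < y := hx.trans hxy
  have e1 : |x - y| ^ (2 * H) ≤ y ^ (2 * H) := by
    rw [abs_of_neg (by linarith)]
    exact Real.rpow_le_rpow (by linarith) (by linarith) (by linarith)
  have e2 : |x + y| ^ (2 * H) ≤ 2 * y ^ (2 * H) := by
    rw [abs_of_pos (by linarith)]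
    calc (x + y) ^ (2 * H) ≤ (2 * y) ^ (2 * H) :=
          Real.rpow_le_rpow (by linarith) (by linarith) (by linarith)
      _ = 2 ^ (2 * H) * y ^ (2 * H) := Real.mul_rpow (by norm_num) hy.le
      _ ≤ _ := by
        gcongr
        calc (2 : ℝ) ^ (2 * H) ≤ 2 ^ (1 : ℝ) :=
              Real.rpow_le_rpow_of_exponent_le (by norm_num) (by linarith)
          _ = 2 := Real.rpow_one 2
  have e3 : |x| ^ (2 * H) ≤ y ^ (2 * H) := by
    rw [abs_of_pos hx]
    exact Real.rpow_le_rpow (by linarith) (by linarith) (by linarith)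
  have p1 : 0 ≤ |x - y| ^ (2 * H) := by positivity
  have p2 : 0 ≤ |x + y| ^ (2 * H) := by positivity
  have p3 : 0 ≤ |x| ^ (2 * H) := by positivity
  rw [abs_le]
  constructor <;> linarith

/-- For y ≤ x the first-order terms cancel. For y > x the trivial bound by y^(2H) is enough, since
y^(2H-2) ≤ x^(2H-2). -/
theorem abs_secondDiff_le {x y : ℝ} (hH0 : 0 < H) (hH : H ≤ 1 / 2) (hx : 0 < x) (hy : 0 < y) :
    |secondDiff H x y| ≤ 5 * x ^ (2 * H - 2) * y ^ 2 := by
  rw [Real.rpow_sub hx, Real.rpow_two]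
  rcases le_or_gt y x with h | h
  · rw [secondDiff_eq_mul hx hy.le h, abs_mul, abs_of_nonneg (by positivity : 0 ≤ x ^ (2 * H))]
    have := abs_one_sub_rpow_add_le (p := 2 * H) (z := y / x) (by linarith) (by linarith)
      (by positivity) ((div_le_one hx).2 h)
    calc _ ≤ x ^ (2 * H) * (2 * (y / x) ^ 2) := by gcongr
      _ ≤ x ^ (2 * H) * (5 * (y / x) ^ 2) := by gcongr; norm_num
      _ = _ := by field_simp
  · refine (abs_secondDiff_le_of_lt hH0 hH hx h).trans ?_
    have : y ^ (2 * H - 2) ≤ x ^ (2 * H - 2) :=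
      Real.rpow_le_rpow_of_nonpos hx h.le (by linarith)
    rw [Real.rpow_sub hx, Real.rpow_two, Real.rpow_sub hy, Real.rpow_two, div_le_iff₀ (by positivity)] at this
    linarith

/-- At H = 1/2 the general rate x^(2H-2) is only 1/x. But |t| is affine on the positive axis, so the
second difference vanishes for y ≤ x, and for y > x extra powers of y/x ≥ 1 may be inserted. -/
theorem abs_secondDiff_half_le {x y : ℝ} (hx : 0 < x) (hy : 0 < y) :
    |secondDiff (1 / 2) x y| ≤ 5 * x ^ (-2 : ℝ) * y ^ 3 := by
  rw [Real.rpow_neg hx.le, Real.rpow_two]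
  rcases le_or_gt y x with h | h
  · have : secondDiff (1 / 2) x y = 0 := by
      unfold secondDiff
      norm_num [abs_of_pos hx]
      rw [abs_of_nonneg (by linarith), abs_of_nonneg (by linarith)]; ring
    rw [this, abs_zero]; positivity
  · refine (abs_secondDiff_le_of_lt (by norm_num) le_rfl hx h).trans ?_
    norm_num
    rw [mul_assoc]
    gcongr
    rw [← div_eq_inv_mul, le_div_iff₀ (by positivity)]
    rw [pow_succ' y 2]
    gcongr

theorem abs_gam_le_of_secondDiff (hH0 : 0 < H) (hH1 : H < 1) {x C k : ℝ} (hk : 0 < k)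
    (h : ∀ y, 0 < y → |secondDiff H x y| ≤ C * y ^ (k - 1)) :
    |gam H x| ≤ C * (1 / 4 * Real.Gamma k) := by
  rw [(gam_eq_integral_secondDiff hH0 hH1 x).2, Real.Gamma_eq_integral hk, ← integral_const_mul,
    ← integral_const_mul]
  refine norm_integral_le_of_norm_le (G := ℝ) (((Real.GammaIntegral_convergent hk).const_mul _).const_mul _) ?_
  filter_upwards [ae_restrict_mem measurableSet_Ioi] with y hy
  have := h y hy
  rw [norm_mul, norm_mul, Real.norm_of_nonneg (Real.exp_nonneg _), Real.norm_eq_abs (secondDiff _ _ _)]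
  calc Real.exp (-y) * (‖(1 / 4 : ℝ)‖ * |secondDiff H x y|)
      ≤ Real.exp (-y) * (1 / 4 * (C * y ^ (k - 1))) := by
        rw [Real.norm_of_nonneg (by norm_num)]; gcongr
    _ = _ := by ring

/-- The exponent is 2 - 2H when H < 1/2 and 2 when H = 1/2. Integrating the bounds y² and y³ against
e^(-y) yields Γ(3) and Γ(4). -/
theorem exists_abs_gam_le (hH0 : 0 < H) (hH : H ≤ 1 / 2) :
    ∃ C θ : ℝ, 0 ≤ C ∧ 1 < θ ∧ ∀ x, 0 < x → |gam H x| ≤ C * x ^ (-θ) := by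
  rcases hH.lt_or_eq with h | rfl
  · refine ⟨5 * (1 / 4 * Real.Gamma 3), 2 - 2 * H, by
      have := Real.Gamma_pos_of_pos (s := 3) (by norm_num); positivity, by linarith, fun x hx => ?_⟩
    refine (abs_gam_le_of_secondDiff hH0 (by linarith) (k := 3) (C := 5 * x ^ (2 * H - 2))
      (by norm_num) fun y hy => ?_).trans (le_of_eq ?_)
    · have := abs_secondDiff_le hH0 hH hx hy
      norm_num
      exact this
    · rw [neg_sub]; ring
  · refine ⟨5 * (1 / 4 * Real.Gamma 4), 2, by
      have := Real.Gamma_pos_of_pos (s := 4) (by norm_num); positivity, by linarith, fun x hx => ?_⟩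
    refine (abs_gam_le_of_secondDiff hH0 (by linarith) (k := 4) (C := 5 * x ^ (-2 : ℝ))
      (by norm_num) fun y hy => ?_).trans (le_of_eq ?_)
    · have := abs_secondDiff_half_le hx hy
      norm_num at this ⊢
      exact this
    · ring

/-- The difference of the two sides is monotone on [0,1]: in its derivative, (1-z)^(p-1) ≤ 1 -
(p-1)z by Bernoulli, as 0 < p - 1 < 1, and (1+z)^(p-1) ≥ 1. -/
theorem one_sub_rpow_add_ge {p z : ℝ} (hp1 : 1 < p) (hp2 : p < 2) (hz0 : 0 ≤ z) (hz1 : z ≤ 1) :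
    p * (p - 1) / 2 * z ^ 2 ≤ (1 - z) ^ p + (1 + z) ^ p - 2 := by
  have hmono : MonotoneOn (fun z : ℝ => (1 - z) ^ p + (1 + z) ^ p - p * (p - 1) / 2 * z ^ 2)
      (Set.Icc 0 1) := by
    have hd : ∀ z : ℝ, HasDerivAt
        (fun z : ℝ => (1 - z) ^ p + (1 + z) ^ p - p * (p - 1) / 2 * z ^ 2)
        (-1 * p * (1 - z) ^ (p - 1) + 1 * p * (1 + z) ^ (p - 1) - p * (p - 1) / 2 * (2 * z)) z := by
      intro z
      have h1 := ((hasDerivAt_id z).const_sub 1).rpow_const (p := p) (Or.inr hp1.le)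
      have h2 := ((hasDerivAt_id z).const_add 1).rpow_const (p := p) (Or.inr hp1.le)
      have h3 := (hasDerivAt_pow 2 z).const_mul (p * (p - 1) / 2)
      exact ((h1.add h2).sub h3).congr_deriv (by simp)
    refine monotoneOn_of_deriv_nonneg (convex_Icc 0 1)
      (fun z _ => (hd z).continuousAt.continuousWithinAt)
      (fun z _ => (hd z).differentiableAt.differentiableWithinAt) fun z hz => ?_
    rw [interior_Icc] at hz
    rw [(hd z).deriv]
    have u2 : (1 - z) ^ (p - 1) ≤ 1 + (p - 1) * (-z) := by
      have := rpow_one_add_le_one_add_mul_self (s := -z) (p := p - 1) (by linarith [hz.2])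
        (by linarith) (by linarith)
      rwa [← sub_eq_add_neg] at this
    have u1 : 1 ≤ (1 + z) ^ (p - 1) := Real.one_le_rpow (by linarith [hz.1]) (by linarith)
    nlinarith
  have := hmono (Set.left_mem_Icc.2 zero_le_one) ⟨hz0, hz1⟩ hz0
  norm_num at this
  linarith

theorem secondDiff_nonneg (hH : 1 / 2 < H) (hH1 : H < 1) {x y : ℝ} (hx : 0 < x) (hy : 0 < y) :
    0 ≤ secondDiff H x y := by
  rcases le_or_gt y x with h | h
  · rw [secondDiff_eq_mul hx hy.le h]
    have := one_sub_rpow_add_ge (p := 2 * H) (z := y / x) (by linarith) (by linarith)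
      (by positivity) ((div_le_one hx).2 h)
    have h2 : 0 ≤ 2 * H * (2 * H - 1) / 2 * (y / x) ^ 2 :=
      mul_nonneg (div_nonneg (mul_nonneg (by linarith) (by linarith)) (by norm_num)) (sq_nonneg _)
    exact mul_nonneg (by positivity) (by linarith)
  · unfold secondDiff
    have h1 : 2 * |x| ^ (2 * H) ≤ |x + y| ^ (2 * H) := by
      rw [abs_of_pos hx, abs_of_pos (by linarith)]
      calc 2 * x ^ (2 * H) ≤ 2 ^ (2 * H) * x ^ (2 * H) := by
            gcongr
            calc (2 : ℝ) = 2 ^ (1 : ℝ) := (Real.rpow_one 2).symm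
              _ ≤ _ := Real.rpow_le_rpow_of_exponent_le (by norm_num) (by linarith)
        _ = (2 * x) ^ (2 * H) := (Real.mul_rpow (by norm_num) hx.le).symm
        _ ≤ _ := Real.rpow_le_rpow (by linarith) (by linarith) (by linarith)
    have : 0 ≤ |x - y| ^ (2 * H) := by positivity
    linarith

/-- The second differences are nonnegative, so only y in (0,1] need be kept. There y ≤ x, and the
convexity bound gives κ x^(2H) (y/x)² ≥ κ y²/x. The rate 1/x is all that the logarithmic divergence
of ∫ xγ² requires. -/
theorem exists_gam_ge (hH : 1 / 2 < H) (hH1 : H < 1) :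
    ∃ c : ℝ, 0 < c ∧ ∀ x, 1 ≤ x → c * x⁻¹ ≤ gam H x := by
  set κ := 2 * H * (2 * H - 1) / 2 with hκ
  have hκ0 : 0 < κ := by
    rw [hκ]; exact div_pos (mul_pos (by linarith) (by linarith)) (by norm_num)
  have hi : IntegrableOn (fun y : ℝ => Real.exp (-y) * (1 / 4 * (κ * y ^ 2))) (Set.Ioc 0 1) :=
    (Continuous.integrableOn_Icc (by fun_prop)).mono_set Set.Ioc_subset_Icc_self
  refine ⟨∫ y in Set.Ioc (0 : ℝ) 1, Real.exp (-y) * (1 / 4 * (κ * y ^ 2)), ?_, fun x hx => ?_⟩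
  · rw [← intervalIntegral.integral_of_le zero_le_one]
    refine intervalIntegral.intervalIntegral_pos_of_pos_on
      ((intervalIntegrable_iff_integrableOn_Ioc_of_le zero_le_one).2 hi) (fun y hy => ?_) zero_lt_one
    have := hy.1
    positivity
  · have hx0 : 0 < x := by linarith
    obtain ⟨h1, h2⟩ := gam_eq_integral_secondDiff (by linarith) hH1 x
    rw [h2, ← integral_mul_const]
    refine le_trans ?_ (setIntegral_mono_set h1 ?_ (LE.le.eventuallyLE
      (Set.Ioc_subset_Ioi_self : Set.Ioc (0 : ℝ) 1 ⊆ Set.Ioi 0)))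
    · refine setIntegral_mono_on (hi.mul_const _) (h1.mono_set Set.Ioc_subset_Ioi_self)
        measurableSet_Ioc fun y hy => ?_
      rw [mul_assoc, mul_assoc]
      gcongr
      rw [secondDiff_eq_mul hx0 hy.1.le (hy.2.trans hx)]
      have := one_sub_rpow_add_ge (p := 2 * H) (z := y / x) (by linarith) (by linarith)
        (div_nonneg hy.1.le hx0.le) ((div_le_one hx0).2 (hy.2.trans hx))
      have h3 : x ≤ x ^ (2 * H) := by
        calc x = x ^ (1 : ℝ) := (Real.rpow_one x).symm
          _ ≤ _ := Real.rpow_le_rpow_of_exponent_le hx (by linarith)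
      calc κ * y ^ 2 * x⁻¹ = x * (κ * (y / x) ^ 2) := by field_simp
        _ ≤ _ := mul_le_mul h3 this (by positivity) (by positivity)
    · filter_upwards [ae_restrict_mem measurableSet_Ioi] with y hy
      have := secondDiff_nonneg hH hH1 hx0 hy
      have := Real.exp_nonneg (-y)
      simp only [Pi.zero_apply]
      positivity


/-! ### Exact integrals of products of the covariance -/

theorem abs_gamConv_le (hH0 : 0 < H) (hH1 : H < 1) (x : ℝ) : |gamConv H x| ≤ 2 * gam H 0 := by
  unfold gamConv gam
  rw [abs_mul, abs_two]
  refine mul_le_mul_of_nonneg_left ?_ zero_le_two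
  refine norm_integral_le_of_norm_le (G := ℝ)
    (integrable_cos_mul (integrable_inv_one_add_sq_specMeasure hH0 hH1) 0) (ae_of_all _ fun ξ => ?_)
  rw [norm_mul, zero_mul, Real.cos_zero, one_mul,
    Real.norm_of_nonneg (r := ((1 + ξ ^ 2)⁻¹) ^ 2) (by positivity)]
  refine (mul_le_of_le_one_left (by positivity) (Real.abs_cos_le_one _)).trans ?_
  nlinarith [inv_one_add_sq_nonneg ξ, inv_one_add_sq_le_one ξ]

theorem abs_gamConv'_le (hH0 : 0 < H) (hH1 : H < 1) (x : ℝ) : |gamConv' H x| ≤ 2 * gam H 0 := by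
  unfold gamConv' gam
  rw [abs_neg, abs_mul, abs_two]
  refine mul_le_mul_of_nonneg_left ?_ zero_le_two
  refine norm_integral_le_of_norm_le (G := ℝ)
    (integrable_cos_mul (integrable_inv_one_add_sq_specMeasure hH0 hH1) 0) (ae_of_all _ fun ξ => ?_)
  rw [norm_mul, zero_mul, Real.cos_zero, one_mul, norm_mul,
    Real.norm_of_nonneg (r := ((1 + ξ ^ 2)⁻¹) ^ 2) (by positivity)]
  refine (mul_le_of_le_one_left (by positivity) (Real.abs_sin_le_one _)).trans ?_
  rw [sq, ← mul_assoc]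
  refine mul_le_of_le_one_left (inv_one_add_sq_nonneg ξ) ?_
  rw [← div_eq_mul_inv, div_le_one (by positivity), Real.norm_eq_abs]
  nlinarith [sq_nonneg (|ξ| - 1), sq_abs ξ]

theorem continuous_gamConv (hH0 : 0 < H) (hH1 : H < 1) : Continuous (gamConv H) :=
  continuous_iff_continuousAt.2 fun x => (hasDerivAt_gamConv hH0 hH1 x).continuousAt

theorem continuous_gamConv' (hH0 : 0 < H) (hH1 : H < 1) : Continuous (gamConv' H) :=
  continuous_iff_continuousAt.2 fun x => (hasDerivAt_gamConv' hH0 hH1 x).continuousAt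

/-- The one-sided convolution of `gam H` with `exp (-v)`, `v > 0`. -/
noncomputable def gamHalf (H x : ℝ) : ℝ := (gamConv H x - gamConv' H x) / 2

theorem hasDerivAt_gamHalf (hH0 : 0 < H) (hH1 : H < 1) (x : ℝ) :
    HasDerivAt (gamHalf H) (gam H x - gamHalf H x) x := by
  have := ((hasDerivAt_gamConv hH0 hH1 x).sub (hasDerivAt_gamConv' hH0 hH1 x)).div_const 2
  refine HasDerivAt.congr_deriv this ?_
  unfold gamHalf
  ring

theorem continuous_gamHalf (hH0 : 0 < H) (hH1 : H < 1) : Continuous (gamHalf H) :=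
  continuous_iff_continuousAt.2 fun x => (hasDerivAt_gamHalf hH0 hH1 x).continuousAt

theorem abs_gamHalf_le (hH0 : 0 < H) (hH1 : H < 1) (x : ℝ) : |gamHalf H x| ≤ 2 * gam H 0 := by
  unfold gamHalf
  have h1 := abs_le.1 (abs_gamConv_le hH0 hH1 x)
  have h2 := abs_le.1 (abs_gamConv'_le hH0 hH1 x)
  rw [abs_le]
  constructor <;> linarith

theorem gamHalf_zero (hH0 : 0 < H) (hH1 : H < 1) : gamHalf H 0 = H * gam H 0 := by
  rw [gamHalf, gamConv_zero hH0 hH1, gamConv'_zero]; ring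

theorem integrableOn_exp_neg_mul_of_bdd {f : ℝ → ℝ} (hf : Continuous f) {C : ℝ}
    (hC : ∀ x, |f x| ≤ C) : IntegrableOn (fun v => Real.exp (-v) * f v) (Set.Ioi 0) := by
  have h3 : IntegrableOn (fun y : ℝ => Real.exp (-y)) (Set.Ioi 0) := integrableOn_exp_neg_Ioi 0
  exact h3.mul_bdd hf.aestronglyMeasurable (ae_of_all _ hC)

theorem tendsto_exp_neg_mul_of_bdd {f : ℝ → ℝ} {C : ℝ} (hC : ∀ x, |f x| ≤ C) :
    Tendsto (fun v => Real.exp (-v) * f v) atTop (𝓝 0) := by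
  have h : Tendsto (fun v : ℝ => Real.exp (-v) * C) atTop (𝓝 0) := by
    simpa using Real.tendsto_exp_neg_atTop_nhds_zero.mul_const C
  refine squeeze_zero_norm (fun v => ?_) h
  rw [norm_mul, Real.norm_of_nonneg (Real.exp_nonneg _)]
  exact mul_le_mul_of_nonneg_left (hC v) (Real.exp_nonneg _)

/-- The function h = `gamHalf H` solves h' = γ - h, so -e^(-v) h(u-v) is a primitive of the
integrand. -/
theorem integral_exp_neg_mul_gam_sub (hH0 : 0 < H) (hH1 : H < 1) (u : ℝ) :
    ∫ v in Set.Ioi (0 : ℝ), Real.exp (-v) * gam H (u - v) = gamHalf H u := by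
  have hi := (integrableOn_exp_neg_mul_of_bdd (f := fun v => gam H (u - v))
    ((continuous_gam hH0 hH1).comp (by fun_prop)) (fun x => abs_gam_le hH0 hH1 _))
  have hd : ∀ v : ℝ, HasDerivAt (fun v => -(Real.exp (-v) * gamHalf H (u - v)))
      (Real.exp (-v) * gam H (u - v)) v := by
    intro v
    have h1 := (hasDerivAt_neg v).exp
    have h2 := (hasDerivAt_gamHalf hH0 hH1 (u - v)).comp_const_sub u v
    exact (h1.mul h2).neg.congr_deriv (by ring)
  have ht := (tendsto_exp_neg_mul_of_bdd (f := fun v => gamHalf H (u - v))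
    (fun x => abs_gamHalf_le hH0 hH1 _)).neg
  rw [integral_Ioi_of_hasDerivAt_of_tendsto' (fun v _ => hd v) hi ht]
  simp

theorem integral_exp_neg_mul_gam (hH0 : 0 < H) (hH1 : H < 1) :
    ∫ v in Set.Ioi (0 : ℝ), Real.exp (-v) * gam H v = H * gam H 0 := by
  rw [← gamHalf_zero hH0 hH1, ← integral_exp_neg_mul_gam_sub hH0 hH1]
  simp [gam_neg]

/-- Integrate (e^(-v) h)' = e^(-v) γ - 2 e^(-v) h, where h(0) = Hγ(0) and the integral of e^(-v) γ
is Hγ(0) as well. -/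
theorem integral_exp_neg_mul_gamHalf (hH0 : 0 < H) (hH1 : H < 1) :
    ∫ v in Set.Ioi (0 : ℝ), Real.exp (-v) * gamHalf H v = H * gam H 0 := by
  have i1 := integrableOn_exp_neg_mul_of_bdd (continuous_gam hH0 hH1) (abs_gam_le hH0 hH1)
  have i2 := integrableOn_exp_neg_mul_of_bdd (continuous_gamHalf hH0 hH1) (abs_gamHalf_le hH0 hH1)
  have hd : ∀ v : ℝ, HasDerivAt (fun v => Real.exp (-v) * gamHalf H v)
      (Real.exp (-v) * gam H v - 2 * (Real.exp (-v) * gamHalf H v)) v := by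
    intro v
    exact ((hasDerivAt_neg v).exp.mul (hasDerivAt_gamHalf hH0 hH1 v)).congr_deriv (by ring)
  have key := integral_Ioi_of_hasDerivAt_of_tendsto' (a := 0) (fun v _ => hd v)
    (i1.sub (i2.const_mul 2)) (tendsto_exp_neg_mul_of_bdd (abs_gamHalf_le hH0 hH1))
  rw [integral_sub i1 (i2.const_mul 2), integral_const_mul, integral_exp_neg_mul_gam hH0 hH1,
    gamHalf_zero hH0 hH1] at key
  simp at key
  linarith

theorem integrableOn_Ioi_of_le_rpow {f : ℝ → ℝ} (hf : Continuous f) {C θ : ℝ} (hθ : 1 < θ)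
    (h : ∀ x, 0 < x → |f x| ≤ C * x ^ (-θ)) : IntegrableOn f (Set.Ioi 0) := by
  rw [← Set.Ioc_union_Ioi_eq_Ioi zero_le_one]
  refine IntegrableOn.union ?_ ?_
  · exact hf.integrableOn_Icc.mono_set Set.Ioc_subset_Icc_self
  · refine ((integrableOn_Ioi_rpow_of_lt (a := -θ) (by linarith) zero_lt_one).const_mul C).mono'
      hf.aestronglyMeasurable ?_
    filter_upwards [ae_restrict_mem measurableSet_Ioi] with x hx
    exact h x (zero_lt_one.trans hx)

theorem integrableOn_gam (hH0 : 0 < H) (hH : H ≤ 1 / 2) : IntegrableOn (gam H) (Set.Ioi 0) := by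
  obtain ⟨C, θ, -, hθ, h⟩ := exists_abs_gam_le hH0 hH
  exact integrableOn_Ioi_of_le_rpow (continuous_gam hH0 (by linarith)) hθ h

theorem integrableOn_gam_mul (hH0 : 0 < H) (hH : H ≤ 1 / 2) {f : ℝ → ℝ} (hf : Continuous f) {C : ℝ}
    (hC : ∀ x, |f x| ≤ C) : IntegrableOn (fun x => gam H x * f x) (Set.Ioi 0) :=
  Integrable.mul_bdd (integrableOn_gam hH0 hH) hf.aestronglyMeasurable (ae_of_all _ hC)

theorem integrableOn_gam_sq (hH0 : 0 < H) (hH : H ≤ 1 / 2) :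
    IntegrableOn (fun x => gam H x ^ 2) (Set.Ioi 0) := by
  simp_rw [sq]
  exact integrableOn_gam_mul hH0 hH (continuous_gam hH0 (by linarith))
    (abs_gam_le hH0 (by linarith))

theorem integrableOn_mul_gam_sq (hH0 : 0 < H) (hH : H ≤ 1 / 2) :
    IntegrableOn (fun x => x * gam H x ^ 2) (Set.Ioi 0) := by
  obtain ⟨C, θ, hC, hθ, h⟩ := exists_abs_gam_le hH0 hH
  have hc := continuous_gam hH0 (by linarith : H < 1)
  refine integrableOn_Ioi_of_le_rpow (C := C ^ 2) (θ := 2 * θ - 1) (by fun_prop) (by linarith)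
    fun x hx => ?_
  rw [abs_mul, abs_of_pos hx, abs_pow]
  calc x * |gam H x| ^ 2 ≤ x * (C * x ^ (-θ)) ^ 2 := by gcongr; exact h x hx
    _ = C ^ 2 * x ^ (-(2 * θ - 1)) := by
      rw [show -(2 * θ - 1) = 1 + (-θ + -θ) by ring, Real.rpow_add hx, Real.rpow_add hx,
        Real.rpow_one]
      ring

theorem tendsto_mul_gam (hH0 : 0 < H) (hH : H ≤ 1 / 2) :
    Tendsto (fun x => x * gam H x) atTop (𝓝 0) := by
  obtain ⟨C, θ, -, hθ, h⟩ := exists_abs_gam_le hH0 hH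
  have ht : Tendsto (fun x : ℝ => C * x ^ (-(θ - 1))) atTop (𝓝 0) := by
    simpa using (tendsto_rpow_neg_atTop (by linarith : 0 < θ - 1)).const_mul C
  refine squeeze_zero_norm' ?_ ht
  filter_upwards [eventually_gt_atTop 0] with x hx
  rw [norm_mul, Real.norm_of_nonneg hx.le, Real.norm_eq_abs]
  calc x * |gam H x| ≤ x * (C * x ^ (-θ)) := by gcongr; exact h x hx
    _ = _ := by
      rw [show -(θ - 1) = 1 + (-θ) by ring, Real.rpow_add hx, Real.rpow_one]
      ring

/-- From xγ' = 2Hγ - g one gets (xγ²)' = (1+4H)γ² - 2γg, and xγ² vanishes at both ends. -/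
theorem integral_gam_mul_gamConv (hH0 : 0 < H) (hH : H ≤ 1 / 2) :
    ∫ x in Set.Ioi (0 : ℝ), gam H x * gamConv H x
      = (2 * H + 1 / 2) * ∫ x in Set.Ioi (0 : ℝ), gam H x ^ 2 := by
  have hH1 : H < 1 := by linarith
  have i1 := integrableOn_gam_sq hH0 hH
  have i2 := integrableOn_gam_mul hH0 hH (continuous_gamConv hH0 hH1) (abs_gamConv_le hH0 hH1)
  have hc := continuous_gam hH0 hH1
  have hd : ∀ x ∈ Set.Ioi (0 : ℝ), HasDerivAt (fun x => x * gam H x ^ 2)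
      ((1 + 4 * H) * gam H x ^ 2 - 2 * (gam H x * gamConv H x)) x := by
    intro x hx
    have hx0 : x ≠ 0 := (Set.mem_Ioi.1 hx).ne'
    refine ((hasDerivAt_id x).mul ((hasDerivAt_gam hH0 hH1 hx).pow 2)).congr_deriv ?_
    simp only [id, Nat.cast_ofNat, Pi.pow_apply]
    field_simp
    ring
  have ht : Tendsto (fun x => x * gam H x ^ 2) atTop (𝓝 0) := by
    have := (tendsto_mul_gam hH0 hH).mul (tendsto_gam hH0 hH1)
    simp only [mul_zero] at this
    exact this.congr fun x => by ring
  have key := integral_Ioi_of_hasDerivAt_of_tendsto (a := 0)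
    (by fun_prop : Continuous fun x => x * gam H x ^ 2).continuousWithinAt hd
    ((i1.const_mul _).sub (i2.const_mul 2)) ht
  rw [integral_sub (i1.const_mul _) (i2.const_mul 2), integral_const_mul, integral_const_mul] at key
  simp at key
  linarith

/-- The equation g'' = g - 2γ gives the total derivative (g² - g'²)' = 4γg'; at 0, g = 2Hγ(0) and g'
= 0. -/
theorem integral_gam_mul_gamConv' (hH0 : 0 < H) (hH : H ≤ 1 / 2) :
    ∫ x in Set.Ioi (0 : ℝ), gam H x * gamConv' H x = -(H * gam H 0) ^ 2 := by
  have hH1 : H < 1 := by linarith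
  have i2 := integrableOn_gam_mul hH0 hH (continuous_gamConv' hH0 hH1) (abs_gamConv'_le hH0 hH1)
  have hd : ∀ x ∈ Set.Ici (0 : ℝ), HasDerivAt (fun x => gamConv H x ^ 2 - gamConv' H x ^ 2)
      (4 * (gam H x * gamConv' H x)) x := by
    intro x hx
    refine (((hasDerivAt_gamConv hH0 hH1 x).pow 2).sub
      ((hasDerivAt_gamConv' hH0 hH1 x).pow 2)).congr_deriv ?_
    simp only [Nat.cast_ofNat, Nat.add_one_sub_one, pow_one]
    ring
  have ht : Tendsto (fun x => gamConv H x ^ 2 - gamConv' H x ^ 2) atTop (𝓝 0) := by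
    have := ((tendsto_gamConv hH0 hH1).pow 2).sub ((tendsto_gamConv' hH0 hH1).pow 2)
    simpa using this
  have key := integral_Ioi_of_hasDerivAt_of_tendsto' hd (i2.const_mul 4) ht
  rw [integral_const_mul, gamConv_zero hH0 hH1, gamConv'_zero] at key
  linarith

/-- Multiplying `gamConv'_eq` by γ shows that γg' + xγ² is the derivative of (2H-1)Γ²/2, with Γ the
primitive of γ. Since (2H-1)Γ = g' + xγ tends to 0, the two integrals cancel. -/
theorem integral_mul_gam_sq (hH0 : 0 < H) (hH : H ≤ 1 / 2) :
    ∫ x in Set.Ioi (0 : ℝ), x * gam H x ^ 2 = (H * gam H 0) ^ 2 := by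
  have hH1 : H < 1 := by linarith
  have i1 := integrableOn_mul_gam_sq hH0 hH
  have i2 := integrableOn_gam_mul hH0 hH (continuous_gamConv' hH0 hH1) (abs_gamConv'_le hH0 hH1)
  have hd : ∀ x ∈ Set.Ici (0 : ℝ), HasDerivAt (fun x => (2 * H - 1) / 2 * gamPrim H x ^ 2)
      (gam H x * gamConv' H x + x * gam H x ^ 2) x := by
    intro x hx
    refine (((hasDerivAt_gamPrim hH0 hH1 x).pow 2).const_mul ((2 * H - 1) / 2)).congr_deriv ?_
    simp only [Nat.cast_ofNat, Nat.add_one_sub_one, pow_one, gamConv'_eq hH0 hH1]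
    ring
  have ht : Tendsto (fun x => (2 * H - 1) / 2 * gamPrim H x ^ 2) atTop (𝓝 0) := by
    -- The limit of the primitive is obtained by dividing by 2H - 1; at H = 1/2 the prefactor
    -- vanishes instead.
    rcases eq_or_ne (2 * H - 1) 0 with h0 | h0
    · simp [h0]
    · have h1 := (tendsto_gamConv' hH0 hH1).add (tendsto_mul_gam hH0 hH)
      have h2 := ((h1.pow 2).const_mul (1 / (2 * (2 * H - 1))))
      simp only [add_zero, ne_eq, OfNat.ofNat_ne_zero, not_false_eq_true, zero_pow, mul_zero] at h2
      refine h2.congr fun x => ?_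
      rw [gamConv'_eq hH0 hH1]
      field_simp
      ring
  have key := integral_Ioi_of_hasDerivAt_of_tendsto' hd (i2.add i1) ht
  rw [integral_add i2 i1, integral_gam_mul_gamConv' hH0 hH, gamPrim_zero] at key
  linarith

theorem integral_gam_mul_gamHalf (hH0 : 0 < H) (hH : H ≤ 1 / 2) :
    ∫ x in Set.Ioi (0 : ℝ), gam H x * gamHalf H x
      = (H + 1 / 4) * (∫ x in Set.Ioi (0 : ℝ), gam H x ^ 2) + (H * gam H 0) ^ 2 / 2 := by
  have hH1 : H < 1 := by linarith
  have i1 := integrableOn_gam_mul hH0 hH (continuous_gamConv hH0 hH1) (abs_gamConv_le hH0 hH1)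
  have i2 := integrableOn_gam_mul hH0 hH (continuous_gamConv' hH0 hH1) (abs_gamConv'_le hH0 hH1)
  have : ∀ x, gam H x * gamHalf H x
      = 1 / 2 * (gam H x * gamConv H x - gam H x * gamConv' H x) := by
    intro x; unfold gamHalf; ring
  simp_rw [this]
  rw [integral_const_mul, integral_sub i1 i2, integral_gam_mul_gamConv hH0 hH,
    integral_gam_mul_gamConv' hH0 hH]
  ring


/-! ### Plancherel and the value of the slope -/

open FourierTransform in
/-- Plancherel's identity for an even function with integrable Fourier transform. -/
theorem integral_fourier_sq_of_even {f : ℝ → ℂ} (hf : Integrable f) (h'f : Integrable (𝓕 f))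
    (hc : ∀ ξ, ξ ≠ 0 → ContinuousAt f ξ) (he : ∀ ξ, f (-ξ) = f ξ) :
    ∫ w, 𝓕 f w ^ 2 = ∫ ξ, f ξ ^ 2 := by
  -- Move one Fourier transform across the product; inversion then identifies the double transform
  -- at ξ with f(-ξ).
  have h1 : ∫ w, 𝓕 f w • 𝓕 f w = ∫ ξ, f ξ • 𝓕 (𝓕 f) ξ := by
    simpa using! (VectorFourier.integral_fourierIntegral_smul_eq_flip (L := innerₗ ℝ)
      Real.continuous_fourierChar continuous_inner hf h'f)
  simp_rw [sq, ← smul_eq_mul]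
  rw [h1]
  refine integral_congr_ae ?_
  filter_upwards [Measure.ae_ne volume (0 : ℝ)] with ξ hξ
  have h2 := hf.fourierInv_fourier_eq h'f (hc (-ξ) (neg_ne_zero.2 hξ))
  rw [Real.fourierInv_eq_fourier_neg, neg_neg] at h2
  rw [h2, he]

theorem gam_eq_volume (hH0 : 0 < H) (hH1 : H < 1) (x : ℝ) :
    gam H x = ∫ ξ, Real.cos (x * ξ) * ((specInt H)⁻¹ * (|ξ| ^ (1 - 2 * H) * (1 + ξ ^ 2)⁻¹)) := by
  rw [gam, integral_specMeasure hH0 hH1]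
  refine integral_congr_ae (ae_of_all _ fun ξ => ?_)
  simp only [smul_eq_mul]; ring

open FourierTransform in
theorem fourier_weight (hH0 : 0 < H) (hH1 : H < 1) (w : ℝ) :
    𝓕 (fun ξ : ℝ => (((specInt H)⁻¹ * (|ξ| ^ (1 - 2 * H) * (1 + ξ ^ 2)⁻¹) : ℝ) : ℂ)) w
      = (gam H (2 * Real.pi * w) : ℂ) := by
  set g : ℝ → ℝ := fun ξ => (specInt H)⁻¹ * (|ξ| ^ (1 - 2 * H) * (1 + ξ ^ 2)⁻¹) with hg
  have hgi : Integrable g := (integrable_weight_div hH0 hH1).const_mul _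
  have hodd : ∫ ξ, Real.sin (2 * Real.pi * w * ξ) * g ξ = 0 := by
    have h1 := integral_neg_eq_self (fun ξ => Real.sin (2 * Real.pi * w * ξ) * g ξ) volume
    have h2 : ∀ ξ, Real.sin (2 * Real.pi * w * -ξ) * g (-ξ)
        = -(Real.sin (2 * Real.pi * w * ξ) * g ξ) := by
      intro ξ; simp [hg]
    simp_rw [h2, integral_neg] at h1
    linarith
  rw [Real.fourier_eq', gam_eq_volume hH0 hH1]
  have hpt : ∀ ξ : ℝ, Complex.exp (((-2 * Real.pi * inner ℝ ξ w : ℝ) : ℂ) * Complex.I) • ((g ξ : ℝ) : ℂ)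
      = ((Real.cos (2 * Real.pi * w * ξ) * g ξ : ℝ) : ℂ)
        - ((Real.sin (2 * Real.pi * w * ξ) * g ξ : ℝ) : ℂ) * Complex.I := by
    intro ξ
    have : (-2 * Real.pi * inner ℝ ξ w : ℝ) = -(2 * Real.pi * w * ξ) := by
      simp only [RCLike.inner_apply, conj_trivial]; ring
    rw [this, Complex.exp_mul_I, ← Complex.ofReal_cos, ← Complex.ofReal_sin, Real.cos_neg,
      Real.sin_neg]
    push_cast
    rw [smul_eq_mul]; ring
  refine (integral_congr_ae (ae_of_all _ hpt)).trans ?_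
  rw [integral_sub (integrable_cos_mul hgi _).ofReal ((integrable_sin_mul hgi _).ofReal.mul_const _),
    integral_mul_const, integral_complex_ofReal, integral_complex_ofReal, hodd]
  simp only [Complex.ofReal_zero, zero_mul, sub_zero, hg]

theorem integrable_gam (hH0 : 0 < H) (hH : H ≤ 1 / 2) : Integrable (gam H) := by
  have := integrable_comp_abs (integrableOn_gam hH0 hH)
  simpa only [gam_abs] using this

/-- γ is, up to rescaling by 2π, the Fourier transform of the spectral density times 1/(1+ξ²), whose
square on the half-line is a Beta integrand. The decay for H ≤ 1/2 makes γ integrable, as the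
inversion formula requires. -/
theorem integral_gam_sq_eq (hH0 : 0 < H) (hH : H ≤ 1 / 2) :
    ∫ x in Set.Ioi (0 : ℝ), gam H x ^ 2 = 2 * Real.pi * ((specInt H)⁻¹) ^ 2 *
      ∫ ξ in Set.Ioi (0 : ℝ), ξ ^ ((3 - 4 * H) - 1) * (1 + ξ ^ 2) ^ (-(2 : ℝ)) := by
  have hH1 : H < 1 := by linarith
  set g : ℝ → ℝ := fun ξ => (specInt H)⁻¹ * (|ξ| ^ (1 - 2 * H) * (1 + ξ ^ 2)⁻¹) with hg
  have hgi : Integrable g := (integrable_weight_div hH0 hH1).const_mul _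
  have hF := funext (fourier_weight hH0 hH1)
  have hint : Integrable (fun w : ℝ => (gam H (2 * Real.pi * w) : ℂ)) :=
    ((integrable_gam hH0 hH).comp_mul_left' (by positivity)).ofReal
  have key := integral_fourier_sq_of_even (f := fun ξ : ℝ => ((g ξ : ℝ) : ℂ)) hgi.ofReal
    (by rw [hF]; exact hint) ?_ ?_
  · rw [hF] at key
    simp_rw [← Complex.ofReal_pow] at key
    rw [integral_complex_ofReal, integral_complex_ofReal, Complex.ofReal_inj] at key
    rw [Measure.integral_comp_mul_left (fun x => gam H x ^ 2) (2 * Real.pi)] at key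
    have e1 : ∫ x, gam H x ^ 2 = 2 * ∫ x in Set.Ioi (0 : ℝ), gam H x ^ 2 := by
      rw [← integral_comp_abs (f := fun x => gam H x ^ 2)]
      simp only [gam_abs]
    have e2 : ∫ ξ, g ξ ^ 2 = 2 * ∫ ξ in Set.Ioi (0 : ℝ), g ξ ^ 2 := by
      rw [← integral_comp_abs (f := fun x => g x ^ 2)]
      simp only [hg, abs_abs, sq_abs]
    have e3 : ∫ ξ in Set.Ioi (0 : ℝ), g ξ ^ 2 = ((specInt H)⁻¹) ^ 2 *
        ∫ ξ in Set.Ioi (0 : ℝ), ξ ^ ((3 - 4 * H) - 1) * (1 + ξ ^ 2) ^ (-(2 : ℝ)) := by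
      rw [← integral_const_mul]
      refine setIntegral_congr_fun measurableSet_Ioi fun ξ hξ => ?_
      have hξ0 : (0 : ℝ) < ξ := hξ
      simp only [hg]
      rw [abs_of_pos hξ0, Real.rpow_neg (by positivity), Real.rpow_two,
        show (3 - 4 * H) - 1 = (1 - 2 * H) + (1 - 2 * H) by ring, Real.rpow_add hξ0]
      field_simp
    rw [e1, e2, e3, abs_inv, abs_of_pos (by positivity : 0 < 2 * Real.pi), smul_eq_mul] at key
    have := Real.pi_pos
    field_simp at key ⊢
    linarith
  · intro ξ hξ
    refine Complex.continuous_ofReal.continuousAt.comp ?_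
    refine continuousAt_const.mul ((continuous_abs.continuousAt.rpow_const
      (Or.inl (abs_ne_zero.2 hξ))).mul ?_)
    exact ContinuousAt.inv₀ (by fun_prop) (by positivity)
  · intro ξ; simp [hg]

/-- A second evaluation of γ(0), on the spectral side, by the Beta integral with k = 1 and the
reflection formula. Comparison with `gam_zero` determines the normalizing constant `specInt H`. -/
theorem gam_zero_eq_specInt (hH0 : 0 < H) (hH1 : H < 1) :
    a H = (specInt H)⁻¹ * (Real.pi / Real.sin (Real.pi * H)) := by
  rw [← gam_zero hH0 hH1, gam, integral_even_specMeasure hH0 hH1 (by simp)]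
  have h := (integrableOn_rpow_mul_one_add_sq_rpow (s := 2 - 2 * H) (k := 1)
    (by linarith) (by linarith)).2
  have e : ∀ ξ : ℝ, ξ ^ (1 - 2 * H) * (Real.cos (0 * ξ) * (1 + ξ ^ 2)⁻¹)
      = ξ ^ ((2 - 2 * H) - 1) * (1 + ξ ^ 2) ^ (-(1 : ℝ)) := by
    intro ξ
    rw [Real.rpow_neg_one]; simp; left; congr 1; ring
  simp_rw [e]
  rw [h, Real.Gamma_one, show (2 - 2 * H) / 2 = 1 - H by ring, show 1 - (1 - H) = H by ring,
    mul_comm (Real.Gamma (1 - H)), Real.Gamma_mul_Gamma_one_sub]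
  ring

theorem four_mul_integral_gam_sq (hH0 : 0 < H) (hH : H ≤ 1 / 2) :
    4 * ∫ x in Set.Ioi (0 : ℝ), gam H x ^ 2 = sigmaSq H := by
  have hH1 : H < 1 := by linarith
  have hs : 0 < Real.sin (Real.pi * H) :=
    Real.sin_pos_of_pos_of_lt_pi (by positivity) (by nlinarith [Real.pi_pos])
  have hc : (specInt H)⁻¹ = a H * Real.sin (Real.pi * H) / Real.pi := by
    rw [gam_zero_eq_specInt hH0 hH1]
    have := Real.pi_pos
    field_simp
  have h := (integrableOn_rpow_mul_one_add_sq_rpow (s := 3 - 4 * H) (k := 2)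
    (by linarith) (by linarith)).2
  rw [integral_gam_sq_eq hH0 hH, h, hc, Real.Gamma_two]
  have hpi := Real.pi_pos
  unfold sigmaSq sigmaHSq
  -- At H = 1/4 both Gamma arguments equal 1. Otherwise 1/2 - 2H is nonzero, and the functional and
  -- reflection equations bring in the cosine.
  split_ifs with h4
  · subst h4
    norm_num
    rw [show Real.pi * (1 / 4) = Real.pi / 4 by ring, Real.sin_pi_div_four]
    field_simp
    rw [Real.sq_sqrt (by norm_num)]
    ring
  · have g1 : Real.Gamma ((3 - 4 * H) / 2) = (1 / 2 - 2 * H) * Real.Gamma (1 / 2 - 2 * H) := by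
      rw [← Real.Gamma_add_one (by intro h0; apply h4; linarith)]
      congr 1; ring
    have g2 := Real.Gamma_mul_Gamma_one_sub (1 / 2 - 2 * H)
    have e2 : Real.sin (Real.pi * (1 / 2 - 2 * H)) = Real.cos (2 * H * Real.pi) := by
      rw [← Real.sin_pi_div_two_sub]; congr 1; ring
    have e3 : Real.cos (2 * H * Real.pi) = 1 - 2 * Real.sin (Real.pi * H) ^ 2 := by
      rw [show 2 * H * Real.pi = 2 * (Real.pi * H) by ring, Real.cos_two_mul, Real.cos_sq']
      ring
    have g3 : Real.Gamma ((3 - 4 * H) / 2) * Real.Gamma (2 - (3 - 4 * H) / 2)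
        = (1 / 2 - 2 * H) * (Real.pi / Real.cos (2 * H * Real.pi)) := by
      rw [g1, mul_assoc, show 2 - (3 - 4 * H) / 2 = 1 - (1 / 2 - 2 * H) by ring, g2, e2]
    -- If the cosine were 0, then, since division by 0 yields 0, `g3` would make a product of
    -- positive Gamma values vanish.
    have hcos : Real.cos (2 * H * Real.pi) ≠ 0 := by
      intro h0
      have p1 := Real.Gamma_pos_of_pos (s := (3 - 4 * H) / 2) (by linarith)
      have p2 := Real.Gamma_pos_of_pos (s := 2 - (3 - 4 * H) / 2) (by linarith)
      rw [h0, div_zero, mul_zero] at g3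
      exact (mul_pos p1 p2).ne' g3
    have hs2 : Real.sin (Real.pi * H) ^ 2 = (1 - Real.cos (2 * H * Real.pi)) / 2 := by
      rw [e3]; ring
    rw [g3, div_pow, mul_pow, hs2]
    clear g3 hs2 e2 e3
    generalize Real.cos (2 * H * Real.pi) = C at hcos ⊢
    field_simp
    ring


/-! ### The closed form of the norm and the correction to stationarity -/

/-- Lebesgue measure on `(0, T]`. -/
noncomputable abbrev volT (T : ℝ) : Measure ℝ := volume.restrict (Set.Ioc 0 T)

/-- The covariance of the fractional Ornstein-Uhlenbeck process started at `0`. -/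
noncomputable def rho (H u v : ℝ) : ℝ :=
  gam H (u - v) - Real.exp (-v) * gam H u - Real.exp (-u) * gam H v
    + Real.exp (-u) * Real.exp (-v) * gam H 0

/-- The squared norm of `fT` in closed form. -/
noncomputable def normFun (H T : ℝ) : ℝ :=
  rho H T T ^ 2 + 4 * (∫ u, rho H T u ^ 2 ∂volT T)
    + 4 * ∫ z : ℝ × ℝ, rho H z.1 z.2 ^ 2 ∂((volT T).prod (volT T))

/-- The difference between the squared covariances with and without initial condition. -/
noncomputable def rhoDiff (H : ℝ) (z : ℝ × ℝ) : ℝ :=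
  rho H z.1 z.2 ^ 2 - gam H (z.1 - z.2) ^ 2

theorem continuous_rho (hH0 : 0 < H) (hH1 : H < 1) :
    Continuous fun z : ℝ × ℝ => rho H z.1 z.2 := by
  have := continuous_gam hH0 hH1
  unfold rho
  fun_prop

theorem continuous_rhoDiff (hH0 : 0 < H) (hH1 : H < 1) : Continuous (rhoDiff H) := by
  have := continuous_gam hH0 hH1
  have := continuous_rho hH0 hH1
  unfold rhoDiff
  fun_prop

theorem integrable_volT {f : ℝ → ℝ} (hf : Continuous f) (T : ℝ) : Integrable f (volT T) :=
  hf.integrableOn_Icc.mono_set Set.Ioc_subset_Icc_self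

theorem integrable_volT_prod {f : ℝ × ℝ → ℝ} (hf : Continuous f) (T : ℝ) :
    Integrable f ((volT T).prod (volT T)) := by
  rw [Measure.prod_restrict]
  exact (hf.continuousOn.integrableOn_compact (isCompact_Icc.prod isCompact_Icc)).mono_set
    (Set.prod_mono Set.Ioc_subset_Icc_self Set.Ioc_subset_Icc_self)

/-- Lebesgue measure on `(0, ∞)`. -/
noncomputable abbrev volPos : Measure ℝ := volume.restrict (Set.Ioi 0)

/-- The square γ(u-v)² cancels, so each summand either separates the variables or contains γ(u-v)
only linearly. In the latter case one inner integral is `gamHalf`. -/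
theorem rhoDiff_eq (z : ℝ × ℝ) : rhoDiff H z =
    gam H z.1 ^ 2 * Real.exp (-2 * z.2) + Real.exp (-2 * z.1) * gam H z.2 ^ 2
    + gam H 0 ^ 2 * (Real.exp (-2 * z.1) * Real.exp (-2 * z.2))
    + 2 * ((Real.exp (-z.1) * gam H z.1) * (Real.exp (-z.2) * gam H z.2))
    - 2 * gam H 0 * ((Real.exp (-z.1) * gam H z.1) * Real.exp (-2 * z.2))
    - 2 * gam H 0 * (Real.exp (-2 * z.1) * (Real.exp (-z.2) * gam H z.2))
    + 2 * gam H 0 * (Real.exp (-z.1) * (Real.exp (-z.2) * gam H (z.1 - z.2)))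
    - 2 * (gam H z.1 * (Real.exp (-z.2) * gam H (z.1 - z.2)))
    - 2 * ((Real.exp (-z.1) * gam H (z.1 - z.2)) * gam H z.2) := by
  have e : ∀ x : ℝ, Real.exp (-2 * x) = Real.exp (-x) ^ 2 := by
    intro x; rw [← Real.exp_nat_mul]; congr 1; push_cast; ring
  unfold rhoDiff rho
  rw [e, e]; ring

theorem integrable_exp_neg_two : Integrable (fun x : ℝ => Real.exp (-2 * x)) volPos :=
  integrableOn_exp_mul_Ioi (by norm_num) 0

theorem integral_exp_neg_two : ∫ x, Real.exp (-2 * x) ∂volPos = 1 / 2 := by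
  rw [integral_exp_mul_Ioi (by norm_num) 0]; norm_num

/-- Integrability rests on γ being in L¹ and L² of the half-line. Write a = γ(0) and K for the
integral of γ². The cross terms reduce to integrals of γ and `gamHalf`, and in the total the
contributions H a² and H² a² cancel, as does the bare K. -/
theorem integrable_and_integral_rhoDiff (hH0 : 0 < H) (hH : H ≤ 1 / 2) :
    Integrable (rhoDiff H) (Measure.prod volPos volPos) ∧
    ∫ z, rhoDiff H z ∂(Measure.prod volPos volPos) =
      -4 * H * (∫ x, gam H x ^ 2 ∂volPos) + (1 / 4) * gam H 0 ^ 2 := by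
  have hH1 : H < 1 := by linarith
  have hc := continuous_gam hH0 hH1
  have hb := abs_gam_le hH0 hH1
  have ig : Integrable (gam H) volPos := integrableOn_gam hH0 hH
  have ig2 : Integrable (fun x => gam H x ^ 2) volPos := integrableOn_gam_sq hH0 hH
  have ie : Integrable (fun x : ℝ => Real.exp (-x)) volPos := integrableOn_exp_neg_Ioi 0
  have ie2 := integrable_exp_neg_two
  have ieg : Integrable (fun x => Real.exp (-x) * gam H x) volPos := integrableOn_exp_neg_mul_of_bdd hc hb
  have hcd : Continuous fun z : ℝ × ℝ => gam H (z.1 - z.2) := by fun_prop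
  have i1 := ig2.mul_prod ie2
  have i2 := ie2.mul_prod ig2
  have i3 := (ie2.mul_prod ie2).const_mul (gam H 0 ^ 2)
  have i4 := (ieg.mul_prod ieg).const_mul 2
  have i5 := (ieg.mul_prod ie2).const_mul (2 * gam H 0)
  have i6 := (ie2.mul_prod ieg).const_mul (2 * gam H 0)
  have j7 : Integrable (fun z : ℝ × ℝ =>
      Real.exp (-z.1) * (Real.exp (-z.2) * gam H (z.1 - z.2))) (Measure.prod volPos volPos) := by
    refine ((ie.mul_prod ie).mul_bdd hcd.aestronglyMeasurable (ae_of_all _ fun z => hb _)).congr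
      (ae_of_all _ fun z => ?_)
    simp only; ring
  have j8 : Integrable (fun z : ℝ × ℝ =>
      gam H z.1 * (Real.exp (-z.2) * gam H (z.1 - z.2))) (Measure.prod volPos volPos) := by
    refine ((ig.mul_prod ie).mul_bdd hcd.aestronglyMeasurable (ae_of_all _ fun z => hb _)).congr
      (ae_of_all _ fun z => ?_)
    simp only; ring
  have j9 : Integrable (fun z : ℝ × ℝ =>
      (Real.exp (-z.1) * gam H (z.1 - z.2)) * gam H z.2) (Measure.prod volPos volPos) := by
    refine ((ie.mul_prod ig).mul_bdd hcd.aestronglyMeasurable (ae_of_all _ fun z => hb _)).congr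
      (ae_of_all _ fun z => ?_)
    simp only; ring
  have i7 := j7.const_mul (2 * gam H 0)
  have i8 := j8.const_mul 2
  have i9 := j9.const_mul 2
  have s2 := i1.add i2
  have s3 := s2.add i3
  have s4 := s3.add i4
  have s5 := s4.sub i5
  have s6 := s5.sub i6
  have s7 := s6.add i7
  have s8 := s7.sub i8
  have s9 := s8.sub i9
  have hfun : rhoDiff H = _ := funext (rhoDiff_eq (H := H))
  have hL : ∫ v, Real.exp (-v) * gam H v ∂volPos = H * gam H 0 := integral_exp_neg_mul_gam hH0 hH1
  have v7 : ∫ z : ℝ × ℝ, Real.exp (-z.1) * (Real.exp (-z.2) * gam H (z.1 - z.2)) ∂(Measure.prod volPos volPos)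
      = H * gam H 0 := by
    rw [integral_prod _ j7]
    simp only [integral_const_mul, integral_exp_neg_mul_gam_sub hH0 hH1]
    exact integral_exp_neg_mul_gamHalf hH0 hH1
  have v8 : ∫ z : ℝ × ℝ, gam H z.1 * (Real.exp (-z.2) * gam H (z.1 - z.2)) ∂(Measure.prod volPos volPos)
      = (H + 1 / 4) * (∫ x, gam H x ^ 2 ∂volPos) + (H * gam H 0) ^ 2 / 2 := by
    rw [integral_prod _ j8]
    simp only [integral_const_mul, integral_exp_neg_mul_gam_sub hH0 hH1]
    exact integral_gam_mul_gamHalf hH0 hH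
  have v9 : ∫ z : ℝ × ℝ, (Real.exp (-z.1) * gam H (z.1 - z.2)) * gam H z.2 ∂(Measure.prod volPos volPos)
      = (H + 1 / 4) * (∫ x, gam H x ^ 2 ∂volPos) + (H * gam H 0) ^ 2 / 2 := by
    rw [← v8, ← integral_prod_swap]
    refine integral_congr_ae (ae_of_all _ fun z => ?_)
    simp only [Prod.fst_swap, Prod.snd_swap]
    rw [← gam_neg (z.2 - z.1), neg_sub]; ring
  constructor
  · rw [hfun]; exact s9
  · have h9 := integral_sub' s8 i9
    rw [integral_sub' s7 i8, integral_add' s6 i7, integral_sub' s5 i6, integral_sub' s4 i5,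
      integral_add' s3 i4, integral_add' s2 i3, integral_add' i1 i2] at h9
    refine (integral_congr_ae (ae_of_all _ rhoDiff_eq)).trans (h9.trans ?_)
    simp only [integral_const_mul, v7, v8, v9]
    rw [integral_prod_mul (fun x => gam H x ^ 2) (fun x => Real.exp (-2 * x)),
      integral_prod_mul (fun x => Real.exp (-2 * x)) (fun x => gam H x ^ 2),
      integral_prod_mul (fun x => Real.exp (-2 * x)) (fun x => Real.exp (-2 * x)),
      integral_prod_mul (fun x => Real.exp (-x) * gam H x) (fun x => Real.exp (-x) * gam H x),
      integral_prod_mul (fun x => Real.exp (-x) * gam H x) (fun x => Real.exp (-2 * x)),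
      integral_prod_mul (fun x => Real.exp (-2 * x)) (fun x => Real.exp (-x) * gam H x),
      integral_exp_neg_two, hL]
    ring


/-! ### The asymptote for H ≤ 1/2 -/

/-- The primitive of the squared stationary covariance. -/
noncomputable def gamSqPrim (H T : ℝ) : ℝ := ∫ x in (0 : ℝ)..T, gam H x ^ 2

theorem integral_volT {T : ℝ} (hT : 0 ≤ T) (f : ℝ → ℝ) :
    ∫ u, f u ∂volT T = ∫ u in (0 : ℝ)..T, f u :=
  (intervalIntegral.integral_of_le hT).symm

theorem continuous_gam_sq (hH0 : 0 < H) (hH1 : H < 1) : Continuous fun x => gam H x ^ 2 :=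
  (continuous_gam hH0 hH1).pow 2

theorem hasDerivAt_gamSqPrim (hH0 : 0 < H) (hH1 : H < 1) (x : ℝ) :
    HasDerivAt (gamSqPrim H) (gam H x ^ 2) x :=
  ((continuous_gam_sq hH0 hH1).integral_hasStrictDerivAt 0 x).hasDerivAt

theorem continuous_gamSqPrim (hH0 : 0 < H) (hH1 : H < 1) : Continuous (gamSqPrim H) :=
  continuous_iff_continuousAt.2 fun x => (hasDerivAt_gamSqPrim hH0 hH1 x).continuousAt

theorem gamSqPrim_mono (hH0 : 0 < H) (hH1 : H < 1) : Monotone (gamSqPrim H) :=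
  monotone_of_hasDerivAt_nonneg (hasDerivAt_gamSqPrim hH0 hH1) fun _ => sq_nonneg _

theorem gamSqPrim_zero : gamSqPrim H 0 = 0 := by simp [gamSqPrim]

theorem gamSqPrim_nonneg (hH0 : 0 < H) (hH1 : H < 1) {x : ℝ} (hx : 0 ≤ x) : 0 ≤ gamSqPrim H x :=
  gamSqPrim_zero (H := H) ▸ gamSqPrim_mono hH0 hH1 hx

theorem gamSqPrim_neg (x : ℝ) : gamSqPrim H (-x) = -gamSqPrim H x := by
  have h := intervalIntegral.integral_comp_neg (a := 0) (b := x) (fun y => gam H y ^ 2)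
  simp only [gam_neg, neg_zero] at h
  unfold gamSqPrim
  rw [h, ← intervalIntegral.integral_symm]

theorem integral_gam_sub_sq (hH0 : 0 < H) (hH1 : H < 1) {T : ℝ} (hT : 0 ≤ T) (u : ℝ) :
    ∫ v, gam H (u - v) ^ 2 ∂volT T = gamSqPrim H u + gamSqPrim H (T - u) := by
  have hc := continuous_gam_sq hH0 hH1
  rw [integral_volT hT, intervalIntegral.integral_comp_sub_left (fun x => gam H x ^ 2) u, sub_zero,
    ← intervalIntegral.integral_interval_sub_left (a := 0) (hc.intervalIntegrable _ _)
      (hc.intervalIntegrable _ _)]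
  have := gamSqPrim_neg (H := H) (T - u)
  rw [neg_sub] at this
  change gamSqPrim H u - gamSqPrim H (u - T) = _
  rw [this]; ring

theorem integral_prod_gam_sub_sq (hH0 : 0 < H) (hH1 : H < 1) {T : ℝ} (hT : 0 ≤ T) :
    ∫ z : ℝ × ℝ, gam H (z.1 - z.2) ^ 2 ∂((volT T).prod (volT T))
      = 2 * ∫ x in (0 : ℝ)..T, gamSqPrim H x := by
  have hc := continuous_gam_sq hH0 hH1
  have hG := continuous_gamSqPrim hH0 hH1
  have hi : Integrable (fun z : ℝ × ℝ => gam H (z.1 - z.2) ^ 2) ((volT T).prod (volT T)) :=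
    integrable_volT_prod (hc.comp (by fun_prop : Continuous fun z : ℝ × ℝ => z.1 - z.2)) T
  rw [integral_prod _ hi]
  simp only [integral_gam_sub_sq hH0 hH1 hT]
  have hG2 : Continuous fun u => gamSqPrim H (T - u) := by fun_prop
  rw [integral_volT hT, intervalIntegral.integral_add (hG.intervalIntegrable _ _)
    (hG2.intervalIntegrable _ _),
    intervalIntegral.integral_comp_sub_left (fun x => gamSqPrim H x) T]
  simp; ring

theorem integral_gamSqPrim (hH0 : 0 < H) (hH1 : H < 1) (T : ℝ) :
    ∫ x in (0 : ℝ)..T, gamSqPrim H x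
      = T * gamSqPrim H T - ∫ x in (0 : ℝ)..T, x * gam H x ^ 2 := by
  have hc := continuous_gam_sq hH0 hH1
  have hG := continuous_gamSqPrim hH0 hH1
  have hx : Continuous fun x => x * gam H x ^ 2 := by fun_prop
  have h := intervalIntegral.integral_eq_sub_of_hasDerivAt (a := 0) (b := T)
    (f := fun x => x * gamSqPrim H x) (f' := fun x => gamSqPrim H x + x * gam H x ^ 2)
    (fun x _ => ((hasDerivAt_id x).mul (hasDerivAt_gamSqPrim hH0 hH1 x)).congr_deriv (by simp))
    ((hG.add hx).intervalIntegrable _ _)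
  rw [intervalIntegral.integral_add (hG.intervalIntegrable _ _) (hx.intervalIntegrable _ _)] at h
  simp only [zero_mul, sub_zero] at h
  linarith

/-- The stationary part is split off; when H ≤ 1/2 the bracketed terms converge and only the first
one grows. -/
theorem normFun_eq (hH0 : 0 < H) (hH1 : H < 1) {T : ℝ} (hT : 0 ≤ T) :
    1 / 2 * normFun H T = 4 * (∫ x in (0 : ℝ)..T, gamSqPrim H x)
      + (1 / 2 * rho H T T ^ 2 + 2 * (∫ u, rho H T u ^ 2 ∂volT T)
        + 2 * ∫ z, rhoDiff H z ∂((volT T).prod (volT T))) := by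
  have hc := continuous_gam hH0 hH1
  have h : ∫ z : ℝ × ℝ, rho H z.1 z.2 ^ 2 ∂((volT T).prod (volT T))
      = ∫ z, rhoDiff H z ∂((volT T).prod (volT T))
        + 2 * ∫ x in (0 : ℝ)..T, gamSqPrim H x := by
    rw [← integral_prod_gam_sub_sq hH0 hH1 hT, ← integral_add
      (integrable_volT_prod (continuous_rhoDiff hH0 hH1) T)
      (integrable_volT_prod (by fun_prop) T)]
    refine integral_congr_ae (ae_of_all _ fun z => ?_)
    simp [rhoDiff]
  rw [normFun, h]
  ring

theorem integral_volT_exp_le (T : ℝ) : ∫ u, Real.exp (-u) ∂volT T ≤ 1 := by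
  rw [← integral_exp_neg_Ioi_zero]
  exact setIntegral_mono_set (integrableOn_exp_neg_Ioi 0)
    (ae_of_all _ fun x => Real.exp_nonneg _) (LE.le.eventuallyLE
    (Set.Ioc_subset_Ioi_self : Set.Ioc (0 : ℝ) T ⊆ Set.Ioi 0))

/-- With τ = ρ(T,u) - γ(T-u), the difference of squares is (2γ(T-u) + τ)τ. The first factor is at
most 5γ(0), the second at most e^(-u)|γ(T)| + 2γ(0)e^(-T), and this last bound is integrated over
(0,T]. -/
theorem abs_integral_rho_sq_sub_le (hH0 : 0 < H) (hH1 : H < 1) {T : ℝ} (hT : 0 ≤ T) :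
    |∫ u, rho H T u ^ 2 ∂volT T - gamSqPrim H T|
      ≤ 5 * gam H 0 * (|gam H T| + 2 * gam H 0 * (T * Real.exp (-T))) := by
  have hc := continuous_gam hH0 hH1
  have hcr : Continuous fun u => rho H T u ^ 2 :=
    ((continuous_rho hH0 hH1).comp (Continuous.prodMk_right T)).pow 2
  have hcg : Continuous fun u => gam H (T - u) ^ 2 := by fun_prop
  have h0 : ∫ u, gam H (T - u) ^ 2 ∂volT T = gamSqPrim H T := by
    rw [integral_gam_sub_sq hH0 hH1 hT, sub_self, gamSqPrim_zero, add_zero]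
  have ha : 0 ≤ gam H 0 := (abs_nonneg _).trans (abs_gam_le hH0 hH1 0)
  rw [← h0, ← integral_sub (integrable_volT hcr T) (integrable_volT hcg T)]
  have hce : Continuous fun u => 5 * gam H 0 *
      (Real.exp (-u) * |gam H T| + 2 * gam H 0 * Real.exp (-T)) := by fun_prop
  have hpt : ∀ᵐ u ∂volT T, ‖rho H T u ^ 2 - gam H (T - u) ^ 2‖ ≤ 5 * gam H 0 *
      (Real.exp (-u) * |gam H T| + 2 * gam H 0 * Real.exp (-T)) := by
    filter_upwards [ae_restrict_mem measurableSet_Ioc] with u hu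
    have e1 : Real.exp (-u) ≤ 1 := Real.exp_le_one_iff.2 (by linarith [hu.1])
    have e2 : Real.exp (-T) ≤ 1 := Real.exp_le_one_iff.2 (by linarith)
    have p1 := Real.exp_nonneg (-u)
    have p2 := Real.exp_nonneg (-T)
    have g1 := abs_gam_le hH0 hH1 u
    have g2 := abs_gam_le hH0 hH1 T
    have g3 := abs_gam_le hH0 hH1 (T - u)
    set τ := rho H T u - gam H (T - u) with hτ
    have hτe : τ = -(Real.exp (-u) * gam H T) + -(Real.exp (-T) * gam H u)
      + Real.exp (-T) * Real.exp (-u) * gam H 0 := by rw [hτ, rho]; ring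
    have hτ1 : |τ| ≤ Real.exp (-u) * |gam H T| + 2 * gam H 0 * Real.exp (-T) := by
      rw [hτe]
      refine (abs_add_three _ _ _).trans ?_
      rw [abs_neg, abs_neg, abs_mul, abs_mul, abs_mul, abs_mul, abs_of_nonneg p1, abs_of_nonneg p2,
        abs_of_nonneg ha]
      have q1 : Real.exp (-T) * |gam H u| ≤ Real.exp (-T) * gam H 0 := by gcongr
      have q2 : Real.exp (-T) * Real.exp (-u) * gam H 0 ≤ Real.exp (-T) * gam H 0 := by
        gcongr; exact mul_le_of_le_one_right p2 e1
      linarith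
    have hτ2 : |τ| ≤ 3 * gam H 0 := by
      refine hτ1.trans ?_
      have q1 : Real.exp (-u) * |gam H T| ≤ 1 * gam H 0 := by gcongr
      have q2 : 2 * gam H 0 * Real.exp (-T) ≤ 2 * gam H 0 * 1 := by gcongr
      linarith
    have e : rho H T u ^ 2 - gam H (T - u) ^ 2 = (2 * gam H (T - u) + τ) * τ := by
      rw [hτ]; ring
    rw [e, norm_mul]
    refine mul_le_mul ?_ hτ1 (norm_nonneg _) (by positivity)
    refine (norm_add_le _ _).trans ?_
    rw [norm_mul, Real.norm_two, Real.norm_eq_abs, Real.norm_eq_abs]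
    linarith
  refine (norm_integral_le_of_norm_le (G := ℝ) (integrable_volT hce T) hpt).trans ?_
  rw [integral_const_mul]
  refine mul_le_mul_of_nonneg_left ?_ (by positivity)
  rw [integral_add (integrable_volT (by fun_prop) T) (integrable_volT (by fun_prop) T),
    integral_mul_const, integral_const]
  have hm : (volT T).real Set.univ = T := by simp [hT]
  rw [hm, smul_eq_mul]
  have := mul_le_of_le_one_left (abs_nonneg (gam H T)) (integral_volT_exp_le T)
  linarith

theorem tendsto_rho_diag (hH0 : 0 < H) (hH1 : H < 1) :
    Tendsto (fun T => rho H T T) atTop (𝓝 (gam H 0)) := by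
  have h1 := Real.tendsto_exp_neg_atTop_nhds_zero.mul (tendsto_gam hH0 hH1)
  have h2 := (Real.tendsto_exp_neg_atTop_nhds_zero.mul
    Real.tendsto_exp_neg_atTop_nhds_zero).mul_const (gam H 0)
  have h := ((tendsto_const_nhds (x := gam H 0)).sub h1 |>.sub h1).add h2
  simp only [mul_zero, sub_zero, zero_mul, add_zero] at h
  refine h.congr fun T => ?_
  rw [rho, sub_self]

theorem tendsto_integral_rho_sq_sub (hH0 : 0 < H) (hH1 : H < 1) :
    Tendsto (fun T => ∫ u, rho H T u ^ 2 ∂volT T - gamSqPrim H T) atTop (𝓝 0) := by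
  have h1 := (tendsto_gam hH0 hH1).abs
  have h2 : Tendsto (fun T : ℝ => T * Real.exp (-T)) atTop (𝓝 0) := by
    simpa using Real.tendsto_pow_mul_exp_neg_atTop_nhds_zero 1
  have h3 := (h1.add (h2.const_mul (2 * gam H 0))).const_mul (5 * gam H 0)
  simp only [abs_zero, mul_zero, add_zero] at h3
  refine squeeze_zero_norm' ?_ h3
  filter_upwards [eventually_ge_atTop 0] with T hT
  exact abs_integral_rho_sq_sub_le hH0 hH1 hT

theorem tendsto_gamSqPrim (hH0 : 0 < H) (hH : H ≤ 1 / 2) :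
    Tendsto (gamSqPrim H) atTop (𝓝 (∫ x in Set.Ioi (0 : ℝ), gam H x ^ 2)) :=
  intervalIntegral_tendsto_integral_Ioi 0 (integrableOn_gam_sq hH0 hH) tendsto_id

theorem tendsto_integral_rhoDiff (hH0 : 0 < H) (hH : H ≤ 1 / 2) :
    Tendsto (fun T => ∫ z, rhoDiff H z ∂((volT T).prod (volT T))) atTop
      (𝓝 (-4 * H * (∫ x in Set.Ioi (0 : ℝ), gam H x ^ 2) + (1 / 4) * gam H 0 ^ 2)) := by
  obtain ⟨h1, h2⟩ := integrable_and_integral_rhoDiff hH0 hH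
  rw [← h2]
  rw [Measure.prod_restrict] at h1 ⊢
  have hU : (⋃ T : ℝ, Set.Ioc 0 T ×ˢ Set.Ioc 0 T) = Set.Ioi (0 : ℝ) ×ˢ Set.Ioi (0 : ℝ) := by
    ext ⟨x, y⟩
    simp only [Set.mem_iUnion, Set.mem_prod, Set.mem_Ioc, Set.mem_Ioi]
    exact ⟨fun ⟨T, h⟩ => ⟨h.1.1, h.2.1⟩, fun h =>
      ⟨max x y, ⟨h.1, le_max_left _ _⟩, ⟨h.2, le_max_right _ _⟩⟩⟩
  have h := tendsto_setIntegral_of_monotone (μ := (volume : Measure ℝ).prod (volume : Measure ℝ))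
    (f := rhoDiff H) (s := fun T : ℝ => Set.Ioc 0 T ×ˢ Set.Ioc 0 T)
    (fun T => measurableSet_Ioc.prod measurableSet_Ioc)
    (fun S T hST => Set.prod_mono (Set.Ioc_subset_Ioc_right hST) (Set.Ioc_subset_Ioc_right hST))
    (by rw [hU]; exact h1)
  rw [hU] at h
  refine h.congr fun T => ?_
  rw [Measure.prod_restrict]

/-- After integration by parts it remains to see that T (G(∞) - G(T)) tends to 0. It is at most the
integral of xγ² over (T,∞), the tail of a convergent integral. -/
theorem tendsto_integral_gamSqPrim_sub (hH0 : 0 < H) (hH : H ≤ 1 / 2) :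
    Tendsto (fun T => (∫ x in (0 : ℝ)..T, gamSqPrim H x)
      - (∫ x in Set.Ioi (0 : ℝ), gam H x ^ 2) * T) atTop (𝓝 (-(H * gam H 0) ^ 2)) := by
  have hH1 : H < 1 := by linarith
  have hJ := integrableOn_mul_gam_sq hH0 hH
  have hK := integrableOn_gam_sq hH0 hH
  have t1 : Tendsto (fun T => ∫ x in (0 : ℝ)..T, x * gam H x ^ 2) atTop (𝓝 ((H * gam H 0) ^ 2)) := by
    rw [← integral_mul_gam_sq hH0 hH]
    exact intervalIntegral_tendsto_integral_Ioi 0 hJ tendsto_id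
  have t2 : Tendsto (fun T => T * (gamSqPrim H T - ∫ x in Set.Ioi (0 : ℝ), gam H x ^ 2)) atTop
      (𝓝 0) := by
    have t3 : Tendsto (fun T => (H * gam H 0) ^ 2 - ∫ x in (0 : ℝ)..T, x * gam H x ^ 2) atTop
        (𝓝 0) := by
      have := t1.const_sub ((H * gam H 0) ^ 2)
      rwa [sub_self] at this
    refine squeeze_zero_norm' ?_ t3
    filter_upwards [eventually_ge_atTop 0] with T hT
    have s1 : (H * gam H 0) ^ 2 - ∫ x in (0 : ℝ)..T, x * gam H x ^ 2
        = ∫ x in Set.Ioi T, x * gam H x ^ 2 := by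
      rw [← integral_mul_gam_sq hH0 hH, ← intervalIntegral.integral_Ioi_sub_Ioi hJ hT]
      ring
    have s2 : gamSqPrim H T - ∫ x in Set.Ioi (0 : ℝ), gam H x ^ 2
        = -∫ x in Set.Ioi T, gam H x ^ 2 := by
      rw [gamSqPrim, ← intervalIntegral.integral_Ioi_sub_Ioi hK hT]
      ring
    have p : 0 ≤ ∫ x in Set.Ioi T, gam H x ^ 2 := integral_nonneg fun x => sq_nonneg _
    rw [s1, s2, norm_mul, norm_neg, Real.norm_of_nonneg hT, Real.norm_of_nonneg p,
      ← integral_const_mul]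
    refine setIntegral_mono_on ((hK.mono_set (Set.Ioi_subset_Ioi hT)).const_mul T)
      (hJ.mono_set (Set.Ioi_subset_Ioi hT)) measurableSet_Ioi fun x hx => ?_
    exact mul_le_mul_of_nonneg_right (le_of_lt hx) (sq_nonneg _)
  have t := t2.sub t1
  rw [zero_sub] at t
  refine t.congr fun T => ?_
  rw [integral_gamSqPrim hH0 hH1]
  ring

theorem tendsto_normFun_sub (hH0 : 0 < H) (hH : H ≤ 1 / 2) :
    Tendsto (fun T => 1 / 2 * normFun H T - (sigmaSq H * T + (-((4 * H - 1) / 2) * sigmaSq H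
        - (2 * H - 1) * (2 * H + 1) * a H ^ 2))) atTop (𝓝 0) := by
  have hH1 : H < 1 := by linarith
  have hK := four_mul_integral_gam_sq hH0 hH
  have h1 := (((tendsto_rho_diag hH0 hH1).pow 2).const_mul (1 / 2)).add
    (((tendsto_integral_rho_sq_sub hH0 hH1).add (tendsto_gamSqPrim hH0 hH)).const_mul 2) |>.add
    ((tendsto_integral_rhoDiff hH0 hH).const_mul 2) |>.add
    ((tendsto_integral_gamSqPrim_sub hH0 hH).const_mul 4)
  have h2 := h1.sub_const (-((4 * H - 1) / 2) * sigmaSq H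
        - (2 * H - 1) * (2 * H + 1) * a H ^ 2)
  -- The summands are the limits of the corner, edge, correction and stationary terms; the integral
  -- of γ² is σ²/4.
  have hlim : 1 / 2 * gam H 0 ^ 2 + 2 * (0 + ∫ x in Set.Ioi (0 : ℝ), gam H x ^ 2)
      + 2 * (-4 * H * (∫ x in Set.Ioi (0 : ℝ), gam H x ^ 2) + (1 / 4) * gam H 0 ^ 2)
      + 4 * -(H * gam H 0) ^ 2 - (-((4 * H - 1) / 2) * sigmaSq H
        - (2 * H - 1) * (2 * H + 1) * a H ^ 2) = 0 := by
    rw [gam_zero hH0 hH1, ← hK]; ring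
  rw [hlim] at h2
  refine h2.congr' ?_
  filter_upwards [eventually_ge_atTop 0] with T hT
  rw [normFun_eq hH0 hH1 hT, ← hK]
  ring

theorem integral_gam_sq_pos (hH0 : 0 < H) (hH : H ≤ 1 / 2) :
    0 < ∫ x in Set.Ioi (0 : ℝ), gam H x ^ 2 := by
  have hH1 : H < 1 := by linarith
  have hne : ∀ᶠ x in 𝓝 (0 : ℝ), gam H x ≠ 0 := by
    refine (continuous_gam hH0 hH1).continuousAt.eventually_ne ?_
    rw [gam_zero hH0 hH1]; exact (a_pos hH0).ne'
  obtain ⟨ε, hε, hball⟩ := Metric.eventually_nhds_iff.1 hne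
  rw [setIntegral_pos_iff_support_of_nonneg_ae (ae_of_all _ fun x => sq_nonneg _)
    (integrableOn_gam_sq hH0 hH)]
  refine lt_of_lt_of_le ?_ (measure_mono (s := Set.Ioo 0 ε) fun x hx => ?_)
  · simpa using hε
  · refine ⟨pow_ne_zero 2 (hball ?_), hx.1⟩
    rw [Real.dist_eq, sub_zero, abs_of_pos hx.1]; exact hx.2

/-- Positivity is read off the integral of γ² rather than the trigonometric formula; it makes the
slope nonzero. -/
theorem sigmaSq_pos (hH0 : 0 < H) (hH : H ≤ 1 / 2) : 0 < sigmaSq H := by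
  rw [← four_mul_integral_gam_sq hH0 hH]
  have := integral_gam_sq_pos hH0 hH
  positivity


/-! ### No asymptote for H > 1/2 -/

theorem integral_volT_exp_nonneg (T : ℝ) : 0 ≤ ∫ u, Real.exp (-u) ∂volT T :=
  integral_nonneg fun _ => Real.exp_nonneg _

/-- A majorant of `rhoDiff` on the positive quadrant. -/
noncomputable def rhoDiffBound (H : ℝ) (z : ℝ × ℝ) : ℝ :=
  Real.exp (-z.1) * gam H (z.1 - z.2) ^ 2 + Real.exp (-z.2) * gam H (z.2 - z.1) ^ 2
    + 4 * (gam H z.1 ^ 2 * Real.exp (-z.2)) + 4 * (Real.exp (-z.1) * gam H z.2 ^ 2)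
    + 5 * gam H 0 ^ 2 * (Real.exp (-z.1) * Real.exp (-z.2))

/-- Each term of ρ - γ carries a factor x = e^(-u) or y = e^(-v) in [0,1], so 2|αβ| ≤ α² + β² and x²
≤ x suffice. The coefficient 4 is 1 from a cross term with γ(u-v) plus 3 from the square of the
three corrections; 5 is 2 + 3 likewise. -/
theorem abs_rhoDiff_le (hH0 : 0 < H) (hH1 : H < 1) {z : ℝ × ℝ} (h1 : 0 ≤ z.1) (h2 : 0 ≤ z.2) :
    |rhoDiff H z| ≤ rhoDiffBound H z := by
  have hx : Real.exp (-z.1) ≤ 1 := Real.exp_le_one_iff.2 (by linarith)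
  have hy : Real.exp (-z.2) ≤ 1 := Real.exp_le_one_iff.2 (by linarith)
  have px := Real.exp_nonneg (-z.1)
  have py := Real.exp_nonneg (-z.2)
  have hsym : gam H (z.2 - z.1) = gam H (z.1 - z.2) := by rw [← gam_neg, neg_sub]
  have hg := abs_le.1 (abs_gam_le hH0 hH1 (z.1 - z.2))
  unfold rhoDiff rho rhoDiffBound
  rw [hsym]
  generalize Real.exp (-z.1) = x at *
  generalize Real.exp (-z.2) = y at *
  generalize gam H (z.1 - z.2) = g at *
  generalize gam H z.1 = p
  generalize gam H z.2 = q
  generalize gam H 0 = c at *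
  have hxy : 0 ≤ x * y := mul_nonneg px py
  have hxy1 : x * y ≤ 1 := mul_le_one₀ hx py hy
  have hc : 0 ≤ c := by linarith
  have A2 : (y * p) ^ 2 ≤ y * p ^ 2 := by
    rw [mul_pow]; exact mul_le_mul_of_nonneg_right (by nlinarith) (sq_nonneg _)
  have B2 : (x * q) ^ 2 ≤ x * q ^ 2 := by
    rw [mul_pow]; exact mul_le_mul_of_nonneg_right (by nlinarith) (sq_nonneg _)
  have D2 : (x * y * c) ^ 2 ≤ x * y * c ^ 2 := by
    rw [mul_pow]; exact mul_le_mul_of_nonneg_right (by nlinarith) (sq_nonneg _)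
  have t : (x * y * c - y * p - x * q) ^ 2 ≤ 3 * ((x * y * c) ^ 2 + (y * p) ^ 2 + (x * q) ^ 2) := by
    nlinarith [sq_nonneg (x * y * c + y * p), sq_nonneg (x * y * c + x * q),
      sq_nonneg (y * p - x * q)]
  have t0 := sq_nonneg (x * y * c - y * p - x * q)
  have e : (g - y * p - x * q + x * y * c) ^ 2 - g ^ 2
      = -(y * (2 * g * p)) - x * (2 * g * q) + x * y * (2 * (g * c))
        + (x * y * c - y * p - x * q) ^ 2 := by ring
  have a1 : y * (2 * g * p) ≤ y * (g ^ 2 + p ^ 2) :=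
    mul_le_mul_of_nonneg_left (by nlinarith [sq_nonneg (g - p)]) py
  have a2 : y * -(g ^ 2 + p ^ 2) ≤ y * (2 * g * p) :=
    mul_le_mul_of_nonneg_left (by nlinarith [sq_nonneg (g + p)]) py
  have b1 : x * (2 * g * q) ≤ x * (g ^ 2 + q ^ 2) :=
    mul_le_mul_of_nonneg_left (by nlinarith [sq_nonneg (g - q)]) px
  have b2 : x * -(g ^ 2 + q ^ 2) ≤ x * (2 * g * q) :=
    mul_le_mul_of_nonneg_left (by nlinarith [sq_nonneg (g + q)]) px
  have d1 : x * y * (2 * (g * c)) ≤ x * y * (2 * c ^ 2) :=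
    mul_le_mul_of_nonneg_left (by nlinarith) hxy
  have d2 : x * y * -(2 * c ^ 2) ≤ x * y * (2 * (g * c)) :=
    mul_le_mul_of_nonneg_left (by nlinarith) hxy
  have q1 := mul_nonneg py (sq_nonneg p)
  have q2 := mul_nonneg px (sq_nonneg q)
  have q3 := mul_nonneg hxy (sq_nonneg c)
  rw [e, abs_le]
  constructor <;> linarith

theorem integral_exp_mul_gam_sub_sq_le (hH0 : 0 < H) (hH1 : H < 1) {T : ℝ} (hT : 0 ≤ T) :
    ∫ z : ℝ × ℝ, Real.exp (-z.1) * gam H (z.1 - z.2) ^ 2 ∂((volT T).prod (volT T))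
      ≤ 2 * gamSqPrim H T := by
  have hc := continuous_gam hH0 hH1
  have hG := continuous_gamSqPrim hH0 hH1
  have hi : Integrable (fun z : ℝ × ℝ => Real.exp (-z.1) * gam H (z.1 - z.2) ^ 2)
    ((volT T).prod (volT T)) := integrable_volT_prod (by fun_prop) T
  rw [integral_prod _ hi]
  simp only [integral_const_mul, integral_gam_sub_sq hH0 hH1 hT]
  have hG0 := gamSqPrim_nonneg hH0 hH1 hT
  calc ∫ u, Real.exp (-u) * (gamSqPrim H u + gamSqPrim H (T - u)) ∂volT T
      ≤ ∫ u, Real.exp (-u) * (2 * gamSqPrim H T) ∂volT T := by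
        refine setIntegral_mono_on (integrable_volT (by fun_prop) T)
          (integrable_volT (by fun_prop) T) measurableSet_Ioc fun u hu => ?_
        have h1 := gamSqPrim_mono hH0 hH1 hu.2
        have h2 := gamSqPrim_mono hH0 hH1 (by linarith [hu.1] : T - u ≤ T)
        gcongr
        linarith
    _ = (∫ u, Real.exp (-u) ∂volT T) * (2 * gamSqPrim H T) := integral_mul_const _ _
    _ ≤ 2 * gamSqPrim H T := mul_le_of_le_one_left (by linarith) (integral_volT_exp_le T)

/-- Decay of γ is not used, so the bound covers every H. The coefficient 12 is 2 + 2 + 4 + 4, from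
the first four terms of `rhoDiffBound`. -/
theorem abs_integral_rhoDiff_le (hH0 : 0 < H) (hH1 : H < 1) {T : ℝ} (hT : 0 ≤ T) :
    |∫ z, rhoDiff H z ∂((volT T).prod (volT T))| ≤ 12 * gamSqPrim H T + 5 * gam H 0 ^ 2 := by
  have hc := continuous_gam hH0 hH1
  have i1 : Integrable (fun z : ℝ × ℝ => Real.exp (-z.1) * gam H (z.1 - z.2) ^ 2)
    ((volT T).prod (volT T)) := integrable_volT_prod (by fun_prop) T
  have i2 : Integrable (fun z : ℝ × ℝ => Real.exp (-z.2) * gam H (z.2 - z.1) ^ 2)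
    ((volT T).prod (volT T)) := integrable_volT_prod (by fun_prop) T
  have i3 : Integrable (fun z : ℝ × ℝ => 4 * (gam H z.1 ^ 2 * Real.exp (-z.2)))
    ((volT T).prod (volT T)) := integrable_volT_prod (by fun_prop) T
  have i4 : Integrable (fun z : ℝ × ℝ => 4 * (Real.exp (-z.1) * gam H z.2 ^ 2))
    ((volT T).prod (volT T)) := integrable_volT_prod (by fun_prop) T
  have i5 : Integrable (fun z : ℝ × ℝ => 5 * gam H 0 ^ 2 * (Real.exp (-z.1) * Real.exp (-z.2)))
    ((volT T).prod (volT T)) := integrable_volT_prod (by fun_prop) T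
  have hb : Integrable (rhoDiffBound H) ((volT T).prod (volT T)) :=
    (((i1.add i2).add i3).add i4).add i5
  have hae : ∀ᵐ z ∂((volT T).prod (volT T)), ‖rhoDiff H z‖ ≤ rhoDiffBound H z := by
    rw [Measure.prod_restrict]
    filter_upwards [ae_restrict_mem (measurableSet_Ioc.prod measurableSet_Ioc)] with z hz
    exact abs_rhoDiff_le hH0 hH1 hz.1.1.le hz.2.1.le
  refine (norm_integral_le_of_norm_le (G := ℝ) hb hae).trans ?_
  have h := integral_add' (((i1.add i2).add i3).add i4) i5
  rw [integral_add' ((i1.add i2).add i3) i4, integral_add' (i1.add i2) i3,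
    integral_add' i1 i2] at h
  refine (h : ∫ z, rhoDiffBound H z ∂((volT T).prod (volT T)) = _).trans_le ?_
  simp only [integral_const_mul]
  rw [integral_prod_mul (fun x => gam H x ^ 2) (fun x => Real.exp (-x)),
    integral_prod_mul (fun x => Real.exp (-x)) (fun x => gam H x ^ 2),
    integral_prod_mul (fun x => Real.exp (-x)) (fun x => Real.exp (-x)),
    integral_volT hT (fun x => gam H x ^ 2)]
  have b1 := integral_exp_mul_gam_sub_sq_le hH0 hH1 hT
  have b2 : ∫ z : ℝ × ℝ, Real.exp (-z.2) * gam H (z.2 - z.1) ^ 2 ∂((volT T).prod (volT T))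
      ≤ 2 * gamSqPrim H T :=
    (integral_prod_swap (fun z : ℝ × ℝ => Real.exp (-z.1) * gam H (z.1 - z.2) ^ 2)).trans_le b1
  change _ + _ + 4 * (gamSqPrim H T * _) + 4 * (_ * gamSqPrim H T) + _ ≤ _
  have e0 := integral_volT_exp_nonneg T
  have e1 := integral_volT_exp_le T
  have hG := gamSqPrim_nonneg hH0 hH1 hT
  have m1 := mul_le_of_le_one_right hG e1
  have m2 := mul_le_of_le_one_left hG e1
  have m3 := mul_le_of_le_one_right (by positivity : 0 ≤ 5 * gam H 0 ^ 2) (mul_le_one₀ e1 e0 e1)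
  linarith

theorem exists_normFun_bound (hH0 : 0 < H) (hH1 : H < 1) : ∃ C : ℝ, 0 ≤ C ∧ ∀ᶠ T in atTop,
    |1 / 2 * normFun H T - 4 * ∫ x in (0 : ℝ)..T, gamSqPrim H x| ≤ C * (1 + gamSqPrim H T) := by
  -- The 26 is 2 from the edge term plus 2·12 from the correction, and 10 is 2·5; the middle summand
  -- absorbs the corner term and the edge error.
  refine ⟨26 + (gam H 0 ^ 2 + 2) + 10 * gam H 0 ^ 2, by positivity, ?_⟩
  have h1 : ∀ᶠ T in atTop, |1 / 2 * rho H T T ^ 2| ≤ gam H 0 ^ 2 + 1 := by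
    have := (((tendsto_rho_diag hH0 hH1).pow 2).const_mul (1 / 2)).abs
    have hlt : |1 / 2 * gam H 0 ^ 2| < gam H 0 ^ 2 + 1 := by
      rw [abs_of_nonneg (by positivity)]; nlinarith [sq_nonneg (gam H 0)]
    filter_upwards [this.eventually_lt_const hlt] with T hT using hT.le
  have h2 : ∀ᶠ T in atTop, |∫ u, rho H T u ^ 2 ∂volT T - gamSqPrim H T| ≤ 1 / 2 := by
    have := (tendsto_integral_rho_sq_sub hH0 hH1).abs
    rw [abs_zero] at this
    filter_upwards [this.eventually (gt_mem_nhds (by norm_num : (0 : ℝ) < 1 / 2))] with T hT using hT.le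
  filter_upwards [h1, h2, eventually_ge_atTop 0] with T g1 g2 hT
  have g3 := abs_le.1 (abs_integral_rhoDiff_le hH0 hH1 hT)
  have hG := gamSqPrim_nonneg hH0 hH1 hT
  rw [normFun_eq hH0 hH1 hT, add_sub_cancel_left]
  have g1' := abs_le.1 g1
  have g2' := abs_le.1 g2
  have hp := mul_nonneg (sq_nonneg (gam H 0)) hG
  rw [abs_le]
  constructor <;> nlinarith

theorem sub_mul_gamSqPrim_le (hH0 : 0 < H) (hH1 : H < 1) {s T : ℝ} (hs : 0 ≤ s) (hsT : s ≤ T) :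
    (T - s) * gamSqPrim H s ≤ ∫ x in (0 : ℝ)..T, gamSqPrim H x := by
  have hG := continuous_gamSqPrim hH0 hH1
  rw [← intervalIntegral.integral_add_adjacent_intervals (hG.intervalIntegrable 0 s)
    (hG.intervalIntegrable s T)]
  have h1 : 0 ≤ ∫ x in (0 : ℝ)..s, gamSqPrim H x :=
    intervalIntegral.integral_nonneg hs fun x hx => gamSqPrim_nonneg hH0 hH1 hx.1
  have h2 : ∫ _ in s..T, gamSqPrim H s ≤ ∫ x in s..T, gamSqPrim H x :=
    intervalIntegral.integral_mono_on hsT intervalIntegrable_const (hG.intervalIntegrable _ _)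
      fun x hx => gamSqPrim_mono hH0 hH1 hx.1
  rw [intervalIntegral.integral_const, smul_eq_mul] at h2
  linarith

theorem gamSqPrim_le_add (hH0 : 0 < H) (hH1 : H < 1) {s T : ℝ} (hsT : s ≤ T) :
    gamSqPrim H T ≤ gamSqPrim H s + (T - s) * gam H 0 ^ 2 := by
  have hc := continuous_gam_sq hH0 hH1
  have h := intervalIntegral.integral_interval_sub_left (μ := volume) (a := 0) (b := T) (c := s)
    (hc.intervalIntegrable _ _) (hc.intervalIntegrable _ _)
  have h2 : ∫ x in s..T, gam H x ^ 2 ≤ ∫ _ in s..T, gam H 0 ^ 2 :=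
    intervalIntegral.integral_mono_on hsT (hc.intervalIntegrable _ _) intervalIntegrable_const
      fun x _ => by
      have := abs_gam_le hH0 hH1 x
      rw [← sq_abs]
      exact pow_le_pow_left₀ (abs_nonneg _) this 2
  rw [intervalIntegral.integral_const, smul_eq_mul] at h2
  change gamSqPrim H T - gamSqPrim H s = _ at h
  linarith

theorem tendsto_integral_mul_gam_sq_atTop (hH : 1 / 2 < H) (hH1 : H < 1) :
    Tendsto (fun T => ∫ x in (0 : ℝ)..T, x * gam H x ^ 2) atTop atTop := by
  obtain ⟨c, hc0, hc⟩ := exists_gam_ge hH hH1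
  have hg := continuous_gam (by linarith : 0 < H) hH1
  have hcont : Continuous fun x => x * gam H x ^ 2 := by fun_prop
  refine tendsto_atTop_mono' _ ?_ (Real.tendsto_log_atTop.const_mul_atTop (by positivity : 0 < c ^ 2))
  filter_upwards [eventually_ge_atTop 1] with T hT
  rw [← intervalIntegral.integral_add_adjacent_intervals (hcont.intervalIntegrable 0 1)
    (hcont.intervalIntegrable 1 T)]
  have h1 : 0 ≤ ∫ x in (0 : ℝ)..1, x * gam H x ^ 2 :=
    intervalIntegral.integral_nonneg zero_le_one fun x hx => mul_nonneg hx.1 (sq_nonneg _)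
  have hpos : ∀ x ∈ Set.uIcc 1 T, x ≠ 0 := by
    intro x hx
    rw [Set.uIcc_of_le hT] at hx
    exact (zero_lt_one.trans_le hx.1).ne'
  have h2 : ∫ x in (1 : ℝ)..T, c ^ 2 * x⁻¹ ≤ ∫ x in (1 : ℝ)..T, x * gam H x ^ 2 := by
    refine intervalIntegral.integral_mono_on hT ?_ (hcont.intervalIntegrable _ _) fun x hx => ?_
    · exact (continuousOn_const.mul (continuousOn_id.inv₀ hpos)).intervalIntegrable
    · have hx0 : 0 < x := by linarith [hx.1]
      have := hc x hx.1
      calc c ^ 2 * x⁻¹ = x * (c * x⁻¹) ^ 2 := by field_simp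
        _ ≤ _ := by gcongr
  rw [intervalIntegral.integral_const_mul, integral_inv_of_pos one_pos (by linarith), div_one] at h2
  linarith

theorem not_tendsto_normFun_sub (hH : 1 / 2 < H) (hH1 : H < 1) (m b : ℝ) :
    ¬ Tendsto (fun T => 1 / 2 * normFun H T - (m * T + b)) atTop (𝓝 0) := by
  intro h
  have hH0 : 0 < H := by linarith
  obtain ⟨C, hC0, hC⟩ := exists_normFun_bound hH0 hH1
  have h1 : ∀ᶠ T in atTop, |1 / 2 * normFun H T - (m * T + b)| ≤ 1 := by
    have := h.abs
    rw [abs_zero] at this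
    filter_upwards [this.eventually (gt_mem_nhds zero_lt_one)] with T hT using hT.le
  have h2 : ∀ᶠ T in atTop, |4 * (∫ x in (0 : ℝ)..T, gamSqPrim H x) - (m * T + b)|
      ≤ 1 + C * (1 + gamSqPrim H T) := by
    filter_upwards [h1, hC] with T g1 g2
    rw [abs_le] at *
    constructor <;> linarith
  -- An asymptote forces G to be bounded: by monotonicity 4∫_0^T G ≥ 2T G(T/2), while the upper
  -- bound is linear in T up to C G(T) ≤ C G(T/2) + O(T). For T ≥ C the term C G(T/2) is absorbed on
  -- the left.
  obtain ⟨B, hB⟩ : ∃ B, ∀ x, 0 ≤ x → gamSqPrim H x ≤ B := by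
    refine ⟨|m| + |b| + 1 + C + C * gam H 0 ^ 2, fun x hx => ?_⟩
    obtain ⟨T, g1, g2, g3, g4⟩ := (h2.and ((eventually_ge_atTop (2 * x)).and
      ((eventually_ge_atTop 1).and (eventually_ge_atTop C)))).exists
    refine (gamSqPrim_mono hH0 hH1 (by linarith : x ≤ T / 2)).trans ?_
    have k1 := sub_mul_gamSqPrim_le hH0 hH1 (by linarith : 0 ≤ T / 2) (by linarith : T / 2 ≤ T)
    have k2 := gamSqPrim_le_add hH0 hH1 (by linarith : T / 2 ≤ T)
    have k3 := gamSqPrim_nonneg hH0 hH1 (by linarith : 0 ≤ T / 2)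
    have k4 := (abs_le.1 g1).2
    set y := gamSqPrim H (T / 2)
    have k5 : C * gamSqPrim H T ≤ C * (y + (T - T / 2) * gam H 0 ^ 2) := by gcongr
    have k6 : C * y ≤ T * y := by gcongr
    have k7 : m * T ≤ |m| * T := mul_le_mul_of_nonneg_right (le_abs_self m) (by linarith)
    have k8 : b ≤ |b| * T := (le_abs_self b).trans (le_mul_of_one_le_right (abs_nonneg b) g3)
    have k9 : C ≤ C * T := le_mul_of_one_le_right hC0 g3
    have k10 : 0 ≤ C * T * gam H 0 ^ 2 := by positivity
    have k11 : T * y ≤ T * (|m| + |b| + 1 + C + C * gam H 0 ^ 2) := by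
      nlinarith
    exact le_of_mul_le_mul_left k11 (by linarith)
  -- With the error now bounded, 4(T-s)G(s) ≤ 4∫_0^T G would outgrow mT if 4G(s) exceeded m.
  have hm : ∀ s, 0 ≤ s → 4 * gamSqPrim H s ≤ m := by
    intro s hs
    by_contra! hlt
    set δ := 4 * gamSqPrim H s - m with hδ
    have hδ0 : 0 < δ := by linarith
    obtain ⟨T, g1, g2, g3⟩ := (h2.and ((eventually_ge_atTop s).and
      (eventually_gt_atTop ((4 * s * gamSqPrim H s + b + 1 + C * (1 + B)) / δ)))).exists
    have k1 := sub_mul_gamSqPrim_le hH0 hH1 hs g2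
    have k2 := (abs_le.1 g1).2
    have k3 : C * gamSqPrim H T ≤ C * B := by gcongr; exact hB T (by linarith)
    rw [div_lt_iff₀ hδ0] at g3
    rw [hδ] at g3
    linarith
  -- Now 4∫_0^T G = 4TG(T) - 4∫_0^T xγ² ≤ mT - 4∫_0^T xγ². The asymptote would then bound the
  -- integral of xγ², which diverges.
  obtain ⟨T, g1, g2, g3⟩ := (h2.and ((eventually_ge_atTop 0).and
    ((tendsto_integral_mul_gam_sq_atTop hH hH1).eventually
      (eventually_gt_atTop (1 + C * (1 + B) - b))))).exists
  have k1 := (abs_le.1 g1).1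
  have k3 : C * gamSqPrim H T ≤ C * B := by gcongr; exact hB T g2
  have k4 := mul_le_mul_of_nonneg_right (hm T g2) g2
  have k5 : 0 ≤ ∫ x in (0 : ℝ)..T, x * gam H x ^ 2 :=
    intervalIntegral.integral_nonneg g2 fun x hx => mul_nonneg hx.1 (sq_nonneg _)
  rw [integral_gamSqPrim hH0 hH1] at k1
  linarith


/-! ### The Fourier isometry on elementary functions -/

/-- The Fourier transform of the indicator function of `[0, s]`, away from `0`. -/
noncomputable def indHat (s ξ : ℝ) : ℂ :=
  (Complex.exp ((s * ξ : ℝ) * Complex.I) - 1) / (ξ * Complex.I)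

theorem measurable_indHat (s : ℝ) : Measurable (indHat s) := by
  unfold indHat; fun_prop

theorem norm_exp_sub_one_sq (x : ℝ) :
    ‖Complex.exp ((x : ℝ) * Complex.I) - 1‖ ^ 2 = 2 - 2 * Real.cos x := by
  rw [← Complex.normSq_eq_norm_sq, Complex.normSq_apply]
  simp only [Complex.sub_re, Complex.sub_im, Complex.exp_ofReal_mul_I_re,
    Complex.exp_ofReal_mul_I_im, Complex.one_re, Complex.one_im]
  nlinarith [Real.sin_sq_add_cos_sq x]

theorem norm_indHat_sq (s ξ : ℝ) : ‖indHat s ξ‖ ^ 2 = (2 - 2 * Real.cos (s * ξ)) / ξ ^ 2 := by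
  rw [indHat, norm_div, div_pow, norm_exp_sub_one_sq, norm_mul, Complex.norm_I, mul_one,
    Complex.norm_real, Real.norm_eq_abs, sq_abs]

/-- The real part is the polarization ½(|ŝ|² + |t̂|² - |(s-t)^|²) and matches the covariance term by
term; the imaginary part is odd in ξ and integrates to 0. -/
theorem indHat_mul_conj (s t ξ : ℝ) : indHat s ξ * (starRingEnd ℂ) (indHat t ξ)
    = (((1 / 2 : ℝ) * ((2 - 2 * Real.cos (s * ξ)) / ξ ^ 2 + (2 - 2 * Real.cos (t * ξ)) / ξ ^ 2
        - (2 - 2 * Real.cos ((s - t) * ξ)) / ξ ^ 2) : ℝ) : ℂ)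
      + (((Real.sin ((s - t) * ξ) - Real.sin (s * ξ) + Real.sin (t * ξ)) / ξ ^ 2 : ℝ) : ℂ)
        * Complex.I := by
  rcases eq_or_ne ξ 0 with rfl | hξ
  · simp [indHat]
  have hξ' : (ξ : ℂ) ≠ 0 := by exact_mod_cast hξ
  have hsub : (s - t) * ξ = s * ξ - t * ξ := by ring
  unfold indHat
  rw [hsub, Real.cos_sub, Real.sin_sub, map_div₀, map_sub, map_mul, map_one, ← Complex.exp_conj, map_mul,
    Complex.conj_I, Complex.conj_ofReal, Complex.conj_ofReal, mul_neg,
    show -(((t * ξ : ℝ) : ℂ) * Complex.I) = ((-(t * ξ) : ℝ) : ℂ) * Complex.I by push_cast; ring,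
    Complex.exp_mul_I, Complex.exp_mul_I]
  simp only [← Complex.ofReal_cos, ← Complex.ofReal_sin, Real.cos_neg, Real.sin_neg]
  push_cast
  generalize Complex.cos (s * ξ) = a
  generalize Complex.cos (t * ξ) = b
  generalize Complex.sin (s * ξ) = c
  generalize Complex.sin (t * ξ) = d
  field_simp
  ring_nf
  have h3 : Complex.I ^ 3 = -Complex.I := by rw [pow_succ, Complex.I_sq, neg_one_mul]
  simp only [h3, Complex.I_sq]
  ring

theorem memLp_indHat (hH0 : 0 < H) (hH1 : H < 1) (s : ℝ) :
    MemLp (indHat s) 2 (specMeasure H) := by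
  rw [memLp_two_iff_integrable_sq_norm (measurable_indHat s).aestronglyMeasurable]
  simp only [norm_indHat_sq]
  exact integrable_two_sub_two_cos_specMeasure hH0 hH1 s

theorem memLp_conj_indHat (hH0 : 0 < H) (hH1 : H < 1) (s : ℝ) :
    MemLp (fun ξ => (starRingEnd ℂ) (indHat s ξ)) 2 (specMeasure H) :=
  (memLp_indHat hH0 hH1 s).star

theorem integrable_indHat_mul_conj (hH0 : 0 < H) (hH1 : H < 1) (s t : ℝ) :
    Integrable (fun ξ => indHat s ξ * (starRingEnd ℂ) (indHat t ξ)) (specMeasure H) :=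
  (memLp_indHat hH0 hH1 s).integrable_mul (memLp_conj_indHat hH0 hH1 t)

theorem integral_indHat_mul_conj (hH0 : 0 < H) (hH1 : H < 1) {s t : ℝ} (hs : 0 ≤ s) (ht : 0 ≤ t) :
    ∫ ξ, indHat s ξ * (starRingEnd ℂ) (indHat t ξ) ∂(specMeasure H) = (cov H s t : ℂ) := by
  have hi := integrable_indHat_mul_conj hH0 hH1 s t
  have i := integrable_two_sub_two_cos_specMeasure hH0 hH1
  have v := integral_two_sub_two_cos_specMeasure hH0 hH1
  have e := indHat_mul_conj s t
  apply Complex.ext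
  · have h := integral_re hi
    simp only [RCLike.re_to_complex] at h
    rw [← h, Complex.ofReal_re]
    have : ∀ ξ, (indHat s ξ * (starRingEnd ℂ) (indHat t ξ)).re
        = (1 / 2) * ((2 - 2 * Real.cos (s * ξ)) / ξ ^ 2 + (2 - 2 * Real.cos (t * ξ)) / ξ ^ 2
        - (2 - 2 * Real.cos ((s - t) * ξ)) / ξ ^ 2) := by
      intro ξ; rw [e]; simp only [Complex.add_re, Complex.ofReal_re, Complex.re_ofReal_mul,
        Complex.I_re, mul_zero, add_zero]
    simp only [this]
    have i2 : Integrable (fun ξ : ℝ => (2 - 2 * Real.cos (s * ξ)) / ξ ^ 2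
      + (2 - 2 * Real.cos (t * ξ)) / ξ ^ 2) (specMeasure H) := (i s).add (i t)
    rw [integral_const_mul, integral_sub i2 (i _), integral_add (i s) (i t), v, v, v, cov,
      abs_of_nonneg hs, abs_of_nonneg ht]
    ring
  · have h := integral_im hi
    simp only [RCLike.im_to_complex] at h
    rw [← h, Complex.ofReal_im]
    refine integral_odd_specMeasure hH0 hH1 fun ξ => ?_
    rw [e, e]
    simp only [Complex.add_im, Complex.ofReal_im, Complex.im_ofReal_mul, Complex.I_im, mul_one,
      zero_add, mul_neg, Real.sin_neg, neg_sq]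
    ring

/-- The Fourier transform of an elementary function, away from the axes. -/
noncomputable def Elem.hat (φ : Elem) (z : ℝ × ℝ) : ℂ :=
  φ.sum fun p c => (c : ℂ) * (indHat p.1 z.1 * indHat p.2 z.2)

theorem Elem.hat_sub (φ ψ : Elem) (z : ℝ × ℝ) :
    Elem.hat (φ - ψ) z = Elem.hat φ z - Elem.hat ψ z :=
  Finsupp.sum_sub_index fun p b c => by push_cast; ring

theorem Elem.IsOn.sub {T : ℝ} {φ ψ : Elem} (h1 : φ.IsOn T) (h2 : ψ.IsOn T) : (φ - ψ).IsOn T := by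
  intro p hp
  classical
  rcases Finset.mem_union.1 (Finsupp.support_sub hp) with h | h
  · exact h1 p h
  · exact h2 p h

theorem Elem.measurable_hat (φ : Elem) : Measurable φ.hat := by
  unfold Elem.hat Finsupp.sum
  refine Finset.measurable_sum _ fun p _ => measurable_const.mul ?_
  exact ((measurable_indHat p.1).comp measurable_fst).mul ((measurable_indHat p.2).comp measurable_snd)

theorem Elem.norm_hat_sq (φ : Elem) (z : ℝ × ℝ) : ((‖φ.hat z‖ ^ 2 : ℝ) : ℂ) =
    ∑ p ∈ φ.support, ∑ q ∈ φ.support, ((φ p * φ q : ℝ) : ℂ) *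
      ((indHat p.1 z.1 * (starRingEnd ℂ) (indHat q.1 z.1)) *
        (indHat p.2 z.2 * (starRingEnd ℂ) (indHat q.2 z.2))) := by
  rw [Complex.ofReal_pow, ← Complex.mul_conj', Elem.hat, Finsupp.sum, map_sum, Finset.sum_mul_sum]
  refine Finset.sum_congr rfl fun p _ => Finset.sum_congr rfl fun q _ => ?_
  simp only [map_mul, Complex.conj_ofReal]
  push_cast
  ring

theorem Elem.integrable_norm_hat_sq (hH0 : 0 < H) (hH1 : H < 1) (φ : Elem) :
    Integrable (fun z => ((‖φ.hat z‖ ^ 2 : ℝ) : ℂ)) ((specMeasure H).prod (specMeasure H)) := by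
  simp only [Elem.norm_hat_sq]
  refine integrable_finsetSum _ fun p _ => integrable_finsetSum _ fun q _ => ?_
  exact ((integrable_indHat_mul_conj hH0 hH1 p.1 q.1).mul_prod
    (integrable_indHat_mul_conj hH0 hH1 p.2 q.2)).const_mul _

theorem Elem.memLp_hat (hH0 : 0 < H) (hH1 : H < 1) (φ : Elem) :
    MemLp φ.hat 2 ((specMeasure H).prod (specMeasure H)) := by
  rw [memLp_two_iff_integrable_sq_norm φ.measurable_hat.aestronglyMeasurable]
  exact (Elem.integrable_norm_hat_sq hH0 hH1 φ).re

/-- The square expands into products of functions of the separate frequencies, so Fubini reduces it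
to the one-variable isometry. `IsOn` supplies the nonnegative endpoints for which `cov` agrees with
the spectral formula in |s|^(2H). -/
theorem Elem.integral_norm_hat_sq (hH0 : 0 < H) (hH1 : H < 1) {T : ℝ} {φ : Elem} (hφ : φ.IsOn T) :
    ∫ z, ‖φ.hat z‖ ^ 2 ∂((specMeasure H).prod (specMeasure H)) = Elem.tensorInner H φ φ := by
  rw [← Complex.ofReal_inj, ← integral_complex_ofReal]
  simp only [Elem.norm_hat_sq]
  rw [integral_finsetSum]
  · rw [Elem.tensorInner, Finsupp.sum]
    push_cast
    refine Finset.sum_congr rfl fun p hp => ?_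
    rw [integral_finsetSum, Finsupp.sum]
    · push_cast
      refine Finset.sum_congr rfl fun q hq => ?_
      rw [integral_const_mul, integral_prod_mul
        (fun ξ => indHat p.1 ξ * (starRingEnd ℂ) (indHat q.1 ξ))
        (fun ξ => indHat p.2 ξ * (starRingEnd ℂ) (indHat q.2 ξ)),
        integral_indHat_mul_conj hH0 hH1 (hφ p hp).1.1 (hφ q hq).1.1,
        integral_indHat_mul_conj hH0 hH1 (hφ p hp).2.1 (hφ q hq).2.1]
    · intro q _
      exact ((integrable_indHat_mul_conj hH0 hH1 p.1 q.1).mul_prod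
        (integrable_indHat_mul_conj hH0 hH1 p.2 q.2)).const_mul _
  · intro p _
    exact integrable_finsetSum _ fun q _ => ((integrable_indHat_mul_conj hH0 hH1 p.1 q.1).mul_prod
        (integrable_indHat_mul_conj hH0 hH1 p.2 q.2)).const_mul _


/-! ### The norm of a function as a spectral integral -/

/-- Lebesgue measure on `[0, T]²`. -/
noncomputable abbrev volSq (T : ℝ) : Measure (ℝ × ℝ) :=
  volume.restrict (Set.Icc 0 T ×ˢ Set.Icc 0 T)

theorem volSq_eq (T : ℝ) :
    volSq T = (volume.restrict (Set.Icc 0 T)).prod (volume.restrict (Set.Icc 0 T)) := by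
  rw [Measure.prod_restrict]; rfl

instance (T : ℝ) : IsFiniteMeasure (volSq T) := by
  rw [volSq_eq]; infer_instance

/-- The character `x ↦ exp (i (x₁ z₁ + x₂ z₂))`. -/
noncomputable def char2 (z x : ℝ × ℝ) : ℂ :=
  Complex.exp ((x.1 * z.1 : ℝ) * Complex.I) * Complex.exp ((x.2 * z.2 : ℝ) * Complex.I)

theorem norm_char2 (z x : ℝ × ℝ) : ‖char2 z x‖ = 1 := by
  rw [char2, norm_mul, Complex.norm_exp_ofReal_mul_I, Complex.norm_exp_ofReal_mul_I, one_mul]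

theorem continuous_char2 (z : ℝ × ℝ) : Continuous (char2 z) := by
  unfold char2; fun_prop

/-- The Fourier transform of a function on `[0, T]²`. -/
noncomputable def hatOn (T : ℝ) (f : ℝ × ℝ → ℝ) (z : ℝ × ℝ) : ℂ :=
  ∫ x, (f x : ℂ) * char2 z x ∂volSq T

theorem integral_exp_mul_I (s : ℝ) {ξ : ℝ} (hξ : ξ ≠ 0) :
    ∫ x in (0 : ℝ)..s, Complex.exp ((x * ξ : ℝ) * Complex.I) = indHat s ξ := by
  have hc : (ξ : ℂ) * Complex.I ≠ 0 :=
    mul_ne_zero (by exact_mod_cast hξ) Complex.I_ne_zero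
  have h := integral_exp_mul_complex (a := 0) (b := s) hc
  rw [indHat]
  simp only [Complex.ofReal_zero, mul_zero, Complex.exp_zero] at h
  rw [show ((s * ξ : ℝ) : ℂ) * Complex.I = ξ * Complex.I * s by push_cast; ring, ← h]
  congr 1 with x
  congr 1; push_cast; ring

theorem integral_indicator_mul_exp {s T ξ : ℝ} (hs : s ∈ Set.Icc 0 T) (hξ : ξ ≠ 0) :
    ∫ x in Set.Icc 0 T, ((((Set.Icc 0 s).indicator 1 x : ℝ)) : ℂ) *
      Complex.exp ((x * ξ : ℝ) * Complex.I) = indHat s ξ := by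
  have h : ∀ x : ℝ, ((((Set.Icc 0 s).indicator 1 x : ℝ)) : ℂ) *
      Complex.exp ((x * ξ : ℝ) * Complex.I)
      = (Set.Icc 0 s).indicator (fun x : ℝ => Complex.exp ((x * ξ : ℝ) * Complex.I)) x := by
    intro x
    by_cases hx : x ∈ Set.Icc 0 s <;> simp [hx]
  simp only [h]
  rw [setIntegral_indicator measurableSet_Icc,
    Set.inter_eq_right.2 (Set.Icc_subset_Icc_right hs.2), integral_Icc_eq_integral_Ioc,
    ← intervalIntegral.integral_of_le hs.1, integral_exp_mul_I s hξ]

theorem integrable_indicator_mul_exp (s T ξ : ℝ) :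
    Integrable (fun x : ℝ => ((((Set.Icc 0 s).indicator 1 x : ℝ)) : ℂ) *
      Complex.exp ((x * ξ : ℝ) * Complex.I)) (volume.restrict (Set.Icc 0 T)) := by
  have hc : Continuous fun x : ℝ => Complex.exp ((x * ξ : ℝ) * Complex.I) := by fun_prop
  refine (hc.integrableOn_Icc (a := 0) (b := T)).bdd_mul (c := 1) ?_ (ae_of_all _ fun x => ?_)
  · refine (Complex.measurable_ofReal.comp ?_).aestronglyMeasurable
    exact measurable_one.indicator measurableSet_Icc
  · by_cases hx : x ∈ Set.Icc 0 s <;> simp [hx]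

theorem Elem.measurable_toFun (φ : Elem) : Measurable φ.toFun := by
  unfold Elem.toFun Finsupp.sum
  refine Finset.measurable_sum _ fun p _ => measurable_const.mul ?_
  exact ((measurable_one.indicator measurableSet_Icc).comp measurable_fst).mul
    ((measurable_one.indicator measurableSet_Icc).comp measurable_snd)

theorem Elem.toFun_mul_char2 (φ : Elem) (z x : ℝ × ℝ) : (φ.toFun x : ℂ) * char2 z x =
    ∑ p ∈ φ.support, (φ p : ℂ) *
      ((((((Set.Icc 0 p.1).indicator 1 x.1 : ℝ)) : ℂ) * Complex.exp ((x.1 * z.1 : ℝ) * Complex.I)) *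
      (((((Set.Icc 0 p.2).indicator 1 x.2 : ℝ)) : ℂ) * Complex.exp ((x.2 * z.2 : ℝ) * Complex.I))) := by
  rw [Elem.toFun, Finsupp.sum, Complex.ofReal_sum, Finset.sum_mul]
  refine Finset.sum_congr rfl fun p _ => ?_
  rw [char2]
  push_cast
  ring

theorem Elem.integrable_toFun_mul_char2 (φ : Elem) (T : ℝ) (z : ℝ × ℝ) :
    Integrable (fun x => (φ.toFun x : ℂ) * char2 z x) (volSq T) := by
  rw [volSq_eq]
  simp only [Elem.toFun_mul_char2]
  exact integrable_finsetSum _ fun p _ => ((integrable_indicator_mul_exp _ _ _).mul_prod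
    (integrable_indicator_mul_exp _ _ _)).const_mul _

theorem Elem.hatOn_toFun {T : ℝ} {φ : Elem} (hφ : φ.IsOn T) {z : ℝ × ℝ} (h1 : z.1 ≠ 0)
    (h2 : z.2 ≠ 0) : hatOn T φ.toFun z = φ.hat z := by
  rw [hatOn, volSq_eq]
  simp only [Elem.toFun_mul_char2]
  rw [integral_finsetSum _ fun p _ => ((integrable_indicator_mul_exp _ _ _).mul_prod
    (integrable_indicator_mul_exp _ _ _)).const_mul _, Elem.hat, Finsupp.sum]
  refine Finset.sum_congr rfl fun p hp => ?_
  rw [integral_const_mul, integral_prod_mul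
    (fun x : ℝ => ((((Set.Icc 0 p.1).indicator 1 x : ℝ)) : ℂ) *
      Complex.exp ((x * z.1 : ℝ) * Complex.I))
    (fun x : ℝ => ((((Set.Icc 0 p.2).indicator 1 x : ℝ)) : ℂ) *
      Complex.exp ((x * z.2 : ℝ) * Complex.I)),
    integral_indicator_mul_exp (hφ p hp).1 h1, integral_indicator_mul_exp (hφ p hp).2 h2]

/-- On a finite measure space L² convergence implies L¹ convergence, and the characters have modulus
1. This pointwise limit ties the L² limit to the limit in the completion. -/
theorem tendsto_hat_of_tendsto {T : ℝ} {f : ℝ × ℝ → ℝ} (hf : Integrable f (volSq T))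
    {φ : ℕ → Elem} (hon : ∀ n, (φ n).IsOn T)
    (hlim : Tendsto (fun n => eLpNorm (fun x => (φ n).toFun x - f x) 2 (volSq T)) atTop (𝓝 0))
    {z : ℝ × ℝ} (h1 : z.1 ≠ 0) (h2 : z.2 ≠ 0) :
    Tendsto (fun n => (φ n).hat z) atTop (𝓝 (hatOn T f z)) := by
  simp only [← Elem.hatOn_toFun (hon _) h1 h2]
  have hfi : Integrable (fun x => (f x : ℂ) * char2 z x) (volSq T) :=
    hf.ofReal.mul_bdd (c := 1) (continuous_char2 z).aestronglyMeasurable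
      (ae_of_all _ fun x => (norm_char2 z x).le)
  refine tendsto_integral_of_L1' _ hfi.aestronglyMeasurable
    (Eventually.of_forall fun n => (φ n).integrable_toFun_mul_char2 T z) ?_
  have hm : ∀ n, AEStronglyMeasurable (fun x => (φ n).toFun x - f x) (volSq T) := fun n =>
    (φ n).measurable_toFun.aestronglyMeasurable.sub hf.aestronglyMeasurable
  have hle : ∀ n, eLpNorm ((fun x => ((φ n).toFun x : ℂ) * char2 z x)
      - fun x => (f x : ℂ) * char2 z x) 1 (volSq T)
      ≤ eLpNorm (fun x => (φ n).toFun x - f x) 2 (volSq T)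
        * (volSq T) Set.univ ^ (1 / (1 : ENNReal).toReal - 1 / (2 : ENNReal).toReal) := by
    intro n
    refine le_trans (le_of_eq ?_) (eLpNorm_le_eLpNorm_mul_rpow_measure_univ one_le_two (hm n))
    refine eLpNorm_congr_norm_ae (ae_of_all _ fun x => ?_)
    simp only [Pi.sub_apply]
    rw [← sub_mul, norm_mul, norm_char2, mul_one, ← Complex.ofReal_sub, Complex.norm_real]
  have h0 : Tendsto (fun n => eLpNorm (fun x => (φ n).toFun x - f x) 2 (volSq T)
        * (volSq T) Set.univ ^ (1 / (1 : ENNReal).toReal - 1 / (2 : ENNReal).toReal)) atTop (𝓝 0) := by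
    have := ENNReal.Tendsto.mul_const hlim (b := (volSq T) Set.univ ^
      (1 / (1 : ENNReal).toReal - 1 / (2 : ENNReal).toReal))
      (Or.inr (ENNReal.rpow_ne_top_of_nonneg (by norm_num) (measure_ne_top _ _)))
    rwa [zero_mul] at this
  exact tendsto_of_tendsto_of_tendsto_of_le_of_le tendsto_const_nhds h0 (fun _ => zero_le) hle

theorem specMeasure_prod_ae_ne_zero :
    ∀ᵐ z ∂((specMeasure H).prod (specMeasure H)), z.1 ≠ 0 ∧ z.2 ≠ 0 := by
  have h1 := Measure.quasiMeasurePreserving_fst (μ := specMeasure H) (ν := specMeasure H)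
    |>.ae (specMeasure_ae_ne_zero (H := H))
  have h2 := Measure.quasiMeasurePreserving_snd (μ := specMeasure H) (ν := specMeasure H)
    |>.ae (specMeasure_ae_ne_zero (H := H))
  exact h1.and h2

theorem norm_toLp_sq {α : Type*} [MeasurableSpace α] {μ : Measure α} {f : α → ℂ} (hf : MemLp f 2 μ) :
    ‖hf.toLp f‖ ^ 2 = ∫ x, ‖f x‖ ^ 2 ∂μ := by
  rw [Lp.norm_toLp, hf.eLpNorm_eq_integral_rpow_norm two_ne_zero ENNReal.ofNat_ne_top,
    ENNReal.toReal_ofReal (by positivity)]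
  simp only [ENNReal.toReal_ofNat, Real.rpow_two]
  rw [← one_div, ← Real.sqrt_eq_rpow, Real.sq_sqrt (integral_nonneg fun x => sq_nonneg _)]

/-- By the isometry the transforms form a Cauchy sequence in a complete L² space. A subsequence
converges almost everywhere to the limit, and pointwise to the transform of f. So the limit depends
on f alone. -/
theorem eq_integral_of_isTensorNormSq (hH0 : 0 < H) (hH1 : H < 1) {T : ℝ} {f : ℝ × ℝ → ℝ}
    (hf : Integrable f (volSq T)) {N : ℝ} (h : IsTensorNormSq H T f N) :
    N = ∫ z, ‖hatOn T f z‖ ^ 2 ∂((specMeasure H).prod (specMeasure H)) := by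
  obtain ⟨φ, hon, hlim, hcau, hN⟩ := h
  set μ2 := (specMeasure H).prod (specMeasure H)
  set g : ℕ → Lp ℂ 2 μ2 := fun n => ((φ n).memLp_hat hH0 hH1).toLp _ with hg
  have hnorm : ∀ n, ‖g n‖ ^ 2 = Elem.tensorInner H (φ n) (φ n) := fun n => by
    rw [hg, norm_toLp_sq, Elem.integral_norm_hat_sq hH0 hH1 (hon n)]
  have hdist : ∀ m n, dist (g m) (g n) ^ 2 = Elem.tensorInner H (φ m - φ n) (φ m - φ n) := by
    intro m n
    rw [dist_eq_norm, hg]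
    simp only
    rw [← MemLp.toLp_sub, norm_toLp_sq, ← Elem.integral_norm_hat_sq hH0 hH1 ((hon m).sub (hon n))]
    simp only [Elem.hat_sub, Pi.sub_apply]
  have hC : CauchySeq g := by
    refine Metric.cauchySeq_iff.2 fun ε hε => ?_
    obtain ⟨n₀, h0⟩ := hcau (ε ^ 2) (by positivity)
    refine ⟨n₀, fun m hm n hn => ?_⟩
    have := h0 m hm n hn
    rw [← hdist] at this
    exact lt_of_pow_lt_pow_left₀ 2 hε.le this
  obtain ⟨G, hG⟩ := cauchySeq_tendsto_of_complete hC
  obtain ⟨ns, hns, hae⟩ := (tendstoInMeasure_of_tendsto_Lp hG).exists_seq_tendsto_ae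
  have hcoe : ∀ᵐ z ∂μ2, ∀ n, g n z = (φ n).hat z :=
    ae_all_iff.2 fun n => MemLp.coeFn_toLp _
  have hGe : ∀ᵐ z ∂μ2, G z = hatOn T f z := by
    filter_upwards [hae, hcoe, specMeasure_prod_ae_ne_zero (H := H)] with z h1 h2 h3
    have h4 := (tendsto_hat_of_tendsto hf hon hlim h3.1 h3.2).comp hns.tendsto_atTop
    refine tendsto_nhds_unique h1 (h4.congr fun n => ?_)
    rw [h2]; rfl
  have h5 : Tendsto (fun n => Elem.tensorInner H (φ n) (φ n)) atTop (𝓝 (‖G‖ ^ 2)) := by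
    simp only [← hnorm]
    exact hG.norm.pow 2
  rw [tendsto_nhds_unique hN h5]
  have h6 := norm_toLp_sq (Lp.memLp G)
  rw [Lp.toLp_coeFn] at h6
  rw [h6]
  refine integral_congr_ae ?_
  filter_upwards [hGe] with z hz
  rw [hz]

theorem isTensorNormSq_of_dominated (hH0 : 0 < H) (hH1 : H < 1) {T : ℝ} {f : ℝ × ℝ → ℝ}
    (hf : Integrable f (volSq T)) {φ : ℕ → Elem} (hon : ∀ n, (φ n).IsOn T)
    (hlim : Tendsto (fun n => eLpNorm (fun x => (φ n).toFun x - f x) 2 (volSq T)) atTop (𝓝 0))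
    {B : ℝ × ℝ → ℝ} (hB : Integrable B ((specMeasure H).prod (specMeasure H)))
    (hle : ∀ n z, z.1 ≠ 0 → z.2 ≠ 0 → ‖(φ n).hat z‖ ^ 2 ≤ B z) :
    IsTensorNormSq H T f
      (∫ z, ‖hatOn T f z‖ ^ 2 ∂((specMeasure H).prod (specMeasure H))) := by
  set μ2 := (specMeasure H).prod (specMeasure H)
  have hpt : ∀ᵐ z ∂μ2, Tendsto (fun n => (φ n).hat z) atTop (𝓝 (hatOn T f z)) := by
    filter_upwards [specMeasure_prod_ae_ne_zero (H := H)] with z hz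
    exact tendsto_hat_of_tendsto hf hon hlim hz.1 hz.2
  have hmeas : AEStronglyMeasurable (hatOn T f) μ2 :=
    aestronglyMeasurable_of_tendsto_ae atTop
      (fun n => (φ n).measurable_hat.aestronglyMeasurable) hpt
  have hfB : ∀ᵐ z ∂μ2, ‖hatOn T f z‖ ^ 2 ≤ B z := by
    filter_upwards [hpt, specMeasure_prod_ae_ne_zero (H := H)] with z hz h0
    exact le_of_tendsto (hz.norm.pow 2) (Eventually.of_forall fun n => hle n z h0.1 h0.2)
  have hd : Tendsto (fun n => ∫ z, ‖(φ n).hat z - hatOn T f z‖ ^ 2 ∂μ2) atTop (𝓝 0) := by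
    have := tendsto_integral_of_dominated_convergence (μ := μ2)
      (F := fun n z => ‖(φ n).hat z - hatOn T f z‖ ^ 2) (f := fun _ => 0)
      -- From |p - q|² ≤ 2|p|² + 2|q|² with both squares at most `B`.
      (fun z => 4 * B z)
      (fun n => (((φ n).measurable_hat.aestronglyMeasurable.sub hmeas).norm.pow 2)) (hB.const_mul 4)
      (fun n => ?_) ?_
    · simpa using this
    · filter_upwards [hfB, specMeasure_prod_ae_ne_zero (H := H)] with z h1 h0
      have h2 := hle n z h0.1 h0.2
      have h3 := norm_sub_le ((φ n).hat z) (hatOn T f z)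
      have h4 := pow_le_pow_left₀ (norm_nonneg _) h3 2
      rw [norm_pow, norm_norm]
      nlinarith [sq_nonneg (‖(φ n).hat z‖ - ‖hatOn T f z‖)]
    · filter_upwards [hpt] with z hz
      simpa using ((hz.sub_const (hatOn T f z)).norm.pow 2)
  have hint : ∀ n, Integrable (fun z => ‖(φ n).hat z - hatOn T f z‖ ^ 2) μ2 := by
    intro n
    refine (hB.const_mul 4).mono'
      (((φ n).measurable_hat.aestronglyMeasurable.sub hmeas).norm.pow 2) ?_
    filter_upwards [hfB, specMeasure_prod_ae_ne_zero (H := H)] with z h1 h0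
    have h2 := hle n z h0.1 h0.2
    have h3 := norm_sub_le ((φ n).hat z) (hatOn T f z)
    have h4 := pow_le_pow_left₀ (norm_nonneg _) h3 2
    rw [norm_pow, norm_norm]
    nlinarith [sq_nonneg (‖(φ n).hat z‖ - ‖hatOn T f z‖)]
  refine ⟨φ, hon, hlim, fun ε hε => ?_, ?_⟩
  · obtain ⟨n₀, h0⟩ := eventually_atTop.1 (hd.eventually_lt_const (by positivity : 0 < ε / 4))
    refine ⟨n₀, fun m hm n hn => ?_⟩
    rw [← Elem.integral_norm_hat_sq hH0 hH1 ((hon m).sub (hon n))]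
    have hle2 : ∫ z, ‖(φ m - φ n).hat z‖ ^ 2 ∂μ2
        ≤ ∫ z, (2 * ‖(φ m).hat z - hatOn T f z‖ ^ 2 + 2 * ‖(φ n).hat z - hatOn T f z‖ ^ 2) ∂μ2 := by
      refine integral_mono_of_nonneg (ae_of_all _ fun z => sq_nonneg _)
        (((hint m).const_mul 2).add ((hint n).const_mul 2)) (ae_of_all _ fun z => ?_)
      simp only [Elem.hat_sub]
      have h3 := norm_sub_le ((φ m).hat z - hatOn T f z) ((φ n).hat z - hatOn T f z)
      rw [sub_sub_sub_cancel_right] at h3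
      have h4 := pow_le_pow_left₀ (norm_nonneg _) h3 2
      nlinarith [sq_nonneg (‖(φ m).hat z - hatOn T f z‖ - ‖(φ n).hat z - hatOn T f z‖)]
    rw [integral_add ((hint m).const_mul 2) ((hint n).const_mul 2), integral_const_mul,
      integral_const_mul] at hle2
    linarith [h0 m hm, h0 n hn]
  · simp only [← Elem.integral_norm_hat_sq hH0 hH1 (hon _)]
    refine tendsto_integral_of_dominated_convergence B
      (fun n => ((φ n).measurable_hat.aestronglyMeasurable.norm.pow 2)) hB (fun n => ?_) ?_
    · filter_upwards [specMeasure_prod_ae_ne_zero (H := H)] with z h0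
      rw [norm_pow, norm_norm]
      exact hle n z h0.1 h0.2
    · filter_upwards [hpt] with z hz
      exact hz.norm.pow 2


/-! ### Grid discretization of the exponential kernel -/

theorem abs_exp_neg_sub_le {x y : ℝ} (hx : 0 ≤ x) (hy : 0 ≤ y) :
    |Real.exp (-x) - Real.exp (-y)| ≤ |x - y| := by
  wlog h : x ≤ y generalizing x y
  · rw [abs_sub_comm, abs_sub_comm x]; exact this hy hx (le_of_not_ge h)
  have h1 : Real.exp (-y) ≤ Real.exp (-x) := Real.exp_le_exp.2 (by linarith)
  have h2 : Real.exp (-y) = Real.exp (-x) * Real.exp (-(y - x)) := by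
    rw [← Real.exp_add]; congr 1; ring
  have h3 := Real.add_one_le_exp (-(y - x))
  have h4 : Real.exp (-x) ≤ 1 := Real.exp_le_one_iff.2 (by linarith)
  rw [abs_of_nonneg (by linarith), abs_sub_comm, abs_of_nonneg (by linarith), h2]
  nlinarith [Real.exp_pos (-x)]

/-- The values of `exp (-|t - s|)` on a grid of mesh `δ`, cut off after the index `m`. -/
noncomputable def gridVal (m : ℕ) (δ : ℝ) (j k : ℕ) : ℝ :=
  if j ≤ m ∧ k ≤ m then Real.exp (-|((j : ℝ) - k) * δ|) else 0

/-- The mixed second difference of `gridVal`. -/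
noncomputable def gridCoeff (m : ℕ) (δ : ℝ) (j k : ℕ) : ℝ :=
  gridVal m δ j k - gridVal m δ (j + 1) k - (gridVal m δ j (k + 1) - gridVal m δ (j + 1) (k + 1))

/-- The elementary function that agrees with a grid discretization of `exp (-|t - s|)`. -/
noncomputable def gridElem (m : ℕ) (δ : ℝ) : Elem :=
  ∑ j ∈ Finset.range (m + 1), ∑ k ∈ Finset.range (m + 1),
    Finsupp.single (((j : ℝ) + 1) * δ, ((k : ℝ) + 1) * δ) (gridCoeff m δ j k)

theorem gridElem_isOn {m : ℕ} {δ : ℝ} (hδ : 0 ≤ δ) :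
    (gridElem m δ).IsOn ((m + 1) * δ) := by
  classical
  intro p hp
  obtain ⟨j, hj, hp⟩ := Finset.mem_biUnion.1 (Finsupp.support_finsetSum hp)
  obtain ⟨k, hk, hp⟩ := Finset.mem_biUnion.1 (Finsupp.support_finsetSum hp)
  have hp' := Finset.mem_singleton.1 (Finsupp.support_single_subset hp)
  have key : ∀ i ∈ Finset.range (m + 1), ((i : ℝ) + 1) * δ ∈ Set.Icc 0 ((m + 1) * δ) := by
    intro i hi
    have hi' : (i : ℝ) ≤ m := by exact_mod_cast Nat.lt_succ_iff.1 (Finset.mem_range.1 hi)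
    exact ⟨by positivity, by gcongr⟩
  rw [hp']
  exact ⟨key j hj, key k hk⟩

theorem sum_gridElem {M : Type*} [AddCommMonoid M] (m : ℕ) (δ : ℝ)
    (h : ℝ × ℝ → ℝ → M) (h0 : ∀ p, h p 0 = 0) (hadd : ∀ p b c, h p (b + c) = h p b + h p c) :
    (gridElem m δ).sum h = ∑ j ∈ Finset.range (m + 1), ∑ k ∈ Finset.range (m + 1),
      h (((j : ℝ) + 1) * δ, ((k : ℝ) + 1) * δ) (gridCoeff m δ j k) := by
  rw [gridElem, ← Finsupp.sum_finsetSum_index h0 hadd]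
  refine Finset.sum_congr rfl fun j _ => ?_
  rw [← Finsupp.sum_finsetSum_index h0 hadd]
  exact Finset.sum_congr rfl fun k _ => Finsupp.sum_single_index (h0 _)

theorem sum_range_sub_mul_ite (v : ℕ → ℝ) (n J : ℕ) (hJ : J ≤ n) :
    ∑ j ∈ Finset.range n, (v j - v (j + 1)) * (if J ≤ j then 1 else 0) = v J - v n := by
  induction n, hJ using Nat.le_induction with
  | base =>
    rw [sub_self]
    refine Finset.sum_eq_zero fun j hj => ?_
    rw [if_neg (not_le.2 (Finset.mem_range.1 hj)), mul_zero]
  | succ n hn ih => rw [Finset.sum_range_succ, ih, if_pos hn]; ring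

/-- The indicators select the nodes with j ≥ J and k ≥ K, and the mixed differences telescope to the
value at (J,K). The upper boundary terms vanish because `gridVal` is cut off after m. -/
theorem gridElem_toFun {m : ℕ} {δ : ℝ} {x : ℝ × ℝ} {J K : ℕ} (hJ : J ≤ m) (hK : K ≤ m)
    (h1 : 0 ≤ x.1) (h2 : 0 ≤ x.2) (hxJ : ∀ j : ℕ, x.1 ≤ ((j : ℝ) + 1) * δ ↔ J ≤ j)
    (hxK : ∀ k : ℕ, x.2 ≤ ((k : ℝ) + 1) * δ ↔ K ≤ k) :
    (gridElem m δ).toFun x = Real.exp (-|((J : ℝ) - K) * δ|) := by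
  rw [Elem.toFun, sum_gridElem m δ _ (fun p => by simp) (fun p b c => by ring)]
  have e1 : ∀ j : ℕ, (Set.Icc 0 (((j : ℝ) + 1) * δ)).indicator (1 : ℝ → ℝ) x.1
      = if J ≤ j then 1 else 0 := by
    intro j
    simp only [Set.indicator_apply, Set.mem_Icc, h1, true_and, hxJ, Pi.one_apply]
  have e2 : ∀ j : ℕ, (Set.Icc 0 (((j : ℝ) + 1) * δ)).indicator (1 : ℝ → ℝ) x.2
      = if K ≤ j then 1 else 0 := by
    intro j
    simp only [Set.indicator_apply, Set.mem_Icc, h2, true_and, hxK, Pi.one_apply]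
  simp only [e1, e2]
  have hz : ∀ j, gridVal m δ j (m + 1) = 0 := fun j => if_neg (by omega)
  have inner : ∀ j : ℕ, ∑ k ∈ Finset.range (m + 1), gridCoeff m δ j k *
      ((if J ≤ j then 1 else 0) * (if K ≤ k then 1 else 0))
      = (gridVal m δ j K - gridVal m δ (j + 1) K) * (if J ≤ j then 1 else 0) := by
    intro j
    have := sum_range_sub_mul_ite (fun k => gridVal m δ j k - gridVal m δ (j + 1) k) (m + 1) K
      (by omega)
    rw [hz, hz, sub_self, sub_zero] at this
    rw [← this, Finset.sum_mul]
    refine Finset.sum_congr rfl fun k _ => ?_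
    rw [gridCoeff]; ring
  simp only [inner]
  have := sum_range_sub_mul_ite (fun j => gridVal m δ j K) (m + 1) J (by omega)
  rw [this, gridVal, gridVal, if_pos ⟨hJ, hK⟩, if_neg (by omega), sub_zero]

theorem exists_grid_index {m : ℕ} {δ x : ℝ} (hδ : 0 < δ) (hx : x ∈ Set.Icc 0 (((m : ℝ) + 1) * δ)) :
    ∃ J : ℕ, J ≤ m ∧ (∀ j : ℕ, x ≤ ((j : ℝ) + 1) * δ ↔ J ≤ j) ∧ |J * δ - x| ≤ δ := by
  have hiff : ∀ j : ℕ, x ≤ ((j : ℝ) + 1) * δ ↔ ⌈x / δ⌉₊ - 1 ≤ j := by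
    intro j
    rw [← div_le_iff₀ hδ, Nat.sub_le_iff_le_add, Nat.ceil_le]
    push_cast; rfl
  -- The cells (Jδ, (J+1)δ] are closed on the right, like the indicators of [0,s]; truncated
  -- subtraction puts x = 0 into cell 0.
  refine ⟨⌈x / δ⌉₊ - 1, (hiff m).1 hx.2, hiff, ?_⟩
  have hu := (hiff (⌈x / δ⌉₊ - 1)).2 le_rfl
  rw [abs_le]
  refine ⟨by linarith, ?_⟩
  rcases Nat.eq_zero_or_pos (⌈x / δ⌉₊ - 1) with h | h
  · rw [h]; push_cast; linarith [hx.1]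
  · have h1 := mt (hiff (⌈x / δ⌉₊ - 1 - 1)).1 (by omega)
    rw [not_le] at h1
    have h2 : ((⌈x / δ⌉₊ - 1 - 1 : ℕ) : ℝ) + 1 = ((⌈x / δ⌉₊ - 1 : ℕ) : ℝ) := by
      exact_mod_cast (show ⌈x / δ⌉₊ - 1 - 1 + 1 = ⌈x / δ⌉₊ - 1 by omega)
    rw [h2] at h1
    linarith

theorem abs_gridElem_toFun_sub_le {m : ℕ} {δ : ℝ} (hδ : 0 < δ) {x : ℝ × ℝ}
    (h1 : x.1 ∈ Set.Icc 0 (((m : ℝ) + 1) * δ)) (h2 : x.2 ∈ Set.Icc 0 (((m : ℝ) + 1) * δ)) :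
    |(gridElem m δ).toFun x - Real.exp (-|x.1 - x.2|)| ≤ 2 * δ := by
  obtain ⟨J, hJm, hJ, hJd⟩ := exists_grid_index hδ h1
  obtain ⟨K, hKm, hK, hKd⟩ := exists_grid_index hδ h2
  rw [gridElem_toFun hJm hKm h1.1 h2.1 hJ hK]
  refine (abs_exp_neg_sub_le (abs_nonneg _) (abs_nonneg _)).trans ?_
  refine (abs_abs_sub_abs_le_abs_sub _ _).trans ?_
  rw [show ((J : ℝ) - K) * δ - (x.1 - x.2) = (J * δ - x.1) - (K * δ - x.2) by ring]
  exact (abs_sub _ _).trans (by linarith)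

theorem abs_second_difference_le {d δ : ℝ} (hδ : 0 ≤ δ) (hd : δ ≤ d) :
    |2 * Real.exp (-d) - Real.exp (-(d + δ)) - Real.exp (-(d - δ))| ≤ δ ^ 2 := by
  have e1 : Real.exp (-d) = Real.exp (-(d - δ)) * Real.exp (-δ) := by
    rw [← Real.exp_add]; congr 1; ring
  have e2 : Real.exp (-(d + δ)) = Real.exp (-(d - δ)) * (Real.exp (-δ) * Real.exp (-δ)) := by
    rw [← Real.exp_add, ← Real.exp_add]; congr 1; ring
  have h1 := Real.add_one_le_exp (-δ)
  have h2 : Real.exp (-δ) ≤ 1 := Real.exp_le_one_iff.2 (by linarith)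
  have h3 : Real.exp (-(d - δ)) ≤ 1 := Real.exp_le_one_iff.2 (by linarith)
  rw [e1, e2, show 2 * (Real.exp (-(d - δ)) * Real.exp (-δ))
      - Real.exp (-(d - δ)) * (Real.exp (-δ) * Real.exp (-δ)) - Real.exp (-(d - δ))
      = -(Real.exp (-(d - δ)) * (1 - Real.exp (-δ)) ^ 2) by ring, abs_neg,
    abs_of_nonneg (by positivity)]
  have h4 : (1 - Real.exp (-δ)) ^ 2 ≤ δ ^ 2 := pow_le_pow_left₀ (by linarith) (by linarith) 2
  nlinarith [sq_nonneg (1 - Real.exp (-δ)), Real.exp_pos (-(d - δ))]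

theorem gridVal_comm (m : ℕ) (δ : ℝ) (j k : ℕ) : gridVal m δ j k = gridVal m δ k j := by
  simp only [gridVal, and_comm (a := j ≤ m)]
  rw [show ((j : ℝ) - k) * δ = -(((k : ℝ) - j) * δ) by ring, abs_neg]

theorem gridCoeff_comm (m : ℕ) (δ : ℝ) (j k : ℕ) : gridCoeff m δ j k = gridCoeff m δ k j := by
  rw [gridCoeff, gridCoeff, gridVal_comm m δ j k, gridVal_comm m δ (j + 1) k,
    gridVal_comm m δ j (k + 1), gridVal_comm m δ (j + 1) (k + 1)]
  ring

/-- Off the diagonal the coefficient is a smooth second difference, of size δ². The kink on the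
diagonal costs 2δ, the cutoff costs δ along the last row and column, and the corner carries mass 1.
-/
theorem abs_gridCoeff_le {m : ℕ} {δ : ℝ} (hδ : 0 ≤ δ) {j k : ℕ} (hj : j ≤ m) (hk : k ≤ m) :
    |gridCoeff m δ j k| ≤ δ ^ 2 + (if j = k then 2 * δ else 0) + (if j = m then δ else 0)
      + (if k = m then δ else 0) + (if j = m then (if k = m then 1 else 0) else 0) := by
  wlog hkj : k ≤ j generalizing j k
  · have := this hk hj (by omega)
    rw [gridCoeff_comm]
    refine this.trans (le_of_eq ?_)
    rw [ite_cond_congr (eq_comm (a := k) (b := j)|> propext)]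
    split_ifs <;> ring
  rcases hkj.eq_or_lt with rfl | hlt
  · rcases hk.eq_or_lt with rfl | hkm
    · have : gridCoeff k δ k k = 1 := by simp [gridCoeff, gridVal]
      rw [this, abs_one]
      simp only [if_true]
      nlinarith [sq_nonneg δ]
    · have : gridCoeff m δ k k = 2 * (1 - Real.exp (-δ)) := by
        have e1 : gridVal m δ k k = 1 := by simp [gridVal, hk]
        have e2 : gridVal m δ (k + 1) (k + 1) = 1 := by simp [gridVal, Nat.succ_le_of_lt hkm]
        have e3 : gridVal m δ (k + 1) k = Real.exp (-δ) := by
          rw [gridVal, if_pos ⟨hkm, hk⟩]; push_cast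
          rw [show ((k : ℝ) + 1 - k) * δ = δ by ring, abs_of_nonneg hδ]
        rw [gridCoeff, e1, e2, gridVal_comm m δ k, e3]; ring
      have h1 := Real.add_one_le_exp (-δ)
      have h2 : Real.exp (-δ) ≤ 1 := Real.exp_le_one_iff.2 (by linarith)
      rw [this, abs_of_nonneg (by linarith), if_pos rfl, if_neg hkm.ne, if_neg hkm.ne]
      nlinarith [sq_nonneg δ]
  · have hd : δ ≤ ((j : ℝ) - k) * δ := by
      have : (k : ℝ) + 1 ≤ j := by exact_mod_cast hlt
      nlinarith
    have hkm : k < m := by omega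
    have e1 : gridVal m δ j k = Real.exp (-(((j : ℝ) - k) * δ)) := by
      rw [gridVal, if_pos ⟨hj, hk⟩, abs_of_nonneg (by linarith)]
    have e2 : gridVal m δ j (k + 1) = Real.exp (-(((j : ℝ) - k) * δ - δ)) := by
      rw [gridVal, if_pos ⟨hj, hkm⟩]; push_cast
      rw [show ((j : ℝ) - (k + 1)) * δ = ((j : ℝ) - k) * δ - δ by ring, abs_of_nonneg (by linarith)]
    rw [if_neg hlt.ne', if_neg hkm.ne]
    rcases hj.eq_or_lt with rfl | hjm
    · have e3 : ∀ i, gridVal j δ (j + 1) i = 0 := fun i => if_neg (by omega)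
      rw [gridCoeff, e1, e2, e3, e3, if_pos rfl, if_pos rfl, if_neg hlt.ne]
      have := abs_exp_neg_sub_le (x := ((j : ℝ) - k) * δ) (y := ((j : ℝ) - k) * δ - δ)
        (by linarith) (by linarith)
      rw [sub_sub_cancel, abs_of_nonneg hδ] at this
      rw [sub_zero, sub_zero]
      nlinarith [sq_nonneg δ]
    · have e3 : gridVal m δ (j + 1) k = Real.exp (-(((j : ℝ) - k) * δ + δ)) := by
        rw [gridVal, if_pos ⟨hjm, hk⟩]; push_cast
        rw [show ((j : ℝ) + 1 - k) * δ = ((j : ℝ) - k) * δ + δ by ring,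
          abs_of_nonneg (by linarith)]
      have e4 : gridVal m δ (j + 1) (k + 1) = Real.exp (-(((j : ℝ) - k) * δ)) := by
        rw [gridVal, if_pos ⟨hjm, hkm⟩]; push_cast
        rw [show ((j : ℝ) + 1 - (k + 1)) * δ = ((j : ℝ) - k) * δ by ring,
          abs_of_nonneg (by linarith)]
      have := abs_second_difference_le hδ hd
      rw [gridCoeff, e1, e2, e3, e4, if_neg hjm.ne, if_neg hjm.ne]
      refine le_trans (le_of_eq ?_) (this.trans (by linarith))
      congr 1; ring

/-- With T = (m+1)δ the contributions add up to T² + 4T + 1. The total variation is thus bounded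
independently of the mesh, which gives the domination needed for existence of the norm. -/
theorem sum_abs_gridCoeff_le {m : ℕ} {δ : ℝ} (hδ : 0 ≤ δ) :
    ∑ j ∈ Finset.range (m + 1), ∑ k ∈ Finset.range (m + 1), |gridCoeff m δ j k|
      ≤ (((m : ℝ) + 1) * δ + 2) ^ 2 := by
  have h : ∀ j ∈ Finset.range (m + 1), ∑ k ∈ Finset.range (m + 1), |gridCoeff m δ j k|
      ≤ ∑ k ∈ Finset.range (m + 1), (δ ^ 2 + (if j = k then 2 * δ else 0) + (if j = m then δ else 0)
      + (if k = m then δ else 0) + (if j = m then (if k = m then 1 else 0) else 0)) :=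
    fun j hj => Finset.sum_le_sum fun k hk => abs_gridCoeff_le hδ
      (Nat.lt_succ_iff.1 (Finset.mem_range.1 hj)) (Nat.lt_succ_iff.1 (Finset.mem_range.1 hk))
  refine (Finset.sum_le_sum h).trans ?_
  simp only [Finset.sum_add_distrib]
  have e1 : ∀ c : ℝ, ∑ j ∈ Finset.range (m + 1), ∑ k ∈ Finset.range (m + 1),
      (if j = k then c else 0) = (m + 1) * c := by
    intro c
    rw [Finset.sum_congr rfl (g := fun _ => c) fun j hj => by rw [Finset.sum_ite_eq, if_pos hj]]
    simp
  have e2 : ∀ c : ℝ, ∑ k ∈ Finset.range (m + 1), (if k = m then c else 0) = c := by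
    intro c; rw [Finset.sum_ite_eq', if_pos (by simp)]
  have e3 : ∀ j : ℕ, ∑ k ∈ Finset.range (m + 1), (if j = m then δ else 0)
      = if j = m then (m + 1) * δ else 0 := by
    intro j; split_ifs <;> simp
  have e4 : ∀ j : ℕ, ∑ k ∈ Finset.range (m + 1), (if j = m then (if k = m then (1:ℝ) else 0) else 0)
      = if j = m then 1 else 0 := by
    intro j; split_ifs
    · exact e2 1
    · simp
  simp only [e1, e3, e4, e2, Finset.sum_const, Finset.card_range, nsmul_eq_mul]
  push_cast
  have : 0 ≤ ((m : ℝ) + 1) * δ := by positivity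
  nlinarith

theorem norm_indHat_le {T t : ℝ} (ht : t ∈ Set.Icc 0 T) (ξ : ℝ) :
    ‖indHat t ξ‖ ≤ Real.sqrt ((T ^ 2 + 4) * (1 + ξ ^ 2)⁻¹) := by
  refine Real.le_sqrt_of_sq_le ?_
  rw [norm_indHat_sq]
  refine (two_sub_two_cos_div_sq_le t ξ).trans ?_
  have := pow_le_pow_left₀ ht.1 ht.2 2
  gcongr

/-- Total variation times the uniform bound on `indHat` in each variable. For fixed (m+1)δ the right
side does not depend on m, and it is integrable against the product spectral measure. -/
theorem norm_gridElem_hat_sq_le {m : ℕ} {δ : ℝ} (hδ : 0 ≤ δ) (z : ℝ × ℝ) :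
    ‖(gridElem m δ).hat z‖ ^ 2 ≤ (((m : ℝ) + 1) * δ + 2) ^ 4 *
      ((((((m : ℝ) + 1) * δ) ^ 2 + 4) * (1 + z.1 ^ 2)⁻¹) *
      (((((m : ℝ) + 1) * δ) ^ 2 + 4) * (1 + z.2 ^ 2)⁻¹)) := by
  set T := ((m : ℝ) + 1) * δ with hT
  have key : ∀ i ∈ Finset.range (m + 1), ((i : ℝ) + 1) * δ ∈ Set.Icc 0 T := by
    intro i hi
    have hi' : (i : ℝ) ≤ m := by exact_mod_cast Nat.lt_succ_iff.1 (Finset.mem_range.1 hi)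
    exact ⟨by positivity, by rw [hT]; gcongr⟩
  set M1 := Real.sqrt ((T ^ 2 + 4) * (1 + z.1 ^ 2)⁻¹) with hM1
  set M2 := Real.sqrt ((T ^ 2 + 4) * (1 + z.2 ^ 2)⁻¹) with hM2
  have hb : ‖(gridElem m δ).hat z‖ ≤ (T + 2) ^ 2 * (M1 * M2) := by
    rw [Elem.hat, sum_gridElem m δ _ (fun p => by simp)
      (fun p b c => by push_cast; ring)]
    refine (norm_sum_le _ _).trans ?_
    refine (Finset.sum_le_sum fun j hj => norm_sum_le _ _).trans ?_
    refine le_trans ?_ (mul_le_mul_of_nonneg_right (sum_abs_gridCoeff_le (m := m) hδ)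
      (by positivity))
    rw [Finset.sum_mul]
    refine Finset.sum_le_sum fun j hj => ?_
    rw [Finset.sum_mul]
    refine Finset.sum_le_sum fun k hk => ?_
    rw [norm_mul, Complex.norm_real, Real.norm_eq_abs, norm_mul]
    gcongr
    · exact norm_indHat_le (key j hj) _
    · exact norm_indHat_le (key k hk) _
  refine (pow_le_pow_left₀ (norm_nonneg _) hb 2).trans (le_of_eq ?_)
  rw [mul_pow, mul_pow, hM1, hM2, Real.sq_sqrt (by positivity), Real.sq_sqrt (by positivity)]
  ring

theorem integrable_fT (T : ℝ) : Integrable (fT T) (volSq T) := by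
  have hm : MeasurableSet (Set.Icc 0 T ×ˢ Set.Icc 0 T) := measurableSet_Icc.prod measurableSet_Icc
  have hc : Continuous fun x : ℝ × ℝ => Real.exp (-|x.1 - x.2|) := by fun_prop
  rw [fT, integrable_indicator_iff hm, IntegrableOn, Measure.restrict_restrict hm, Set.inter_self]
  exact hc.continuousOn.integrableOn_compact (isCompact_Icc.prod isCompact_Icc)

theorem isTensorNormSq_fT (hH0 : 0 < H) (hH1 : H < 1) {T : ℝ} (hT : 0 < T) :
    IsTensorNormSq H T (fT T)
      (∫ z, ‖hatOn T (fT T) z‖ ^ 2 ∂((specMeasure H).prod (specMeasure H))) := by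
  -- The mesh T/(n+1) makes the last node (n+1)δ equal to T exactly.
  have hδ : ∀ n : ℕ, 0 < T / ((n : ℝ) + 1) := fun n => by positivity
  have hTδ : ∀ n : ℕ, ((n : ℝ) + 1) * (T / ((n : ℝ) + 1)) = T := fun n => by field_simp
  have hm : MeasurableSet (Set.Icc 0 T ×ˢ Set.Icc 0 T) := measurableSet_Icc.prod measurableSet_Icc
  refine isTensorNormSq_of_dominated hH0 hH1 (integrable_fT T)
    (φ := fun n => gridElem n (T / ((n : ℝ) + 1))) (fun n => ?_) ?_
    (B := fun z => (T + 2) ^ 4 * (((T ^ 2 + 4) * (1 + z.1 ^ 2)⁻¹) *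
      ((T ^ 2 + 4) * (1 + z.2 ^ 2)⁻¹))) ?_ (fun n z _ _ => ?_)
  · have := gridElem_isOn (m := n) (hδ n).le
    rwa [hTδ] at this
  · have hb : ∀ n : ℕ, eLpNorm (fun x => (gridElem n (T / ((n : ℝ) + 1))).toFun x - fT T x) 2
        (volSq T) ≤ (volSq T) Set.univ ^ (2 : ENNReal).toReal⁻¹
          * ENNReal.ofReal (2 * (T / ((n : ℝ) + 1))) := by
      intro n
      refine eLpNorm_le_of_ae_bound ?_
      filter_upwards [ae_restrict_mem hm] with x hx
      rw [fT, Set.indicator_of_mem hx, Real.norm_eq_abs]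
      refine abs_gridElem_toFun_sub_le (hδ n) ?_ ?_
      · rw [hTδ]; exact hx.1
      · rw [hTδ]; exact hx.2
    have h0 : Tendsto (fun n : ℕ => 2 * (T / ((n : ℝ) + 1))) atTop (𝓝 0) := by
      have := (tendsto_one_div_add_atTop_nhds_zero_nat (𝕜 := ℝ)).const_mul (2 * T)
      rw [mul_zero] at this
      exact this.congr fun n => by ring
    have h1 : Tendsto (fun n : ℕ => (volSq T) Set.univ ^ (2 : ENNReal).toReal⁻¹
          * ENNReal.ofReal (2 * (T / ((n : ℝ) + 1)))) atTop (𝓝 0) := by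
      have := ENNReal.Tendsto.const_mul (ENNReal.tendsto_ofReal h0)
        (a := (volSq T) Set.univ ^ (2 : ENNReal).toReal⁻¹)
        (Or.inr (ENNReal.rpow_ne_top_of_nonneg (by norm_num) (measure_ne_top _ _)))
      rwa [ENNReal.ofReal_zero, mul_zero] at this
    exact tendsto_of_tendsto_of_tendsto_of_le_of_le tendsto_const_nhds h1 (fun _ => zero_le) hb
  · have := (integrable_inv_one_add_sq_specMeasure hH0 hH1).const_mul (T ^ 2 + 4)
    exact (this.mul_prod this).const_mul _
  · have := norm_gridElem_hat_sq_le (m := n) (hδ n).le z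
    rwa [hTδ] at this

theorem isTensorNormSq_fT_iff (hH0 : 0 < H) (hH1 : H < 1) {T : ℝ} (hT : 0 < T) (N : ℝ) :
    IsTensorNormSq H T (fT T) N ↔
      N = ∫ z, ‖hatOn T (fT T) z‖ ^ 2 ∂((specMeasure H).prod (specMeasure H)) :=
  ⟨eq_integral_of_isTensorNormSq hH0 hH1 (integrable_fT T),
    fun h => h ▸ isTensorNormSq_fT hH0 hH1 hT⟩

theorem tensorNormSq_fT (hH0 : 0 < H) (hH1 : H < 1) {T : ℝ} (hT : 0 < T) :
    tensorNormSq H T (fT T) =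
      ∫ z, ‖hatOn T (fT T) z‖ ^ 2 ∂((specMeasure H).prod (specMeasure H)) :=
  (isTensorNormSq_fT_iff hH0 hH1 hT _).1
    (Classical.epsilon_spec ⟨_, isTensorNormSq_fT hH0 hH1 hT⟩)


/-! ### Evaluation of the norm by a mixture of rank-one tensors -/

/-- The mixing measure `δ_T + 2 dr` on `(0, T]`. -/
noncomputable def mixMeasure (T : ℝ) : Measure ℝ := Measure.dirac T + (2 : ENNReal) • volT T

instance (T : ℝ) : IsFiniteMeasure (mixMeasure T) := by
  have : IsFiniteMeasure ((2 : ENNReal) • volT T) := Measure.smul_finite _ (by simp)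
  unfold mixMeasure; infer_instance

theorem integral_mixMeasure {T : ℝ} {g : ℝ → ℝ} (hg : Integrable g (volT T)) :
    ∫ u, g u ∂mixMeasure T = g T + 2 * ∫ u, g u ∂volT T := by
  rw [mixMeasure, integral_add_measure (integrable_dirac (by simp))
    (hg.smul_measure (by simp)), integral_dirac, integral_smul_measure]
  simp

theorem mixMeasure_ae_mem {T : ℝ} (hT : 0 ≤ T) : ∀ᵐ u ∂mixMeasure T, u ∈ Set.Icc 0 T := by
  rw [mixMeasure, ae_add_measure_iff]
  refine ⟨?_, Measure.ae_smul_measure ?_ _⟩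
  · exact (ae_dirac_iff measurableSet_Icc).2 ⟨hT, le_rfl⟩
  · filter_upwards [ae_restrict_mem measurableSet_Ioc] with u hu using ⟨hu.1.le, hu.2⟩

/-- The exponential started at time `T - u`. -/
noncomputable def expFrom (T u t : ℝ) : ℝ :=
  if T - u ≤ t then Real.exp (-(t - (T - u))) else 0

theorem abs_expFrom_le (T u t : ℝ) : |expFrom T u t| ≤ 1 := by
  unfold expFrom
  split_ifs with h
  · rw [abs_of_pos (Real.exp_pos _)]
    exact Real.exp_le_one_iff.2 (by linarith)
  · simp

theorem measurable_expFrom (T : ℝ) : Measurable fun p : ℝ × ℝ => expFrom T p.1 p.2 := by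
  unfold expFrom
  exact Measurable.ite (measurableSet_le (by fun_prop) (by fun_prop)) (by fun_prop) measurable_const

/-- Both factors are nonzero exactly for u ≥ T - min(x,y). The absolutely continuous part
contributes e^(-|x-y|) - e^(-(x+y)), and the atom at T restores the missing e^(-(x+y)). -/
theorem exp_neg_abs_sub_eq_integral {T x y : ℝ} (hx : x ∈ Set.Icc 0 T) (hy : y ∈ Set.Icc 0 T) :
    Real.exp (-|x - y|) = ∫ u, expFrom T u x * expFrom T u y ∂mixMeasure T := by
  have hT : 0 ≤ T := hx.1.trans hx.2
  have hmeas : Measurable fun u => expFrom T u x * expFrom T u y :=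
    ((measurable_expFrom T).comp (measurable_id.prodMk measurable_const)).mul
      ((measurable_expFrom T).comp (measurable_id.prodMk measurable_const))
  have hint : Integrable (fun u => expFrom T u x * expFrom T u y) (volT T) := by
    refine Integrable.of_bound hmeas.aestronglyMeasurable 1 (ae_of_all _ fun u => ?_)
    rw [norm_mul]
    exact mul_le_one₀ (abs_expFrom_le _ _ _) (norm_nonneg _) (abs_expFrom_le _ _ _)
  rw [integral_mixMeasure hint]
  have hprod : ∀ u, expFrom T u x * expFrom T u y
      = (Set.Ici (T - min x y)).indicator (fun u => Real.exp (-(x + y - 2 * T + 2 * u))) u := by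
    intro u
    unfold expFrom
    by_cases h : u ∈ Set.Ici (T - min x y)
    · have h' : T - min x y ≤ u := h
      rw [Set.indicator_of_mem h, if_pos (by linarith [min_le_left x y]),
        if_pos (by linarith [min_le_right x y]), ← Real.exp_add]
      congr 1; ring
    · rw [Set.indicator_of_notMem h]
      have h' : u < T - min x y := not_le.1 h
      rcases min_choice x y with e | e
      · rw [if_neg (by rw [e] at h'; linarith), zero_mul]
      · rw [if_neg (c := T - u ≤ y) (by rw [e] at h'; linarith), mul_zero]
  have hm0 : 0 ≤ min x y := le_min hx.1 hy.1
  have hmT : min x y ≤ T := (min_le_left _ _).trans hx.2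
  have hset : (Set.Ici (T - min x y) ∩ Set.Ioc 0 T : Set ℝ) =ᵐ[volume] Set.Ioc (T - min x y) T := by
    have he : (Set.Ioi (T - min x y) ∩ Set.Ioc 0 T : Set ℝ) = Set.Ioc (T - min x y) T := by
      rw [Set.inter_comm, Set.Ioc_inter_Ioi, sup_eq_right.2 (by linarith)]
    rw [← he]
    exact Ioi_ae_eq_Ici.symm.inter (ae_eq_refl (Set.Ioc 0 T))
  simp only [hprod]
  rw [integral_indicator measurableSet_Ici, Measure.restrict_restrict measurableSet_Ici,
    Measure.restrict_congr_set hset, ← intervalIntegral.integral_of_le (by linarith),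
    Set.indicator_of_mem (show T ∈ Set.Ici (T - min x y) from sub_le_self _ hm0)]
  have hderiv : ∀ u ∈ Set.uIcc (T - min x y) T,
      HasDerivAt (fun u => -(1 / 2) * Real.exp (-(x + y - 2 * T + 2 * u)))
        (Real.exp (-(x + y - 2 * T + 2 * u))) u := by
    intro u _
    have h1 : HasDerivAt (fun u : ℝ => -(x + y - 2 * T + 2 * u)) (-(2 * 1)) u :=
      (((hasDerivAt_id u).const_mul 2).const_add (x + y - 2 * T)).neg
    exact (h1.exp.const_mul _).congr_deriv (by ring)
  rw [intervalIntegral.integral_eq_sub_of_hasDerivAt hderiv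
    (Continuous.intervalIntegrable (by fun_prop) _ _)]
  have e : |x - y| = x + y - 2 * min x y := by
    rcases le_total x y with h | h
    · rw [min_eq_left h, abs_of_nonpos (by linarith)]; ring
    · rw [min_eq_right h, abs_of_nonneg (by linarith)]; ring
  rw [e, show x + y - 2 * T + 2 * (T - min x y) = x + y - 2 * min x y by ring]
  ring

/-- The Fourier transform of `expFrom`, up to a phase. -/
noncomputable def expHat (u ξ : ℝ) : ℂ :=
  (Complex.exp ((-(u * ξ) : ℝ) * Complex.I) - (Real.exp (-u) : ℂ)) / (1 - ξ * Complex.I)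

theorem one_sub_mul_I_ne_zero (ξ : ℝ) : (1 : ℂ) - ξ * Complex.I ≠ 0 := by
  intro h
  have := congrArg Complex.re h
  simp at this

theorem measurable_expHat {α : Type*} [MeasurableSpace α] {f g : α → ℝ} (hf : Measurable f)
    (hg : Measurable g) : Measurable fun p => expHat (f p) (g p) := by
  unfold expHat
  fun_prop

/-- The factor e^(iTξ) does not depend on u, so it leaves the integral over the mixture and
disappears in the modulus. -/
theorem integral_expFrom_mul_exp {T u : ℝ} (hu : u ∈ Set.Icc 0 T) (ξ : ℝ) :
    ∫ t in Set.Icc 0 T, (expFrom T u t : ℂ) * Complex.exp ((t * ξ : ℝ) * Complex.I)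
      = Complex.exp ((T * ξ : ℝ) * Complex.I) * expHat u ξ := by
  have hc : (ξ : ℂ) * Complex.I - 1 ≠ 0 := by
    rw [← neg_sub]; exact neg_ne_zero.2 (one_sub_mul_I_ne_zero ξ)
  have h : ∀ t : ℝ, (expFrom T u t : ℂ) * Complex.exp ((t * ξ : ℝ) * Complex.I)
      = (Set.Ici (T - u)).indicator (fun t : ℝ => (Real.exp (T - u) : ℂ) *
        Complex.exp (((ξ : ℂ) * Complex.I - 1) * t)) t := by
    intro t
    unfold expFrom
    by_cases ht : T - u ≤ t
    · rw [if_pos ht, Set.indicator_of_mem (show t ∈ Set.Ici (T - u) from ht), Complex.ofReal_exp,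
        Complex.ofReal_exp, ← Complex.exp_add, ← Complex.exp_add]
      congr 1; push_cast; ring
    · rw [if_neg ht, Set.indicator_of_notMem (show t ∉ Set.Ici (T - u) from ht)]
      simp
  simp only [h]
  have hset : (Set.Icc 0 T ∩ Set.Ici (T - u) : Set ℝ) = Set.Icc (T - u) T := by
    ext t
    simp only [Set.mem_inter_iff, Set.mem_Icc, Set.mem_Ici]
    constructor
    · rintro ⟨h1, h2⟩; exact ⟨h2, h1.2⟩
    · rintro ⟨h1, h2⟩; exact ⟨⟨by linarith [hu.2], h2⟩, h1⟩
  rw [setIntegral_indicator measurableSet_Ici, hset, integral_Icc_eq_integral_Ioc,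
    ← intervalIntegral.integral_of_le (by linarith [hu.1]), intervalIntegral.integral_const_mul,
    integral_exp_mul_complex hc, expHat, mul_div_assoc', mul_div_assoc',
    div_eq_div_iff hc (one_sub_mul_I_ne_zero ξ)]
  have e1 : (Real.exp (T - u) : ℂ) * Complex.exp (((ξ : ℂ) * Complex.I - 1) * T)
      = Complex.exp ((T * ξ : ℝ) * Complex.I) * (Real.exp (-u) : ℂ) := by
    rw [Complex.ofReal_exp, Complex.ofReal_exp, ← Complex.exp_add, ← Complex.exp_add]
    congr 1; push_cast; ring
  have e2 : (Real.exp (T - u) : ℂ) * Complex.exp (((ξ : ℂ) * Complex.I - 1) * (T - u : ℝ))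
      = Complex.exp ((T * ξ : ℝ) * Complex.I) * Complex.exp ((-(u * ξ) : ℝ) * Complex.I) := by
    rw [Complex.ofReal_exp, ← Complex.exp_add, ← Complex.exp_add]
    congr 1; push_cast; ring
  linear_combination (1 - (ξ : ℂ) * Complex.I) * (e1 - e2)

theorem hatOn_fT {T : ℝ} (hT : 0 ≤ T) (z : ℝ × ℝ) :
    hatOn T (fT T) z = Complex.exp ((T * z.1 : ℝ) * Complex.I) *
      Complex.exp ((T * z.2 : ℝ) * Complex.I) *
      ∫ u, expHat u z.1 * expHat u z.2 ∂mixMeasure T := by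
  have hm : MeasurableSet (Set.Icc 0 T ×ˢ Set.Icc 0 T) := measurableSet_Icc.prod measurableSet_Icc
  have h1 : hatOn T (fT T) z = ∫ x, ∫ u, ((expFrom T u x.1 * expFrom T u x.2 : ℝ) : ℂ) * char2 z x
      ∂mixMeasure T ∂volSq T := by
    rw [hatOn]
    refine integral_congr_ae ?_
    filter_upwards [ae_restrict_mem hm] with x hx
    rw [fT, Set.indicator_of_mem hx, exp_neg_abs_sub_eq_integral hx.1 hx.2,
      ← integral_complex_ofReal, integral_mul_const]
  have hmeas : Measurable (Function.uncurry fun (x : ℝ × ℝ) (u : ℝ) =>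
      ((expFrom T u x.1 * expFrom T u x.2 : ℝ) : ℂ) * char2 z x) := by
    have m1 : Measurable fun p : (ℝ × ℝ) × ℝ => expFrom T p.2 p.1.1 :=
      (measurable_expFrom T).comp (by fun_prop : Measurable fun p : (ℝ × ℝ) × ℝ => (p.2, p.1.1))
    have m2 : Measurable fun p : (ℝ × ℝ) × ℝ => expFrom T p.2 p.1.2 :=
      (measurable_expFrom T).comp (by fun_prop : Measurable fun p : (ℝ × ℝ) × ℝ => (p.2, p.1.2))
    exact (Complex.measurable_ofReal.comp (m1.mul m2)).mul
      ((continuous_char2 z).measurable.comp measurable_fst)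
  rw [h1, integral_integral_swap, ← integral_const_mul]
  · refine integral_congr_ae ?_
    filter_upwards [mixMeasure_ae_mem hT] with u hu
    have e : ∀ x : ℝ × ℝ, ((expFrom T u x.1 * expFrom T u x.2 : ℝ) : ℂ) * char2 z x
        = ((expFrom T u x.1 : ℂ) * Complex.exp ((x.1 * z.1 : ℝ) * Complex.I))
          * ((expFrom T u x.2 : ℂ) * Complex.exp ((x.2 * z.2 : ℝ) * Complex.I)) := by
      intro x; rw [char2]; push_cast; ring
    simp only [e]
    rw [volSq_eq, integral_prod_mul
      (fun t : ℝ => (expFrom T u t : ℂ) * Complex.exp ((t * z.1 : ℝ) * Complex.I))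
      (fun t : ℝ => (expFrom T u t : ℂ) * Complex.exp ((t * z.2 : ℝ) * Complex.I)),
      integral_expFrom_mul_exp hu, integral_expFrom_mul_exp hu]
    ring
  · refine Integrable.of_bound hmeas.aestronglyMeasurable 1 (ae_of_all _ fun p => ?_)
    simp only [Function.uncurry]
    rw [norm_mul, norm_char2, mul_one, Complex.norm_real, norm_mul]
    exact mul_le_one₀ (abs_expFrom_le _ _ _) (norm_nonneg _) (abs_expFrom_le _ _ _)

theorem norm_expHat_mul_expHat_le {u v : ℝ} (hu : 0 ≤ u) (hv : 0 ≤ v) (ξ : ℝ) :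
    ‖expHat u ξ * (starRingEnd ℂ) (expHat v ξ)‖ ≤ 4 * (1 + ξ ^ 2)⁻¹ := by
  have hn : ∀ u, 0 ≤ u → ‖Complex.exp ((-(u * ξ) : ℝ) * Complex.I) - (Real.exp (-u) : ℂ)‖ ≤ 2 := by
    intro u hu
    refine (norm_sub_le _ _).trans ?_
    rw [Complex.norm_exp_ofReal_mul_I, Complex.norm_real, Real.norm_eq_abs,
      abs_of_pos (Real.exp_pos _)]
    linarith [Real.exp_le_one_iff.2 (neg_nonpos.2 hu)]
  have hd : ‖(1 : ℂ) - ξ * Complex.I‖ * ‖(1 : ℂ) - ξ * Complex.I‖ = 1 + ξ ^ 2 := by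
    rw [← sq, ← Complex.normSq_eq_norm_sq, Complex.normSq_apply]
    simp; ring
  rw [norm_mul, RCLike.norm_conj, expHat, expHat, norm_div, norm_div, div_mul_div_comm, hd,
    div_eq_mul_inv]
  have := mul_le_mul (hn u hu) (hn v hv) (norm_nonneg _) (by norm_num)
  gcongr
  linarith

/-- The conjugate denominators multiply to 1 + ξ². The real part consists of the four terms of `rho`
under the spectral integral (cos 0 standing for γ(0)), and the imaginary part is odd. -/
theorem expHat_mul_conj (u v ξ : ℝ) : expHat u ξ * (starRingEnd ℂ) (expHat v ξ)
    = ((Real.cos ((u - v) * ξ) * (1 + ξ ^ 2)⁻¹ - Real.exp (-v) * (Real.cos (u * ξ) * (1 + ξ ^ 2)⁻¹)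
        - Real.exp (-u) * (Real.cos (v * ξ) * (1 + ξ ^ 2)⁻¹)
        + Real.exp (-u) * Real.exp (-v) * (Real.cos (0 * ξ) * (1 + ξ ^ 2)⁻¹) : ℝ) : ℂ)
      + (((-Real.sin ((u - v) * ξ) + Real.exp (-v) * Real.sin (u * ξ)
        - Real.exp (-u) * Real.sin (v * ξ)) * (1 + ξ ^ 2)⁻¹ : ℝ) : ℂ) * Complex.I := by
  have hd : ((1 : ℂ) - ξ * Complex.I) * (1 + ξ * Complex.I) = 1 + (ξ : ℂ) ^ 2 := by
    linear_combination (-(ξ : ℂ) ^ 2) * Complex.I_sq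
  have hsub : (u - v) * ξ = u * ξ - v * ξ := by ring
  unfold expHat
  rw [hsub, Real.cos_sub, Real.sin_sub, zero_mul, Real.cos_zero, map_div₀, map_sub, map_sub, map_one,
    map_mul, ← Complex.exp_conj, map_mul, Complex.conj_I, Complex.conj_ofReal, Complex.conj_ofReal,
    Complex.conj_ofReal, mul_neg, mul_neg, sub_neg_eq_add,
    show -(((-(v * ξ) : ℝ) : ℂ) * Complex.I) = ((v * ξ : ℝ) : ℂ) * Complex.I by push_cast; ring,
    Complex.exp_mul_I, Complex.exp_mul_I, div_mul_div_comm, hd, div_eq_mul_inv]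
  simp only [← Complex.ofReal_cos, ← Complex.ofReal_sin, Real.cos_neg, Real.sin_neg]
  push_cast
  generalize Complex.cos (u * ξ) = a
  generalize Complex.cos (v * ξ) = b
  generalize Complex.sin (u * ξ) = c
  generalize Complex.sin (v * ξ) = d
  generalize (1 + (ξ : ℂ) ^ 2)⁻¹ = e
  linear_combination (-c * d * e) * Complex.I_sq

theorem integral_expHat_mul_conj (hH0 : 0 < H) (hH1 : H < 1) {u v : ℝ} (hu : 0 ≤ u) (hv : 0 ≤ v) :
    ∫ ξ, expHat u ξ * (starRingEnd ℂ) (expHat v ξ) ∂(specMeasure H) = (rho H u v : ℂ) := by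
  have hi : Integrable (fun ξ => expHat u ξ * (starRingEnd ℂ) (expHat v ξ)) (specMeasure H) :=
    ((integrable_inv_one_add_sq_specMeasure hH0 hH1).const_mul 4).mono'
      ((measurable_expHat measurable_const measurable_id).mul
        (Complex.continuous_conj.measurable.comp (measurable_expHat measurable_const measurable_id))).aestronglyMeasurable
      (ae_of_all _ fun ξ => norm_expHat_mul_expHat_le hu hv ξ)
  have e := expHat_mul_conj u v
  have i := fun t => integrable_cos_mul (integrable_inv_one_add_sq_specMeasure hH0 hH1) t
  apply Complex.ext
  · have h := integral_re hi
    simp only [RCLike.re_to_complex] at h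
    rw [← h, Complex.ofReal_re]
    simp only [e, Complex.add_re, Complex.ofReal_re, Complex.re_ofReal_mul,
        Complex.I_re, mul_zero, add_zero]
    have i1 := i (u - v)
    have i2 := (i u).const_mul (Real.exp (-v))
    have i3 := (i v).const_mul (Real.exp (-u))
    have i4 := (i 0).const_mul (Real.exp (-u) * Real.exp (-v))
    have h9 := integral_add' ((i1.sub i2).sub i3) i4
    rw [integral_sub' (i1.sub i2) i3, integral_sub' i1 i2] at h9
    simp only [integral_const_mul] at h9
    exact h9
  · have h := integral_im hi
    simp only [RCLike.im_to_complex] at h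
    rw [← h, Complex.ofReal_im]
    refine integral_odd_specMeasure hH0 hH1 fun ξ => ?_
    rw [e, e]
    simp only [Complex.add_im, Complex.ofReal_im, Complex.im_ofReal_mul, Complex.I_im, mul_one,
      zero_add, mul_neg, Real.sin_neg, neg_sq]
    ring

/-- The modulus squared of an integral over u is a double integral over (u,v). After exchanging the
order the two frequencies separate and each gives ρ(u,v), whence the square. -/
theorem integral_norm_hatOn_fT_sq (hH0 : 0 < H) (hH1 : H < 1) {T : ℝ} (hT : 0 ≤ T) :
    ∫ z, ‖hatOn T (fT T) z‖ ^ 2 ∂((specMeasure H).prod (specMeasure H))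
      = ∫ w : ℝ × ℝ, rho H w.1 w.2 ^ 2 ∂((mixMeasure T).prod (mixMeasure T)) := by
  have hae : ∀ᵐ w ∂((mixMeasure T).prod (mixMeasure T)), 0 ≤ w.1 ∧ 0 ≤ w.2 := by
    have h0 : ∀ᵐ u ∂mixMeasure T, 0 ≤ u := (mixMeasure_ae_mem hT).mono fun u hu => hu.1
    exact (Measure.quasiMeasurePreserving_fst.ae h0).and (Measure.quasiMeasurePreserving_snd.ae h0)
  have hsq : ∀ z : ℝ × ℝ, ((‖hatOn T (fT T) z‖ ^ 2 : ℝ) : ℂ) =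
      ∫ w : ℝ × ℝ, (expHat w.1 z.1 * (starRingEnd ℂ) (expHat w.2 z.1)) *
        (expHat w.1 z.2 * (starRingEnd ℂ) (expHat w.2 z.2))
        ∂((mixMeasure T).prod (mixMeasure T)) := by
    intro z
    rw [hatOn_fT hT, norm_mul, norm_mul, Complex.norm_exp_ofReal_mul_I,
      Complex.norm_exp_ofReal_mul_I, one_mul, one_mul, Complex.ofReal_pow, ← Complex.mul_conj',
      ← integral_conj, ← integral_prod_mul]
    refine integral_congr_ae (ae_of_all _ fun w => ?_)
    simp only [map_mul]
    ring
  rw [← Complex.ofReal_inj, ← integral_complex_ofReal, ← integral_complex_ofReal]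
  simp only [hsq]
  rw [integral_integral_swap]
  · refine integral_congr_ae ?_
    filter_upwards [hae] with w hw
    rw [integral_prod_mul (fun ξ => expHat w.1 ξ * (starRingEnd ℂ) (expHat w.2 ξ))
      (fun ξ => expHat w.1 ξ * (starRingEnd ℂ) (expHat w.2 ξ)),
      integral_expHat_mul_conj hH0 hH1 hw.1 hw.2]
    push_cast; ring
  · have hB := (integrable_inv_one_add_sq_specMeasure hH0 hH1).const_mul 4
    have hB2 := (hB.mul_prod hB).mul_prod
      (integrable_const (μ := (mixMeasure T).prod (mixMeasure T)) (1 : ℝ))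
    refine hB2.mono' ?_ ?_
    · refine Measurable.aestronglyMeasurable ?_
      have m1 := measurable_expHat (f := fun p : (ℝ × ℝ) × (ℝ × ℝ) => p.2.1)
        (g := fun p => p.1.1) (by fun_prop) (by fun_prop)
      have m2 := measurable_expHat (f := fun p : (ℝ × ℝ) × (ℝ × ℝ) => p.2.2)
        (g := fun p => p.1.1) (by fun_prop) (by fun_prop)
      have m3 := measurable_expHat (f := fun p : (ℝ × ℝ) × (ℝ × ℝ) => p.2.1)
        (g := fun p => p.1.2) (by fun_prop) (by fun_prop)
      have m4 := measurable_expHat (f := fun p : (ℝ × ℝ) × (ℝ × ℝ) => p.2.2)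
        (g := fun p => p.1.2) (by fun_prop) (by fun_prop)
      exact (m1.mul (Complex.continuous_conj.measurable.comp m2)).mul
        (m3.mul (Complex.continuous_conj.measurable.comp m4))
    · filter_upwards [Measure.quasiMeasurePreserving_snd.ae hae] with p hp
      simp only [Function.uncurry]
      rw [norm_mul, mul_one]
      exact mul_le_mul (norm_expHat_mul_expHat_le hp.1 hp.2 _)
        (norm_expHat_mul_expHat_le hp.1 hp.2 _) (norm_nonneg _) (by positivity)

theorem rho_comm (u v : ℝ) : rho H u v = rho H v u := by
  rw [rho, rho, ← gam_neg (u - v), neg_sub]; ring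

/-- Atom times atom gives the first term of `normFun`. The two equal mixed products give 2 · 2 = 4,
and the two densities give 2² = 4. -/
theorem integral_rho_sq_mixMeasure (hH0 : 0 < H) (hH1 : H < 1) {T : ℝ} (hT : 0 ≤ T) :
    ∫ w : ℝ × ℝ, rho H w.1 w.2 ^ 2 ∂((mixMeasure T).prod (mixMeasure T)) = normFun H T := by
  have hc := continuous_rho hH0 hH1
  have hc2 : Continuous fun w : ℝ × ℝ => rho H w.1 w.2 ^ 2 := hc.pow 2
  have hcu : ∀ u, Continuous fun v => rho H u v ^ 2 := fun u =>
    Continuous.comp (f := fun v : ℝ => (u, v)) hc2 (by fun_prop)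
  have hi : Integrable (fun w : ℝ × ℝ => rho H w.1 w.2 ^ 2) ((volT T).prod (volT T)) :=
    integrable_volT_prod hc2 T
  have hmix : Integrable (fun w : ℝ × ℝ => rho H w.1 w.2 ^ 2)
      ((mixMeasure T).prod (mixMeasure T)) := by
    obtain ⟨C, hC⟩ := (isCompact_Icc.prod isCompact_Icc :
      IsCompact (Set.Icc 0 T ×ˢ Set.Icc 0 T)).exists_bound_of_continuousOn hc2.continuousOn
    have h0 := mixMeasure_ae_mem hT
    refine Integrable.of_bound hc2.aestronglyMeasurable C ?_
    filter_upwards [Measure.quasiMeasurePreserving_fst.ae h0,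
      Measure.quasiMeasurePreserving_snd.ae h0] with w h1 h2
    exact hC w ⟨h1, h2⟩
  rw [integral_prod _ hmix]
  simp only [integral_mixMeasure (integrable_volT (hcu _) T)]
  have i1 : Integrable (fun u => rho H u T ^ 2) (volT T) :=
    integrable_volT (Continuous.comp (f := fun u : ℝ => (u, T)) hc2 (by fun_prop)) T
  have i2 : Integrable (fun u => 2 * ∫ v, rho H u v ^ 2 ∂volT T) (volT T) :=
    hi.integral_prod_left.const_mul 2
  have i12 : Integrable (fun u => rho H u T ^ 2 + 2 * ∫ v, rho H u v ^ 2 ∂volT T) (volT T) :=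
    i1.add i2
  rw [integral_mixMeasure i12, integral_add i1 i2, integral_const_mul, normFun, integral_prod _ hi]
  simp only [rho_comm _ T]
  ring

theorem tensorNormSq_fT_eq (hH0 : 0 < H) (hH1 : H < 1) {T : ℝ} (hT : 0 < T) :
    tensorNormSq H T (fT T) = normFun H T := by
  rw [tensorNormSq_fT hH0 hH1 hT, integral_norm_hatOn_fT_sq hH0 hH1 hT.le,
    integral_rho_sq_mixMeasure hH0 hH1 hT.le]


/-! ### Conclusion: uniqueness of the line and the main theorem -/

theorem eq_of_tendsto_sub_line {F : ℝ → ℝ} {m b m' b' : ℝ}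
    (h : Tendsto (fun T => F T - (m * T + b)) atTop (𝓝 0))
    (h' : Tendsto (fun T => F T - (m' * T + b')) atTop (𝓝 0)) : m = m' ∧ b = b' := by
  have hd : Tendsto (fun T : ℝ => (m' - m) * T + (b' - b)) atTop (𝓝 0) := by
    have := h.sub h'
    rw [sub_zero] at this
    exact this.congr fun T => by ring
  have hm : m' - m = 0 := by
    have h1 := hd.mul tendsto_inv_atTop_zero
    have h2 : Tendsto (fun T : ℝ => (m' - m) + (b' - b) * T⁻¹) atTop (𝓝 (m' - m)) := by
      simpa using (tendsto_inv_atTop_zero.const_mul (b' - b)).const_add (m' - m)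
    rw [zero_mul] at h1
    refine tendsto_nhds_unique h2 (h1.congr' ?_)
    filter_upwards [eventually_gt_atTop 0] with T hT
    field_simp
  rw [hm] at hd
  simp only [zero_mul, zero_add] at hd
  have hb := tendsto_nhds_unique hd tendsto_const_nhds
  exact ⟨by linarith, by linarith⟩

theorem hasObliqueAsymptote_iff (hH0 : 0 < H) (hH1 : H < 1) (m b : ℝ) :
    HasObliqueAsymptote (fun T => (1 / 2) * tensorNormSq H T (fT T)) m b ↔
      m ≠ 0 ∧ Tendsto (fun T => 1 / 2 * normFun H T - (m * T + b)) atTop (𝓝 0) := by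
  refine and_congr Iff.rfl (tendsto_congr' ?_)
  filter_upwards [eventually_gt_atTop 0] with T hT
  rw [tensorNormSq_fT_eq hH0 hH1 hT]

end FBM

theorem mainTheorem3 (H : ℝ) (hH0 : 0 < H) (hH1 : H < 1) :
    (∀ T : ℝ, 0 < T → ∃! N : ℝ, FBM.IsTensorNormSq H T (FBM.fT T) N) ∧
    ((∃ m b : ℝ, FBM.HasObliqueAsymptote
        (fun T => (1 / 2) * FBM.tensorNormSq H T (FBM.fT T)) m b) ↔ H ≤ 1 / 2) ∧
    (∀ m b : ℝ, FBM.HasObliqueAsymptote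
        (fun T => (1 / 2) * FBM.tensorNormSq H T (FBM.fT T)) m b →
      m = FBM.sigmaSq H ∧
      b = -((4 * H - 1) / 2) * FBM.sigmaSq H
        - (2 * H - 1) * (2 * H + 1) * FBM.a H ^ 2) := by
  -- For H > 1/2 every affine approximation is excluded, a horizontal one included.
  have hle : ∀ m b : ℝ, Tendsto (fun T => 1 / 2 * FBM.normFun H T - (m * T + b)) atTop (𝓝 0) →
      H ≤ 1 / 2 := fun m b h => by
    by_contra hH
    exact FBM.not_tendsto_normFun_sub (not_le.1 hH) hH1 m b h
  simp only [FBM.hasObliqueAsymptote_iff hH0 hH1]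
  refine ⟨fun T hT => ⟨_, FBM.isTensorNormSq_fT hH0 hH1 hT, fun N hN =>
    (FBM.isTensorNormSq_fT_iff hH0 hH1 hT N).1 hN⟩, ⟨?_, fun hH => ?_⟩, ?_⟩
  · rintro ⟨m, b, -, h⟩
    exact hle m b h
  · exact ⟨_, _, (FBM.sigmaSq_pos hH0 hH).ne', FBM.tendsto_normFun_sub hH0 hH⟩
  · rintro m b ⟨-, h⟩
    exact FBM.eq_of_tendsto_sub_line h (FBM.tendsto_normFun_sub hH0 (hle m b h))
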